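/- **Setting.** Let $\mathbb K=\mathbb R$ or $\mathbb C$, let $(M,\omega)$ be a symplectic manifold, and let $E=E^+\oplus E^-$ be a smooth finite-rank $\mathbb Z_2$-graded $\mathbb K$-vector bundle over $M$. Let $\Omega(M)$, $\Omega(M,E)$, $\Omega(M,\mathrm{End}\,E)$ be the spaces of smooth forms on $M$ of arbitrary (mixed) degree with values in $\mathbb K$, $E$ and the bundle of $\mathbb K$-linear endomorphisms of $E$. Put $\mathrm{End}^+E=\mathrm{Hom}(E^+,E^+)\oplus\mathrm{Hom}(E^-,E^-)$ and $\mathrm{End}^-E=\mathrm{Hom}(E^+,E^-)\oplus\mathrm{Hom}(E^-,E^+)$, and for $F=E$ or $F=\mathrm{End}\,E$ put $$\Omega^{+}(M,F)=\sum_{i\text{ even}}\Omega^i(M,F^+)\oplus\sum_{i\text{ odd}}\Omega^i(M,F^-),\qquad \Omega^{-}(M,F)=\sum_{i\text{ odd}}\Omega^i(M,F^+)\oplus\sum_{i\text{ even}}\Omega^i(M,F^-).$$ Let $\Pi$ be the operator on $\Omega(M,E)$ equal to $\pm1$ on $\Omega^\pm(M,E)$. An element of $\Omega(M,\mathrm{End}\,E)$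 acts on $\Omega(M,E)$ by $(\alpha\otimes L)(\beta\otimes v)=(-1)^{|L||\beta|}(\alpha\wedge\beta)\otimes Lv$, and its supertrace in $\Omega(M)$ is given by $\mathrm{Str}(\alpha\otimes L)=\bigl(\mathrm{tr}\,L|_{E^+\to E^+}-\mathrm{tr}\,L|_{E^-\to E^-}\bigr)\alpha$. A *superconnection* on $E$ is a $\mathbb K$-linear operator $A$ on $\Omega(M,E)$ that maps $\Omega^\pm(M,E)$ to $\Omega^\mp(M,E)$ and satisfies $A(\alpha\wedge\theta)=d\alpha\wedge\theta+(-1)^{|\alpha|}\alpha\wedge A\theta$ for $\alpha\in\Omega(M)$, $\theta\in\Omega(M,E)$. A *primitive superconnection* is a map $$\mathbb A:\ \Omega(M,E)\oplus\Omega(M,E)\to\Omega(M,E)\oplus\Omega(M,E),\qquad (\alpha,\beta)\mapsto(A\alpha+\omega\wedge\beta,\ B\alpha-A\beta),$$ where $A$ is a superconnection on $E$ and $B\in\Omega^+(M,\mathrm{End}\,E)$. A family $\mathbb A_t$ $(t\in\mathbb R)$ of primitive superconnections, given by $A_t$ and $B_t$, is *smooth* if for every $\theta\in\Omega(M,E)$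 the forms $A_t\theta$ and $B_t\theta$ depend smoothly on $(t,x)\in\mathbb R\times M$; then $$\frac{d\mathbb A_t}{dt}(\alpha,\beta)=\Bigl(\frac{dA_t}{dt}\alpha,\ \frac{dB_t}{dt}\alpha-\frac{dA_t}{dt}\beta\Bigr).$$ A pair $(D,\tilde D)\in\Omega(M,\mathrm{End}\,E)\oplus\Omega(M,\mathrm{End}\,E)$ is identified with the operator $$(\alpha,\beta)\mapsto(D\alpha,\ \tilde D\alpha+\Pi D\Pi\beta)$$ on $\Omega(M,E)\oplus\Omega(M,E)$, and the supertrace of an operator $\mathbb D$ identified with $(D,\tilde D)$ is $\mathbf{Str}(\mathbb D)=(\mathrm{Str}\,D,\mathrm{Str}\,\tilde D)\in\Omega(M)\oplus\Omega(M)$. For $(\alpha,\beta)\in\Omega(M)\oplus\Omega(M)$ let $\partial(\alpha,\beta)=(d\alpha+\omega\wedge\beta,\,-d\beta)$. **Theorem.** Let $\mathbb A_t$ $(t\in\mathbb R)$ be a smooth family of primitive superconnections. For every $t$ and every $k\ge 0$ the operator $\mathbb A_t^{2k}$ is identified with a unique pair, and this pair lies in $\Omega^+(M,\mathrm{End}\,E)\oplus\Omega^-(M,\mathrm{End}\,E)$.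 For every $t$ and every $k\ge1$ the operator $\frac{d\mathbb A_t}{dt}\mathbb A_t^{2k-2}$ is identified with a unique pair, and this pair lies in $\Omega^-(M,\mathrm{End}\,E)\oplus\Omega^+(M,\mathrm{End}\,E)$. Moreover, for every polynomial $f\in\mathbb K[z]$ and every $t\in\mathbb R$: 1. $\partial\,\mathbf{Str}\bigl(f(\mathbb A_t^2)\bigr)=(0,0)$; 2. $\dfrac{d}{dt}\mathbf{Str}\bigl(f(\mathbb A_t^2)\bigr)=\partial\,\mathbf{Str}\Bigl(\dfrac{d\mathbb A_t}{dt}f'(\mathbb A_t^2)\Bigr)$, where in particular the derivative on the left (taken pointwise on $M$) exists. -/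

import Mathlib

open Bundle
open scoped Manifold ContDiff

namespace PrimitiveChernWeil

noncomputable section

set_option linter.unusedSectionVars false

/-! ### Exterior products of (inhomogeneous) alternating forms on a vector space -/

section Algebra

variable {T N₁ N₂ N : Type*} [AddCommGroup T] [Module ℝ T] [AddCommGroup N₁] [Module ℝ N₁]
  [AddCommGroup N₂] [Module ℝ N₂] [AddCommGroup N] [Module ℝ N]

/-- The exterior product of the inhomogeneous forms `α = ∑ᵢ αᵢ` and `β = ∑ⱼ βⱼ`, whose values are
multiplied by the bilinear maps `b j` (which may depend on the degree `j` of the second factor):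
the component of degree `n` is the sum over `i + j = n` of the usual (shuffle) products. -/
def wedgeWith (b : ℕ → N₁ →ₗ[ℝ] N₂ →ₗ[ℝ] N) (α : ∀ n : ℕ, T [⋀^Fin n]→ₗ[ℝ] N₁)
    (β : ∀ n : ℕ, T [⋀^Fin n]→ₗ[ℝ] N₂) (n : ℕ) : T [⋀^Fin n]→ₗ[ℝ] N :=
  ∑ i : Fin (n + 1),
    ((TensorProduct.lift (b (n - i))).compAlternatingMap
      ((α i).domCoprod (β (n - i)))).domDomCongr (finSumFinEquiv.trans (finCongr (by omega)))

theorem alternating_sum_apply {ι : Type*} {n : ℕ} (s : Finset ι) (f : ι → T [⋀^Fin n]→ₗ[ℝ] N)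
    (v : Fin n → T) : (∑ i ∈ s, f i) v = ∑ i ∈ s, f i v := by
  classical
  induction s using Finset.induction_on with
  | empty => simp
  | insert a s ha ih => rw [Finset.sum_insert ha, Finset.sum_insert ha, AlternatingMap.add_apply, ih]

theorem wedgeWith_apply (b : ℕ → N₁ →ₗ[ℝ] N₂ →ₗ[ℝ] N) (α : ∀ n : ℕ, T [⋀^Fin n]→ₗ[ℝ] N₁)
    (β : ∀ n : ℕ, T [⋀^Fin n]→ₗ[ℝ] N₂) (n : ℕ) (v : Fin n → T) :
    wedgeWith b α β n v = ∑ i : Fin (n + 1),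
      ∑ q : Equiv.Perm.ModSumCongr (Fin i) (Fin (n - i)),
        ((Equiv.Perm.sign q.out : ℤ) : ℝ) • b (n - i)
          (α i fun a => v ((finSumFinEquiv.trans (finCongr (by omega))) (q.out (Sum.inl a))))
          (β (n - i) fun a =>
            v ((finSumFinEquiv.trans (finCongr (by omega))) (q.out (Sum.inr a)))) := by
  simp only [wedgeWith, alternating_sum_apply, AlternatingMap.domDomCongr_apply,
    LinearMap.compAlternatingMap_apply, AlternatingMap.domCoprod_apply, sum_apply, map_sum]
  refine Finset.sum_congr rfl fun i _ => Finset.sum_congr rfl fun q _ => ?_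
  conv_lhs => rw [← Quotient.out_eq' q]
  rw [AlternatingMap.domCoprod.summand_mk'']
  rcases Int.units_eq_one_or (Equiv.Perm.sign q.out) with h | h <;> rw [h] <;>
    simp [Function.comp_def]

theorem wedgeWith_add_right (b : ℕ → N₁ →ₗ[ℝ] N₂ →ₗ[ℝ] N) (α : ∀ n : ℕ, T [⋀^Fin n]→ₗ[ℝ] N₁)
    (β β' : ∀ n : ℕ, T [⋀^Fin n]→ₗ[ℝ] N₂) (n : ℕ) :
    wedgeWith b α (β + β') n = wedgeWith b α β n + wedgeWith b α β' n := by
  ext v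
  simp [wedgeWith_apply, Finset.sum_add_distrib]

theorem wedgeWith_smul_right {S : Type*} [Semiring S] [Module S N₂] [SMulCommClass ℝ S N₂]
    [Module S N] [SMulCommClass ℝ S N] (c : S)
    (b : ℕ → N₁ →ₗ[ℝ] N₂ →ₗ[ℝ] N) (hb : ∀ j x y, b j x (c • y) = c • b j x y)
    (α : ∀ n : ℕ, T [⋀^Fin n]→ₗ[ℝ] N₁) (β : ∀ n : ℕ, T [⋀^Fin n]→ₗ[ℝ] N₂) (n : ℕ) :
    wedgeWith b α (c • β) n = c • wedgeWith b α β n := by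
  ext v
  simp only [wedgeWith_apply, Pi.smul_apply, AlternatingMap.smul_apply, hb, Finset.smul_sum]
  exact Finset.sum_congr rfl fun i _ => Finset.sum_congr rfl fun q _ => smul_comm _ _ _

/-- A multilinear form on a finite-dimensional space, with values in a normed space, is
automatically continuous. -/
theorem alternating_continuous {V K : Type*} [NormedAddCommGroup V] [NormedSpace ℝ V]
    [FiniteDimensional ℝ V] [NormedAddCommGroup K] [NormedSpace ℝ K] {n : ℕ}
    (f : V [⋀^Fin n]→ₗ[ℝ] K) : Continuous f := by
  classical
  let b := Module.finBasis ℝ V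
  have h : ∀ v : Fin n → V, f v = ∑ r : Fin n → Fin (Module.finrank ℝ V),
      (∏ i, b.repr (v i) (r i)) • f (fun i => b (r i)) := by
    intro v
    have : v = fun i => ∑ j, b.repr (v i) j • b j := by
      funext i; exact (b.sum_repr (v i)).symm
    conv_lhs => rw [this]
    rw [← AlternatingMap.coe_multilinearMap, MultilinearMap.map_sum]
    refine Finset.sum_congr rfl fun r _ => ?_
    rw [MultilinearMap.map_smul_univ]
  have hc : (f : (Fin n → V) → K) = fun v => ∑ r : Fin n → Fin (Module.finrank ℝ V),
      (∏ i, b.repr (v i) (r i)) • f (fun i => b (r i)) := funext h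
  rw [hc]
  refine continuous_finsetSum _ fun r _ => Continuous.smul ?_ continuous_const
  refine continuous_finsetProd _ fun i _ => ?_
  exact (LinearMap.continuous_of_finiteDimensional (b.coord (r i))).comp (continuous_apply i)

/-- An alternating form on a finite-dimensional space as a continuous alternating form. -/
def toContinuousAlternating {V K : Type*} [NormedAddCommGroup V] [NormedSpace ℝ V]
    [FiniteDimensional ℝ V] [NormedAddCommGroup K] [NormedSpace ℝ K] {n : ℕ}
    (f : V [⋀^Fin n]→ₗ[ℝ] K) : V [⋀^Fin n]→L[ℝ] K :=
  { f with cont := alternating_continuous f }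

end Algebra

/-! ### Forms on a manifold

`M` is a manifold modelled on the finite-dimensional real vector space `V`. -/

section Forms

variable (V : Type*) [NormedAddCommGroup V] [NormedSpace ℝ V]
variable {M : Type*} [TopologicalSpace M] [ChartedSpace V M]

/-- Inhomogeneous forms on `M` with values in the vector bundle `W`, without any regularity: for
every `x` and `n` an alternating `n`-form on `T_x M` with values in `W x`.
(The components with `n > dim M` vanish automatically.) -/
abbrev Form (W : M → Type*) [∀ x, AddCommGroup (W x)] [∀ x, Module ℝ (W x)] :=
  ∀ (x : M) (n : ℕ), TangentSpace 𝓘(ℝ, V) x [⋀^Fin n]→ₗ[ℝ] W x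

variable (M) in
/-- Smooth vector fields on `M`. -/
abbrev VectorField [IsManifold 𝓘(ℝ, V) ∞ M] :=
  Cₛ^∞⟮𝓘(ℝ, V); V, (TangentSpace 𝓘(ℝ, V) : M → Type _)⟯

variable {V}

/-- The exterior derivative of an `n`-form on `M` (with values in a fixed normed space `K`): at the
point `x` it is `φ^* d ((φ⁻¹)^* α)`, where `φ` is the chart of `M` at `x` and the inner `d` is the
exterior derivative on the vector space `V`. -/
def extDerivForm [FiniteDimensional ℝ V] {K : Type*} [NormedAddCommGroup K] [NormedSpace ℝ K]
    {n : ℕ} (α : ∀ x : M, TangentSpace 𝓘(ℝ, V) x [⋀^Fin n]→ₗ[ℝ] K) (x : M) :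
    TangentSpace 𝓘(ℝ, V) x [⋀^Fin (n + 1)]→ₗ[ℝ] K :=
  (extDeriv (fun y : V => toContinuousAlternating ((α ((extChartAt 𝓘(ℝ, V) x).symm y)).compLinearMap
      (mfderiv 𝓘(ℝ, V) 𝓘(ℝ, V) (extChartAt 𝓘(ℝ, V) x).symm y : V →L[ℝ] _).toLinearMap))
    (extChartAt 𝓘(ℝ, V) x x)).toAlternatingMap.compLinearMap
      (mfderiv 𝓘(ℝ, V) 𝓘(ℝ, V) (extChartAt 𝓘(ℝ, V) x) x :
        TangentSpace 𝓘(ℝ, V) x →L[ℝ] V).toLinearMap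

/-- The exterior derivative of an inhomogeneous form. -/
def d [FiniteDimensional ℝ V] {K : Type*} [NormedAddCommGroup K] [NormedSpace ℝ K]
    (α : Form V (fun _ : M => K)) : Form V (fun _ : M => K)
  | _, 0 => 0
  | x, _ + 1 => extDerivForm (fun y => α y _) x

end Forms

section Bundles

variable (𝕜 : Type*) [RCLike 𝕜]
  {V : Type*} [NormedAddCommGroup V] [NormedSpace ℝ V]
  {M : Type*} [TopologicalSpace M] [ChartedSpace V M] [IsManifold 𝓘(ℝ, V) ∞ M]
  (G : Type*) [NormedAddCommGroup G] [NormedSpace ℝ G] [NormedSpace 𝕜 G] [IsScalarTower ℝ 𝕜 G]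
  (W : M → Type*) [TopologicalSpace (TotalSpace G W)]
  [∀ x, AddCommGroup (W x)] [∀ x, Module ℝ (W x)] [∀ x, Module 𝕜 (W x)]
  [∀ x, IsScalarTower ℝ 𝕜 (W x)] [∀ x, TopologicalSpace (W x)] [FiberBundle G W]
  [VectorBundle ℝ G W] [VectorBundle 𝕜 G W]

variable {G W} in
theorem contMDiff_smul_section {f : M → 𝕜} {s : ∀ x, W x} (hf : ContMDiff 𝓘(ℝ, V) 𝓘(ℝ, 𝕜) ∞ f)
    (hs : ContMDiff 𝓘(ℝ, V) (𝓘(ℝ, V).prod 𝓘(ℝ, G)) ∞ fun x => TotalSpace.mk' G x (s x)) :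
    ContMDiff 𝓘(ℝ, V) (𝓘(ℝ, V).prod 𝓘(ℝ, G)) ∞ fun x => TotalSpace.mk' G x (f x • s x) := by
  intro x₀
  have h := hs x₀
  rw [Bundle.contMDiffAt_section] at h ⊢
  set e := trivializationAt G W x₀
  have hb : ContDiff ℝ ∞ fun p : 𝕜 × G => p.1 • p.2 :=
    (ContinuousLinearMap.lsmul ℝ 𝕜 : 𝕜 →L[ℝ] G →L[ℝ] G).isBoundedBilinearMap.contDiff
  have := hb.contMDiff.contMDiffAt.comp x₀ ((hf x₀).prodMk_space h)
  refine this.congr_of_eventuallyEq ?_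
  filter_upwards [e.open_baseSet.mem_nhds (FiberBundle.mem_baseSet_trivializationAt' x₀)]
    with x hx
  exact (e.linear 𝕜 hx).2 _ _

/-- `Ω(M) = ⨁ₙ Ωⁿ(M)`: smooth forms on `M` with values in `𝕜`. -/
def ScalarForm : Submodule 𝕜 (Form V (fun _ : M => 𝕜)) where
  carrier := {α | ∀ (n : ℕ) (X : Fin n → VectorField V M),
    ContMDiff 𝓘(ℝ, V) 𝓘(ℝ, 𝕜) ∞ fun x => α x n fun i => X i x}
  add_mem' hα hβ n X := (hα n X).add (hβ n X)
  zero_mem' _ _ := contMDiff_const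
  smul_mem' c _ hα n X := (ContinuousLinearMap.mul ℝ 𝕜 c).contMDiff.comp (hα n X)

theorem mem_scalarForm {α : Form V (fun _ : M => 𝕜)} : α ∈ ScalarForm (V := V) (M := M) 𝕜 ↔
    ∀ (n : ℕ) (X : Fin n → VectorField V M),
      ContMDiff 𝓘(ℝ, V) 𝓘(ℝ, 𝕜) ∞ fun x => α x n fun i => X i x := Iff.rfl

/-- `Ω(M, W) = ⨁ₙ Ωⁿ(M, W)`: smooth forms on `M` with values in the vector bundle `W` (with model
fibre `G`). -/
def BundleForm : Submodule 𝕜 (Form V W) where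
  carrier := {θ | ∀ (n : ℕ) (X : Fin n → VectorField V M),
    ContMDiff 𝓘(ℝ, V) (𝓘(ℝ, V).prod 𝓘(ℝ, G)) ∞
      fun x => TotalSpace.mk' G x (θ x n fun i => X i x)}
  add_mem' hα hβ n X := (hα n X).add_section (hβ n X)
  zero_mem' _ _ := Bundle.contMDiff_zeroSection ℝ W
  smul_mem' _ _ hα n X := contMDiff_smul_section 𝕜 contMDiff_const (hα n X)

/-- `Ω(M, End W)`: smooth forms on `M` with values in the bundle `End W` of `𝕜`-linear
endomorphisms. A section of `End W` is smooth if it maps smooth sections to smooth sections. -/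
def EndForm : Submodule 𝕜 (Form V (fun x => Module.End 𝕜 (W x))) where
  carrier := {P | ∀ (n : ℕ) (X : Fin n → VectorField V M) (s : Cₛ^∞⟮𝓘(ℝ, V); G, W⟯),
    ContMDiff 𝓘(ℝ, V) (𝓘(ℝ, V).prod 𝓘(ℝ, G)) ∞
      fun x => TotalSpace.mk' G x (P x n (fun i => X i x) (s x))}
  add_mem' hα hβ n X s := (hα n X s).add_section (hβ n X s)
  zero_mem' _ _ _ := Bundle.contMDiff_zeroSection ℝ W
  smul_mem' _ _ hα n X s := contMDiff_smul_section 𝕜 contMDiff_const (hα n X s)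

variable {G W}

theorem contMDiff_sum_section {ι : Type*} [Fintype ι] {s : ι → ∀ x, W x}
    (hs : ∀ i, ContMDiff 𝓘(ℝ, V) (𝓘(ℝ, V).prod 𝓘(ℝ, G)) ∞ fun x => TotalSpace.mk' G x (s i x)) :
    ContMDiff 𝓘(ℝ, V) (𝓘(ℝ, V).prod 𝓘(ℝ, G)) ∞ fun x => TotalSpace.mk' G x (∑ i, s i x) :=
  ContMDiff.sum_section fun i _ => hs i

variable {𝕜}

/-- Scalar multiplication `(c, v) ↦ c • v` as an `ℝ`-bilinear map. -/
def smulBilin (N : Type*) [AddCommGroup N] [Module ℝ N] [Module 𝕜 N] [IsScalarTower ℝ 𝕜 N] :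
    𝕜 →ₗ[ℝ] N →ₗ[ℝ] N :=
  LinearMap.mk₂ ℝ (fun c v => c • v) (fun c c' v => add_smul c c' v) (fun r c v => smul_assoc r c v)
    (fun c v v' => smul_add c v v') (fun r c v => smul_comm c r v)

/-- The exterior product `α ∧ θ` of a scalar form and a bundle-valued form. -/
def wedge {W : M → Type*} [∀ x, AddCommGroup (W x)] [∀ x, Module ℝ (W x)] [∀ x, Module 𝕜 (W x)]
    [∀ x, IsScalarTower ℝ 𝕜 (W x)] (α : Form V (fun _ : M => 𝕜)) (θ : Form V W) : Form V W :=
  fun x => wedgeWith (fun _ => smulBilin (W x)) (α x) (θ x)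

theorem wedge_add {W : M → Type*} [∀ x, AddCommGroup (W x)] [∀ x, Module ℝ (W x)]
    [∀ x, Module 𝕜 (W x)] [∀ x, IsScalarTower ℝ 𝕜 (W x)] (α : Form V (fun _ : M => 𝕜))
    (θ θ' : Form V W) : wedge α (θ + θ') = wedge α θ + wedge α θ' := by
  funext x n
  exact wedgeWith_add_right (fun _ => smulBilin (W x)) (α x) (θ x) (θ' x) n

theorem wedge_smul {W : M → Type*} [∀ x, AddCommGroup (W x)] [∀ x, Module ℝ (W x)]
    [∀ x, Module 𝕜 (W x)] [∀ x, IsScalarTower ℝ 𝕜 (W x)] (c : 𝕜) (α : Form V (fun _ : M => 𝕜))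
    (θ : Form V W) : wedge α (c • θ) = c • wedge α θ := by
  funext x n
  have hb : ∀ (j : ℕ) (r : 𝕜) (v : W x),
      (fun _ : ℕ => smulBilin (W x)) j r (c • v) = c • (fun _ : ℕ => smulBilin (W x)) j r v := by
    intro j r v
    simp only [smulBilin, LinearMap.mk₂_apply]
    rw [smul_smul, smul_smul, mul_comm]
  exact wedgeWith_smul_right c _ hb (α x) (θ x) n

theorem wedge_mem {α : Form V (fun _ : M => 𝕜)} (hα : α ∈ ScalarForm 𝕜) {θ : Form V W}
    (hθ : θ ∈ BundleForm 𝕜 G W) : wedge α θ ∈ BundleForm 𝕜 G W := by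
  intro n X
  simp only [wedge, wedgeWith_apply]
  refine contMDiff_sum_section fun i => contMDiff_sum_section fun q => ?_
  refine ContMDiff.const_smul_section ?_
  have h1 := (mem_scalarForm 𝕜).1 hα i
    fun a => X ((finSumFinEquiv.trans (finCongr (by omega))) (q.out (Sum.inl a)))
  have h2 := hθ (n - i)
    fun a => X ((finSumFinEquiv.trans (finCongr (by omega))) (q.out (Sum.inr a)))
  exact contMDiff_smul_section 𝕜 h1 h2

/-- Left multiplication `θ ↦ α ∧ θ` on `Ω(M, W)` by a scalar form `α ∈ Ω(M)`. -/
def wedgeLeft (α : ScalarForm (V := V) (M := M) 𝕜) :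
    BundleForm (V := V) 𝕜 G W →ₗ[𝕜] BundleForm (V := V) 𝕜 G W where
  toFun θ := ⟨wedge α.1 θ.1, wedge_mem α.2 θ.2⟩
  map_add' θ θ' := Subtype.ext (wedge_add α.1 θ.1 θ'.1)
  map_smul' c θ := Subtype.ext (wedge_smul c α.1 θ.1)

end Bundles

/-! ### Smooth families of forms and of operators -/

section Families

variable (𝕜 : Type*) [RCLike 𝕜]
  {V : Type*} [NormedAddCommGroup V] [NormedSpace ℝ V] [FiniteDimensional ℝ V]
  {M : Type*} [TopologicalSpace M] [ChartedSpace V M] [IsManifold 𝓘(ℝ, V) ∞ M] [T2Space M]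
  (G : Type*) [NormedAddCommGroup G] [NormedSpace ℝ G] [NormedSpace 𝕜 G] [IsScalarTower ℝ 𝕜 G]
  {W : M → Type*} [TopologicalSpace (TotalSpace G W)]
  [∀ x, AddCommGroup (W x)] [∀ x, Module ℝ (W x)] [∀ x, Module 𝕜 (W x)]
  [∀ x, IsScalarTower ℝ 𝕜 (W x)] [∀ x, TopologicalSpace (W x)] [FiberBundle G W]
  [VectorBundle ℝ G W] [VectorBundle 𝕜 G W]

theorem exists_section_extending [ContMDiffVectorBundle ∞ G W 𝓘(ℝ, V)] {x₀ : M} (w : W x₀) :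
    ∃ s : Cₛ^∞⟮𝓘(ℝ, V); G, W⟯, ∀ᶠ x in nhds x₀, s x = FiberBundle.extend G w x := by
  obtain ⟨u, hu, hs⟩ := FiberBundle.exists_contMDiffOn_extend (k := ∞) 𝓘(ℝ, V) G w
  obtain ⟨f, -, hf⟩ := (SmoothBumpFunction.nhds_basis_tsupport (I := 𝓘(ℝ, V)) x₀).mem_iff.1
    (interior_mem_nhds.2 hu)
  refine ⟨⟨_, ContMDiffOn.smul_section_of_tsupport f.contMDiff.contMDiffOn isOpen_interior hf
    (hs.mono interior_subset)⟩, ?_⟩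
  filter_upwards [f.eventuallyEq_one] with x hx
  simp [hx]

theorem exists_section_apply_eq [ContMDiffVectorBundle ∞ G W 𝓘(ℝ, V)] {x₀ : M} (w : W x₀) :
    ∃ s : Cₛ^∞⟮𝓘(ℝ, V); G, W⟯, s x₀ = w := by
  obtain ⟨s, hs⟩ := exists_section_extending (V := V) G w
  exact ⟨s, by simpa using hs.self_of_nhds⟩

/-- A family `(θ_t)` of forms on `M` is smooth if it is jointly smooth on `ℝ × M`. -/
def IsSmoothFamily (θ : ℝ → Form V W) : Prop :=
  ∀ (n : ℕ) (X : Fin n → VectorField V M),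
    ContMDiff (𝓘(ℝ, ℝ).prod 𝓘(ℝ, V)) (𝓘(ℝ, V).prod 𝓘(ℝ, G)) ∞
      fun p : ℝ × M => TotalSpace.mk' G p.2 (θ p.1 p.2 n fun i => X i p.2)

/-- The identification of the fibre `W x` with the model fibre `G` by a local trivialization. -/
def fibreIso (x : M) : W x ≃L[ℝ] G :=
  (trivializationAt G W x).continuousLinearEquivAt ℝ x
    (FiberBundle.mem_baseSet_trivializationAt' x)

/-- The derivative of a curve in the (finite-dimensional) fibre `W x`. -/
def fibreDeriv {x : M} (g : ℝ → W x) (t : ℝ) : W x :=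
  (fibreIso G x).symm (deriv (fun s => fibreIso G x (g s)) t)

variable {G}

theorem contMDiffAt_triv {θ : ℝ → Form V W} (hθ : IsSmoothFamily G θ) (n : ℕ)
    (X : Fin n → VectorField V M) (t : ℝ) (x₀ : M) :
    ContMDiffAt (𝓘(ℝ, ℝ).prod 𝓘(ℝ, V)) 𝓘(ℝ, G) ∞
      (fun p : ℝ × M => (trivializationAt G W x₀ ⟨p.2, θ p.1 p.2 n fun i => X i p.2⟩).2)
      (t, x₀) :=
  (Bundle.contMDiffAt_totalSpace.1 (hθ n X (t, x₀))).2

theorem differentiable_fibre {θ : ℝ → Form V W} (hθ : IsSmoothFamily G θ) (x : M) (n : ℕ)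
    (v : Fin n → TangentSpace 𝓘(ℝ, V) x) :
    Differentiable ℝ fun s => fibreIso G x (θ s x n v) := by
  choose X hX using fun i => exists_section_apply_eq (V := V) V
    (W := (TangentSpace 𝓘(ℝ, V) : M → Type _)) (v i)
  intro t
  have h := contMDiffAt_triv hθ n X t x
  have h2 : ContMDiffAt 𝓘(ℝ, ℝ) (𝓘(ℝ, ℝ).prod 𝓘(ℝ, V)) ∞ (fun s : ℝ => (s, x)) t :=
    contMDiffAt_id.prodMk contMDiffAt_const
  have h3 := (h.comp t h2).contDiffAt.differentiableAt (by simp)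
  have h4 : (fun s => fibreIso G x (θ s x n v)) =
      (fun p : ℝ × M => (trivializationAt G W x ⟨p.2, θ p.1 p.2 n fun i => X i p.2⟩).2) ∘
        (fun s : ℝ => (s, x)) := by
    funext s
    simp [fibreIso, hX]
  rw [h4]
  exact h3

theorem triv_fibreDeriv {x₀ x : M} (hx : x ∈ (trivializationAt G W x₀).baseSet) {g : ℝ → W x}
    (hg : Differentiable ℝ fun s => fibreIso G x (g s)) (t : ℝ) :
    (trivializationAt G W x₀ ⟨x, fibreDeriv G g t⟩).2 =
      deriv (fun s => (trivializationAt G W x₀ ⟨x, g s⟩).2) t := by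
  let L : G →L[ℝ] G := ((trivializationAt G W x₀).continuousLinearEquivAt ℝ x hx :
    W x →L[ℝ] G).comp ((fibreIso (W := W) G x).symm : G →L[ℝ] W x)
  have h1 : ∀ w : W x, (trivializationAt G W x₀ ⟨x, w⟩).2 = L (fibreIso G x w) := by
    intro w
    simp [L]
  have h2 : (fun s => (trivializationAt G W x₀ ⟨x, g s⟩).2) =
      fun s => L (fibreIso G x (g s)) := funext fun s => h1 _
  rw [h1, h2, fibreDeriv, ContinuousLinearEquiv.apply_symm_apply]
  exact ((L.hasFDerivAt.comp_hasDerivAt t (hg t).hasDerivAt).deriv).symm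

theorem contMDiffAt_deriv {F : ℝ × M → G} {t : ℝ} {x₀ : M}
    (hF : ContMDiffAt (𝓘(ℝ, ℝ).prod 𝓘(ℝ, V)) 𝓘(ℝ, G) ∞ F (t, x₀)) :
    ContMDiffAt 𝓘(ℝ, V) 𝓘(ℝ, G) ∞ (fun x => deriv (fun s => F (s, x)) t) x₀ := by
  have hsw : ContMDiffAt (𝓘(ℝ, V).prod 𝓘(ℝ, ℝ)) (𝓘(ℝ, ℝ).prod 𝓘(ℝ, V)) ∞
      (fun p : M × ℝ => (p.2, p.1)) (x₀, t) := contMDiffAt_snd.prodMk contMDiffAt_fst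
  have hF' : ContMDiffAt (𝓘(ℝ, V).prod 𝓘(ℝ, ℝ)) 𝓘(ℝ, G) ∞
      (Function.uncurry fun (x : M) (s : ℝ) => F (s, x)) (x₀, t) := hF.comp (x₀, t) hsw
  have h := ContMDiffAt.mfderiv (fun (x : M) (s : ℝ) => F (s, x)) (fun _ => t) hF'
    (contMDiffAt_const (c := t)) (m := ∞) (by simp)
  have h' := ContMDiffAt.clm_apply (f := fun _ => (1 : ℝ)) h contMDiffAt_const
  refine h'.congr_of_eventuallyEq (Filter.Eventually.of_forall fun x => ?_)
  have e := inCoordinates_tangent_bundle_core_model_space (I := 𝓘(ℝ, ℝ)) (I' := 𝓘(ℝ, G))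
    t t (F (t, x₀)) (F (t, x)) (fderiv ℝ (fun s => F (s, x)) t)
  simp only [inTangentCoordinates, mfderiv_eq_fderiv]
  exact (congrArg (fun L : ℝ →L[ℝ] G => L 1) e).symm

/-- The derivative `dθ_t/dt` of a smooth family of forms, taken pointwise in the fibres of `W`. -/
def timeDeriv [ContMDiffVectorBundle ∞ G W 𝓘(ℝ, V)] (θ : ℝ → Form V W) (hθ : IsSmoothFamily G θ) (t : ℝ) : Form V W := fun x n =>
  { toFun := fun v => fibreDeriv G (fun s => θ s x n v) t
    map_update_add' := by
      intro _ v i a b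
      have h : ∀ a, DifferentiableAt ℝ (fun s => fibreIso G x (θ s x n (Function.update v i a))) t :=
        fun a => differentiable_fibre hθ x n _ t
      simp only [fibreDeriv, AlternatingMap.map_update_add, map_add]
      rw [deriv_fun_add (by convert h a) (by convert h b), map_add]
    map_update_smul' := by
      intro _ v i c a
      simp only [fibreDeriv, AlternatingMap.map_update_smul, map_smul]
      rw [deriv_fun_const_smul_field, map_smul]
    map_eq_zero_of_eq' := by
      intro v i j hv hij
      simp [fibreDeriv, AlternatingMap.map_eq_zero_of_eq _ v hv hij] }

theorem timeDeriv_mem [ContMDiffVectorBundle ∞ G W 𝓘(ℝ, V)] {θ : ℝ → Form V W} (hθ : IsSmoothFamily G θ) (t : ℝ) :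
    timeDeriv θ hθ t ∈ BundleForm 𝕜 G W := by
  intro n X x₀
  rw [Bundle.contMDiffAt_section]
  refine (contMDiffAt_deriv (contMDiffAt_triv hθ n X t x₀)).congr_of_eventuallyEq ?_
  filter_upwards [(trivializationAt G W x₀).open_baseSet.mem_nhds
    (FiberBundle.mem_baseSet_trivializationAt' x₀)] with x hx
  exact triv_fibreDeriv hx (differentiable_fibre hθ x n _) t

theorem contMDiff_trace [ContMDiffVectorBundle ∞ G W 𝓘(ℝ, V)] [FiniteDimensional 𝕜 G]
    {L : ∀ x, Module.End 𝕜 (W x)}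
    (hL : ∀ s : Cₛ^∞⟮𝓘(ℝ, V); G, W⟯, ContMDiff 𝓘(ℝ, V) (𝓘(ℝ, V).prod 𝓘(ℝ, G)) ∞
      fun x => TotalSpace.mk' G x (L x (s x))) :
    ContMDiff 𝓘(ℝ, V) 𝓘(ℝ, 𝕜) ∞ fun x => LinearMap.trace 𝕜 (W x) (L x) := by
  intro x₀
  set e := trivializationAt G W x₀ with he
  let b := Module.finBasis 𝕜 G
  have hx₀ : x₀ ∈ e.baseSet := FiberBundle.mem_baseSet_trivializationAt' x₀
  choose S hS using fun i => exists_section_extending (V := V) G (W := W) (x₀ := x₀)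
    ((e.linearEquivAt 𝕜 x₀ hx₀).symm (b i))
  have hsm : ∀ i, ContMDiffAt 𝓘(ℝ, V) 𝓘(ℝ, 𝕜) ∞
      (fun x => b.coord i (e ⟨x, L x (S i x)⟩).2) x₀ := by
    intro i
    have h := (Bundle.contMDiffAt_section x₀).1 (hL (S i) x₀)
    have hc : ContMDiff 𝓘(ℝ, G) 𝓘(ℝ, 𝕜) ∞ (((b.coord i).restrictScalars ℝ) : G → 𝕜) := by
      have := Module.Finite.trans (R := ℝ) 𝕜 G
      exact (LinearMap.toContinuousLinearMap ((b.coord i).restrictScalars ℝ)).contMDiff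
    exact (hc _).comp x₀ h
  have hsum : ContMDiffAt 𝓘(ℝ, V) 𝓘(ℝ, 𝕜) ∞
      (fun x => ∑ i, b.coord i (e ⟨x, L x (S i x)⟩).2) x₀ := by
    exact contMDiffAt_finsetSum fun i _ => hsm i
  refine hsum.congr_of_eventuallyEq ?_
  filter_upwards [e.open_baseSet.mem_nhds hx₀, Filter.eventually_all.2 hS] with x hx hSx
  let b' := b.map (e.linearEquivAt 𝕜 x hx).symm
  have hb' : ∀ i, S i x = b' i := by
    intro i
    rw [hSx i]
    simp [FiberBundle.extend, b', ← he]
    rw [e.apply_mk_symm hx₀]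
  rw [LinearMap.trace_eq_matrix_trace 𝕜 b', Matrix.trace]
  refine Finset.sum_congr rfl fun i _ => ?_
  rw [Matrix.diag_apply, LinearMap.toMatrix_apply, ← hb']
  simp [b']

variable {𝕜}

/-- A family `(D_t)` of operators on `Ω(M, W)` is smooth if `(D_t θ)` is a smooth family of forms
for every `θ ∈ Ω(M, W)`. -/
def IsSmoothOpFamily (D : ℝ → Module.End 𝕜 (BundleForm (V := V) 𝕜 G W)) : Prop :=
  ∀ θ, IsSmoothFamily G fun t => (D t θ).1

/-- The derivative `dD_t/dt : θ ↦ d(D_t θ)/dt` of a smooth family of operators on `Ω(M, W)`. -/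
def opDeriv [ContMDiffVectorBundle ∞ G W 𝓘(ℝ, V)] (D : ℝ → Module.End 𝕜 (BundleForm (V := V) 𝕜 G W)) (hD : IsSmoothOpFamily D) (t : ℝ) :
    Module.End 𝕜 (BundleForm (V := V) 𝕜 G W) where
  toFun θ := ⟨timeDeriv _ (hD θ) t, timeDeriv_mem 𝕜 (hD θ) t⟩
  map_add' θ θ' := by
    refine Subtype.ext (funext fun x => funext fun n => AlternatingMap.ext fun v => ?_)
    have h := fun θ => differentiable_fibre (hD θ) x n v t
    change fibreDeriv G (fun s => (D s (θ + θ')).1 x n v) t =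
      fibreDeriv G (fun s => (D s θ).1 x n v) t + fibreDeriv G (fun s => (D s θ').1 x n v) t
    simp only [fibreDeriv, map_add, Submodule.coe_add, Pi.add_apply, AlternatingMap.add_apply]
    rw [deriv_fun_add (h θ) (h θ'), map_add]
  map_smul' c θ := by
    refine Subtype.ext (funext fun x => funext fun n => AlternatingMap.ext fun v => ?_)
    have hc : ∀ w : W x, fibreIso G x (c • w) = c • fibreIso G x w := fun w =>
      ((trivializationAt G W x).linear 𝕜 (FiberBundle.mem_baseSet_trivializationAt' x)).2 c w
    change fibreDeriv G (fun s => (D s (c • θ)).1 x n v) t =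
      c • fibreDeriv G (fun s => (D s θ).1 x n v) t
    simp only [fibreDeriv, map_smul, Submodule.coe_smul, Pi.smul_apply, AlternatingMap.smul_apply,
      hc]
    rw [deriv_fun_const_smul_field, ContinuousLinearEquiv.symm_apply_eq, hc,
      ContinuousLinearEquiv.apply_symm_apply]

end Families

/-! ### Superbundles, superconnections -/

section Super

variable (𝕜 : Type*) [RCLike 𝕜]
  {V : Type*} [NormedAddCommGroup V] [NormedSpace ℝ V] [FiniteDimensional ℝ V]
  {M : Type*} [TopologicalSpace M] [ChartedSpace V M] [IsManifold 𝓘(ℝ, V) ∞ M]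

section Fibre

variable {P N : Type*} [AddCommGroup P] [Module ℝ P] [Module 𝕜 P] [IsScalarTower ℝ 𝕜 P]
  [AddCommGroup N] [Module ℝ N] [Module 𝕜 N] [IsScalarTower ℝ 𝕜 N]

/-- The grading operator `ε` of the super vector space `P ⊕ N`: it is `1` on the even part `P` and
`-1` on the odd part `N`. -/
def grading : Module.End 𝕜 (P × N) := LinearMap.id.prodMap (-LinearMap.id)

/-- The pairing `(L, v) ↦ (-1)^{|L| j} L v` of `End (P ⊕ N)` with `P ⊕ N`; note that
`ε^j L ε^j = (-1)^{|L| j} L` for homogeneous `L`. -/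
def signedApply (j : ℕ) : Module.End 𝕜 (P × N) →ₗ[ℝ] (P × N) →ₗ[ℝ] (P × N) :=
  LinearMap.mk₂ ℝ (fun L v => (grading 𝕜 ^ j * L * grading 𝕜 ^ j : Module.End 𝕜 (P × N)) v)
    (fun L L' v => by simp [mul_add, add_mul]) (fun r L v => by simp)
    (fun L v v' => by simp) (fun r L v => by simp)

/-- The supertrace `Str L = tr (L⁺⁺) - tr (L⁻⁻)` on `End (P ⊕ N)`. -/
def supertrace : Module.End 𝕜 (P × N) →ₗ[ℝ] 𝕜 where
  toFun L := LinearMap.trace 𝕜 P (LinearMap.fst 𝕜 P N ∘ₗ L ∘ₗ LinearMap.inl 𝕜 P N) -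
    LinearMap.trace 𝕜 N (LinearMap.snd 𝕜 P N ∘ₗ L ∘ₗ LinearMap.inr 𝕜 P N)
  map_add' L L' := by
    simp only [LinearMap.add_comp, LinearMap.comp_add, map_add]; ring
  map_smul' r L := by
    have h : r • L = (r : 𝕜) • L := by
      ext v <;> simp
    rw [h]
    simp only [LinearMap.smul_comp, LinearMap.comp_smul, map_smul, RingHom.id_apply, ← smul_sub]
    simp [RCLike.real_smul_eq_coe_mul]

end Fibre

variable (Fp : Type*) [NormedAddCommGroup Fp] [NormedSpace ℝ Fp] [NormedSpace 𝕜 Fp]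
  [IsScalarTower ℝ 𝕜 Fp] [FiniteDimensional 𝕜 Fp]
  (Ep : M → Type*) [TopologicalSpace (TotalSpace Fp Ep)]
  [∀ x, AddCommGroup (Ep x)] [∀ x, Module ℝ (Ep x)] [∀ x, Module 𝕜 (Ep x)]
  [∀ x, IsScalarTower ℝ 𝕜 (Ep x)] [∀ x, TopologicalSpace (Ep x)] [FiberBundle Fp Ep]
  [VectorBundle ℝ Fp Ep] [VectorBundle 𝕜 Fp Ep]
  (Fm : Type*) [NormedAddCommGroup Fm] [NormedSpace ℝ Fm] [NormedSpace 𝕜 Fm]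
  [IsScalarTower ℝ 𝕜 Fm] [FiniteDimensional 𝕜 Fm]
  (Em : M → Type*) [TopologicalSpace (TotalSpace Fm Em)]
  [∀ x, AddCommGroup (Em x)] [∀ x, Module ℝ (Em x)] [∀ x, Module 𝕜 (Em x)]
  [∀ x, IsScalarTower ℝ 𝕜 (Em x)] [∀ x, TopologicalSpace (Em x)] [FiberBundle Fm Em]
  [VectorBundle ℝ Fm Em] [VectorBundle 𝕜 Fm Em]

/-- `Ω(M, E)` for the superbundle `E = E⁺ ⊕ E⁻`. -/
abbrev SuperForm : Submodule 𝕜 (Form V (Ep ×ᵇ Em)) := BundleForm 𝕜 (Fp × Fm) (Ep ×ᵇ Em)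

/-- `Ω(M, End E)` for the superbundle `E = E⁺ ⊕ E⁻`. -/
abbrev SuperEnd : Submodule 𝕜 (Form V (fun x => Module.End 𝕜 ((Ep ×ᵇ Em) x))) :=
  EndForm 𝕜 (Fp × Fm) (Ep ×ᵇ Em)

variable {Fp Ep Fm Em}

theorem contMDiff_grading {s : ∀ x, (Ep ×ᵇ Em) x}
    (hs : ContMDiff 𝓘(ℝ, V) (𝓘(ℝ, V).prod 𝓘(ℝ, Fp × Fm)) ∞
      fun x => TotalSpace.mk' (Fp × Fm) x (s x)) :
    ContMDiff 𝓘(ℝ, V) (𝓘(ℝ, V).prod 𝓘(ℝ, Fp × Fm)) ∞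
      fun x => TotalSpace.mk' (Fp × Fm) x (grading 𝕜 (s x) : (Ep ×ᵇ Em) x) := by
  intro x₀
  have h := hs x₀
  rw [Bundle.contMDiffAt_section] at h ⊢
  set e := trivializationAt Fp Ep x₀
  set e' := trivializationAt Fm Em x₀
  have hL := ((ContinuousLinearMap.fst ℝ Fp Fm).prod
    (-(ContinuousLinearMap.snd ℝ Fp Fm))).contMDiff (n := ∞)
  refine ((hL _).comp x₀ h).congr_of_eventuallyEq ?_
  filter_upwards [e.open_baseSet.mem_nhds (FiberBundle.mem_baseSet_trivializationAt' x₀),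
    e'.open_baseSet.mem_nhds (FiberBundle.mem_baseSet_trivializationAt' x₀)] with x hx hx'
  refine Prod.ext rfl ?_
  have := (e'.linear 𝕜 hx').2 (-1) (s x).2
  simp only [neg_smul, one_smul] at this
  exact this

theorem contMDiff_grading_pow (j : ℕ) {s : ∀ x, (Ep ×ᵇ Em) x}
    (hs : ContMDiff 𝓘(ℝ, V) (𝓘(ℝ, V).prod 𝓘(ℝ, Fp × Fm)) ∞
      fun x => TotalSpace.mk' (Fp × Fm) x (s x)) :
    ContMDiff 𝓘(ℝ, V) (𝓘(ℝ, V).prod 𝓘(ℝ, Fp × Fm)) ∞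
      fun x => TotalSpace.mk' (Fp × Fm) x ((grading 𝕜 ^ j) (s x) : (Ep ×ᵇ Em) x) := by
  induction j with
  | zero => simpa using hs
  | succ j ih =>
    have := contMDiff_grading 𝕜 ih
    simpa only [pow_succ', Module.End.mul_apply] using this

variable {𝕜}

/-- The (not necessarily smooth) form `T θ`, where `T` is an `End E`-valued form acting on the
`E`-valued form `θ`, with the sign rule
`(α ⊗ L) (β ⊗ v) = (-1)^{|L| |β|} (α ∧ β) ⊗ L v`. -/
def act (T : Form V (fun x => Module.End 𝕜 ((Ep ×ᵇ Em) x))) (θ : Form V (Ep ×ᵇ Em)) :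
    Form V (Ep ×ᵇ Em) :=
  fun x => wedgeWith (fun j => signedApply 𝕜 j) (T x) (θ x)

theorem act_mem {T : Form V (fun x => Module.End 𝕜 ((Ep ×ᵇ Em) x))} (hT : T ∈ SuperEnd 𝕜 Fp Ep Fm Em)
    {θ : Form V (Ep ×ᵇ Em)} (hθ : θ ∈ SuperForm 𝕜 Fp Ep Fm Em) :
    act T θ ∈ SuperForm 𝕜 Fp Ep Fm Em := by
  intro n X
  simp only [act, wedgeWith_apply]
  refine contMDiff_sum_section fun i => contMDiff_sum_section fun q => ?_
  refine ContMDiff.const_smul_section ?_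
  have h1 := contMDiff_grading_pow 𝕜 (n - i : ℕ) (hθ (n - i) fun a => X
    ((finSumFinEquiv.trans (finCongr (by omega))) (q.out (Sum.inr a))))
  exact contMDiff_grading_pow 𝕜 (n - i : ℕ) (hT i (fun a => X
    ((finSumFinEquiv.trans (finCongr (by omega))) (q.out (Sum.inl a)))) ⟨_, h1⟩)

/-- The operator on `Ω(M, E)` given by an element of `Ω(M, End E)`. -/
def actOp (T : SuperEnd (V := V) 𝕜 Fp Ep Fm Em) : Module.End 𝕜 (SuperForm (V := V) 𝕜 Fp Ep Fm Em) where
  toFun θ := ⟨act T.1 θ.1, act_mem T.2 θ.2⟩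
  map_add' θ θ' := by
    refine Subtype.ext (funext fun x => funext fun n => ?_)
    exact wedgeWith_add_right _ _ _ _ _
  map_smul' c θ := by
    refine Subtype.ext (funext fun x => funext fun n => ?_)
    exact wedgeWith_smul_right c _ (fun j L v => map_smul
      (grading 𝕜 ^ j * L * grading 𝕜 ^ j : Module.End 𝕜 (Ep x × Em x)) c v) _ _ _

/-! #### Supertraces -/

section Supertrace

theorem contMDiff_inl {s : ∀ x, Ep x}
    (hs : ContMDiff 𝓘(ℝ, V) (𝓘(ℝ, V).prod 𝓘(ℝ, Fp)) ∞ fun x => TotalSpace.mk' Fp x (s x)) :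
    ContMDiff 𝓘(ℝ, V) (𝓘(ℝ, V).prod 𝓘(ℝ, Fp × Fm)) ∞
      fun x => TotalSpace.mk' (Fp × Fm) x ((s x, 0) : (Ep ×ᵇ Em) x) := by
  intro x₀
  have h := hs x₀
  have h' := Bundle.contMDiff_zeroSection (n := ∞) (IB := 𝓘(ℝ, V)) (F := Fm) ℝ Em x₀
  rw [Bundle.contMDiffAt_section] at h ⊢
  have h'' := (Bundle.contMDiffAt_section x₀).1 h'
  exact h.prodMk_space h''

theorem contMDiff_inr {s : ∀ x, Em x}
    (hs : ContMDiff 𝓘(ℝ, V) (𝓘(ℝ, V).prod 𝓘(ℝ, Fm)) ∞ fun x => TotalSpace.mk' Fm x (s x)) :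
    ContMDiff 𝓘(ℝ, V) (𝓘(ℝ, V).prod 𝓘(ℝ, Fp × Fm)) ∞
      fun x => TotalSpace.mk' (Fp × Fm) x ((0, s x) : (Ep ×ᵇ Em) x) := by
  intro x₀
  have h := hs x₀
  have h' := Bundle.contMDiff_zeroSection (n := ∞) (IB := 𝓘(ℝ, V)) (F := Fp) ℝ Ep x₀
  rw [Bundle.contMDiffAt_section] at h ⊢
  have h'' := (Bundle.contMDiffAt_section x₀).1 h'
  exact h''.prodMk_space h

theorem contMDiff_fst_section {s : ∀ x, (Ep ×ᵇ Em) x}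
    (hs : ContMDiff 𝓘(ℝ, V) (𝓘(ℝ, V).prod 𝓘(ℝ, Fp × Fm)) ∞
      fun x => TotalSpace.mk' (Fp × Fm) x (s x)) :
    ContMDiff 𝓘(ℝ, V) (𝓘(ℝ, V).prod 𝓘(ℝ, Fp)) ∞ fun x => TotalSpace.mk' Fp x (s x).1 := by
  intro x₀
  have h := hs x₀
  rw [Bundle.contMDiffAt_section] at h ⊢
  exact ((ContinuousLinearMap.fst ℝ Fp Fm).contMDiff (n := ∞) _).comp x₀ h

theorem contMDiff_snd_section {s : ∀ x, (Ep ×ᵇ Em) x}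
    (hs : ContMDiff 𝓘(ℝ, V) (𝓘(ℝ, V).prod 𝓘(ℝ, Fp × Fm)) ∞
      fun x => TotalSpace.mk' (Fp × Fm) x (s x)) :
    ContMDiff 𝓘(ℝ, V) (𝓘(ℝ, V).prod 𝓘(ℝ, Fm)) ∞ fun x => TotalSpace.mk' Fm x (s x).2 := by
  intro x₀
  have h := hs x₀
  rw [Bundle.contMDiffAt_section] at h ⊢
  exact ((ContinuousLinearMap.snd ℝ Fp Fm).contMDiff (n := ∞) _).comp x₀ h

variable [T2Space M] [ContMDiffVectorBundle ∞ Fp Ep 𝓘(ℝ, V)]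
  [ContMDiffVectorBundle ∞ Fm Em 𝓘(ℝ, V)]

theorem supertrace_mem {T : Form V (fun x => Module.End 𝕜 ((Ep ×ᵇ Em) x))}
    (hT : T ∈ SuperEnd 𝕜 Fp Ep Fm Em) :
    (fun x n => (supertrace (P := Ep x) (N := Em x) 𝕜).compAlternatingMap (T x n) :
      Form V (fun _ : M => 𝕜)) ∈ ScalarForm (V := V) (M := M) 𝕜 := by
  intro n X
  have h1 := contMDiff_trace (V := V) (G := Fp) (W := Ep) 𝕜
    (L := fun x => LinearMap.fst 𝕜 (Ep x) (Em x) ∘ₗ (T x n fun i => X i x) ∘ₗ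
      LinearMap.inl 𝕜 (Ep x) (Em x))
    (fun s => contMDiff_fst_section (hT n X ⟨_, contMDiff_inl s.contMDiff⟩))
  have h2 := contMDiff_trace (V := V) (G := Fm) (W := Em) 𝕜
    (L := fun x => LinearMap.snd 𝕜 (Ep x) (Em x) ∘ₗ (T x n fun i => X i x) ∘ₗ
      LinearMap.inr 𝕜 (Ep x) (Em x))
    (fun s => contMDiff_snd_section (hT n X ⟨_, contMDiff_inr s.contMDiff⟩))
  exact h1.sub h2

/-- The supertrace `Str : Ω(M, End E) → Ω(M)`, `Str (α ⊗ L) = Str(L) α`. -/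
def Str (T : SuperEnd (V := V) 𝕜 Fp Ep Fm Em) : ScalarForm (V := V) (M := M) 𝕜 :=
  ⟨fun x n => (supertrace (P := Ep x) (N := Em x) 𝕜).compAlternatingMap (T.1 x n),
    supertrace_mem T.2⟩

end Supertrace

/-! #### Parity -/

/-- `θ ∈ Ω⁺(M, E) = ∑_{i even} Ωⁱ(M, E⁺) ⊕ ∑_{i odd} Ωⁱ(M, E⁻)`. -/
def IsEvenForm (θ : Form V (Ep ×ᵇ Em)) : Prop :=
  ∀ x n v, (Even n → (θ x n v).2 = 0) ∧ (Odd n → (θ x n v).1 = 0)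

/-- `θ ∈ Ω⁻(M, E) = ∑_{i odd} Ωⁱ(M, E⁺) ⊕ ∑_{i even} Ωⁱ(M, E⁻)`. -/
def IsOddForm (θ : Form V (Ep ×ᵇ Em)) : Prop :=
  ∀ x n v, (Odd n → (θ x n v).2 = 0) ∧ (Even n → (θ x n v).1 = 0)

section FibreParity

variable {P N : Type*} [AddCommGroup P] [Module 𝕜 P] [AddCommGroup N] [Module 𝕜 N]

/-- `End⁺ (P ⊕ N) = Hom(P, P) ⊕ Hom(N, N)`. -/
def IsEvenMap (L : Module.End 𝕜 (P × N)) : Prop :=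
  (∀ p : P, (L (p, 0)).2 = 0) ∧ ∀ q : N, (L (0, q)).1 = 0

/-- `End⁻ (P ⊕ N) = Hom(P, N) ⊕ Hom(N, P)`. -/
def IsOddMap (L : Module.End 𝕜 (P × N)) : Prop :=
  (∀ p : P, (L (p, 0)).1 = 0) ∧ ∀ q : N, (L (0, q)).2 = 0

end FibreParity

/-- `T ∈ Ω⁺(M, End E)`: the sum of the degree and the parity of the endomorphism is even. -/
def IsEvenEnd (T : Form V (fun x => Module.End 𝕜 ((Ep ×ᵇ Em) x))) : Prop :=
  ∀ x n v, (Even n → IsEvenMap (P := Ep x) (N := Em x) (T x n v)) ∧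
    (Odd n → IsOddMap (P := Ep x) (N := Em x) (T x n v))

/-- `T ∈ Ω⁻(M, End E)`: the sum of the degree and the parity of the endomorphism is odd. -/
def IsOddEnd (T : Form V (fun x => Module.End 𝕜 ((Ep ×ᵇ Em) x))) : Prop :=
  ∀ x n v, (Odd n → IsEvenMap (P := Ep x) (N := Em x) (T x n v)) ∧
    (Even n → IsOddMap (P := Ep x) (N := Em x) (T x n v))

/-- The grading operator of `Ω(M, E)`: it is `1` on `Ω⁺(M, E)` and `-1` on `Ω⁻(M, E)`. -/
def parity : Module.End 𝕜 (SuperForm (V := V) 𝕜 Fp Ep Fm Em) where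
  toFun θ := ⟨fun x n => (-1 : ℝ) ^ n • ((grading (P := Ep x) (N := Em x) 𝕜).restrictScalars
      ℝ).compAlternatingMap (θ.1 x n), by
    intro n X
    exact ContMDiff.const_smul_section (contMDiff_grading 𝕜 (θ.2 n X))⟩
  map_add' θ θ' := by
    refine Subtype.ext (funext fun x => funext fun n => AlternatingMap.ext fun v => ?_)
    change (-1 : ℝ) ^ n • grading (P := Ep x) (N := Em x) 𝕜 (θ.1 x n v + θ'.1 x n v) =
      (-1 : ℝ) ^ n • grading (P := Ep x) (N := Em x) 𝕜 (θ.1 x n v) +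
        (-1 : ℝ) ^ n • grading (P := Ep x) (N := Em x) 𝕜 (θ'.1 x n v)
    rw [← smul_add]
    congr 1
    exact map_add (grading (P := Ep x) (N := Em x) 𝕜) _ _
  map_smul' c θ := by
    refine Subtype.ext (funext fun x => funext fun n => AlternatingMap.ext fun v => ?_)
    change (-1 : ℝ) ^ n • grading (P := Ep x) (N := Em x) 𝕜 (c • θ.1 x n v) =
      c • (-1 : ℝ) ^ n • grading (P := Ep x) (N := Em x) 𝕜 (θ.1 x n v)
    rw [smul_comm c]
    congr 1
    exact map_smul (grading (P := Ep x) (N := Em x) 𝕜) _ _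

/-- The operator on pairs of forms that is identified with the pair `(D, D')` of `End E`-valued
forms: `(α, β) ↦ (D α, D' α + Π D Π β)`, where `Π` is the grading operator of `Ω(M, E)`. If `D` has
the blocks `D₁, D₂, D₃, D₄` with respect to `Ω⁺(M, E) ⊕ Ω⁻(M, E)`, then
`Π D Π β = D₁ β⁺ - D₂ β⁻ - D₃ β⁺ + D₄ β⁻`. -/
def pairOp (P : SuperEnd (V := V) 𝕜 Fp Ep Fm Em × SuperEnd (V := V) 𝕜 Fp Ep Fm Em) :
    Module.End 𝕜 (SuperForm (V := V) 𝕜 Fp Ep Fm Em × SuperForm (V := V) 𝕜 Fp Ep Fm Em) :=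
  (actOp P.1 ∘ₗ LinearMap.fst 𝕜 _ _).prod
    (actOp P.2 ∘ₗ LinearMap.fst 𝕜 _ _ + (parity * actOp P.1 * parity) ∘ₗ LinearMap.snd 𝕜 _ _)

open Classical in
/-- The supertrace `𝐒𝐭𝐫(𝔻) = (Str D, Str D')` of an operator `𝔻` on pairs of forms that is
identified with the pair `(D, D')` of `End E`-valued forms (and `0` if there is no such pair). -/
def pairStr [T2Space M] [ContMDiffVectorBundle ∞ Fp Ep 𝓘(ℝ, V)]
    [ContMDiffVectorBundle ∞ Fm Em 𝓘(ℝ, V)]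
    (D : Module.End 𝕜 (SuperForm (V := V) 𝕜 Fp Ep Fm Em × SuperForm (V := V) 𝕜 Fp Ep Fm Em)) :
    ScalarForm (V := V) (M := M) 𝕜 × ScalarForm (V := V) (M := M) 𝕜 :=
  if h : ∃ P, pairOp P = D then (Str h.choose.1, Str h.choose.2) else 0

/-! #### Symplectic forms and primitive superconnections -/

section Symplectic

variable (V M) in
/-- A symplectic form on `M`: a closed nondegenerate smooth real 2-form. -/
structure SymplecticForm where
  /-- the form -/
  form : ∀ x : M, TangentSpace 𝓘(ℝ, V) x [⋀^Fin 2]→ₗ[ℝ] ℝ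
  smooth : ∀ X : Fin 2 → VectorField V M, ContMDiff 𝓘(ℝ, V) 𝓘(ℝ, ℝ) ∞ fun x =>
    form x fun i => X i x
  closed : ∀ x, extDerivForm form x = 0
  nondegenerate : ∀ (x : M) (v : TangentSpace 𝓘(ℝ, V) x), (∀ w, form x ![v, w] = 0) → v = 0

variable (𝕜) in
/-- A symplectic form as an element of `Ω²(M) ⊆ Ω(M)`. -/
def SymplecticForm.toScalarForm (σ : SymplecticForm V M) : ScalarForm (V := V) (M := M) 𝕜 :=
  ⟨fun x n => match n with
    | 2 => (Algebra.linearMap ℝ 𝕜).compAlternatingMap (σ.form x)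
    | _ => 0, by
    intro n X
    match n, X with
    | 2, X => exact (Algebra.linearMap ℝ 𝕜).toContinuousLinearMap.contMDiff.comp (σ.smooth X)
    | 0, _ => exact contMDiff_const
    | 1, _ => exact contMDiff_const
    | _ + 3, _ => exact contMDiff_const⟩

/-- The map `∂ (α, β) = (dα + σ ∧ β, -dβ)` on pairs of forms. -/
def boundary (σ : SymplecticForm V M)
    (p : ScalarForm (V := V) (M := M) 𝕜 × ScalarForm (V := V) (M := M) 𝕜) :
    Form V (fun _ : M => 𝕜) × Form V (fun _ : M => 𝕜) :=
  (d p.1.1 + wedge (σ.toScalarForm 𝕜).1 p.2.1, -d p.2.1)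

variable (V 𝕜 Fp Ep Fm Em)

/-- A superconnection on `E`: an operator on `Ω(M, E)` that exchanges `Ω⁺(M, E)` and `Ω⁻(M, E)` and
satisfies the Leibniz rule `A (α ∧ θ) = dα ∧ θ + (-1)^{|α|} α ∧ A θ`. -/
structure Superconnection where
  /-- the operator -/
  op : Module.End 𝕜 (SuperForm (V := V) 𝕜 Fp Ep Fm Em)
  odd_of_even : ∀ θ, IsEvenForm θ.1 → IsOddForm (op θ).1
  even_of_odd : ∀ θ, IsOddForm θ.1 → IsEvenForm (op θ).1
  leibniz : ∀ (α : ScalarForm (V := V) (M := M) 𝕜) (θ : SuperForm (V := V) 𝕜 Fp Ep Fm Em),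
    (op (wedgeLeft α θ)).1 =
      wedge (d α.1) θ.1 + wedge (fun x n => (-1 : ℝ) ^ n • α.1 x n) (op θ).1

/-- The data `(A, B)` of a primitive superconnection: a superconnection `A` on `E` and
`B ∈ Ω⁺(M, End E)`. -/
structure PrimitiveSuperconnection where
  /-- the superconnection `A` -/
  conn : Superconnection 𝕜 V Fp Ep Fm Em
  /-- the even endomorphism-valued form `B` -/
  endo : SuperEnd (V := V) 𝕜 Fp Ep Fm Em
  even_endo : IsEvenEnd endo.1

variable {V 𝕜 Fp Ep Fm Em}

/-- The map `(α, β) ↦ (A α + σ ∧ β, B α - A β)`. -/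
def PrimitiveSuperconnection.op (𝔸 : PrimitiveSuperconnection 𝕜 V Fp Ep Fm Em)
    (σ : SymplecticForm V M) :
    Module.End 𝕜 (SuperForm (V := V) 𝕜 Fp Ep Fm Em × SuperForm (V := V) 𝕜 Fp Ep Fm Em) :=
  (𝔸.conn.op ∘ₗ LinearMap.fst 𝕜 _ _ + wedgeLeft (σ.toScalarForm 𝕜) ∘ₗ LinearMap.snd 𝕜 _ _).prod
    (actOp 𝔸.endo ∘ₗ LinearMap.fst 𝕜 _ _ - 𝔸.conn.op ∘ₗ LinearMap.snd 𝕜 _ _)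

/-- A family `𝔸_t` of primitive superconnections is smooth if the families of operators `A_t` and
`B_t` on `Ω(M, E)` are smooth. -/
structure IsSmoothPrimitiveFamily (𝔸 : ℝ → PrimitiveSuperconnection 𝕜 V Fp Ep Fm Em) : Prop where
  conn : IsSmoothOpFamily fun t => (𝔸 t).conn.op
  endo : IsSmoothOpFamily fun t => actOp (𝔸 t).endo

/-- The derivative `d𝔸_t/dt : (α, β) ↦ ((dA_t/dt) α, (dB_t/dt) α - (dA_t/dt) β)` of a smooth family
of primitive superconnections. -/
def IsSmoothPrimitiveFamily.deriv [T2Space M] [ContMDiffVectorBundle ∞ Fp Ep 𝓘(ℝ, V)]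
    [ContMDiffVectorBundle ∞ Fm Em 𝓘(ℝ, V)]
    {𝔸 : ℝ → PrimitiveSuperconnection 𝕜 V Fp Ep Fm Em} (h : IsSmoothPrimitiveFamily 𝔸) (t : ℝ) :
    Module.End 𝕜 (SuperForm (V := V) 𝕜 Fp Ep Fm Em × SuperForm (V := V) 𝕜 Fp Ep Fm Em) :=
  (opDeriv _ h.conn t ∘ₗ LinearMap.fst 𝕜 _ _).prod
    (opDeriv _ h.endo t ∘ₗ LinearMap.fst 𝕜 _ _ - opDeriv _ h.conn t ∘ₗ LinearMap.snd 𝕜 _ _)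

end Symplectic

end Super
end
end PrimitiveChernWeil

open PrimitiveChernWeil

/-!
Throughout, `𝔸` is a primitive superconnection given by a superconnection `A` and an even form `B`,
and `w` is exterior multiplication by the symplectic form.

**Forms at a point.** All products of forms (of scalar forms, of a scalar form with a form, the
action and the product of endomorphism-valued forms) are instances of one product `xprod`, which
differs from them only in the pairing of the values. The interior product with a vector is an
antiderivation of it (`inner1_xprod`), and a form of positive degree is determined by its interior
products. Hence associativity (`xprod_assoc`), graded commutativity (`xprod_comm`) and compatibility
with linear maps (`xprod_map`) follow by induction on the degree from the corresponding identities
for the values. Together with the cyclicity of the trace this shows that the supertrace of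
`End E`-valued forms vanishes on supercommutators (`strAt_mulAt_comm`).

**Tensorial operators.** An operator `Φ` on `Ω(M, E)` of parity `p` with
`Φ (α ∧ θ) = κ dα ∧ θ + (-1)^{p |α|} α ∧ Φ θ` is determined near a point by its values on a local
frame. For `κ = 1`, `p = 1` it is a superconnection. For `κ = 0` it acts pointwise and is the action
of an `End E`-valued form (`IsLeibniz.exists_actOp_eq`). The derivation terms cancel in `A²`, in
`A D - (-1)^{|D|} D A` for an `End E`-valued form `D`, and in the time derivative of a family of
superconnections, so that all of these are `End E`-valued forms.

**The transgression identity.** In a local frame a superconnection is `d` plus a connection form, and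
the connection form does not contribute to the supertrace of a supercommutator, so that
`Str (A D - (-1)^{|D|} D A) = d (Str D)` (`Str_supercommutator`). Since `w` is even and closed, it
commutes with `A` and with even and odd `End E`-valued forms, and a computation with `2 × 2` blocks
gives `𝐒𝐭𝐫 (𝔸 X + X 𝔸) = ∂ 𝐒𝐭𝐫 X` for every `X` that is identified with an odd pair
(`isPairOp_anticommutator`), and `∂ 𝐒𝐭𝐫 X = 0` for every `X` that is identified with an even pair and
commutes with `𝔸` (`boundary_pairStr_eq_zero`). The latter applies to `X = f(𝔸²)`.

**The derivative.** The derivative of `𝔸²` is `𝔸 𝔸̇ + 𝔸̇ 𝔸` (`hasPairDeriv_op_sq`). As `𝐒𝐭𝐫` is cyclic on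
even pairs, the derivative of `𝐒𝐭𝐫 f(𝔸²)` is `𝐒𝐭𝐫 ((𝔸 𝔸̇ + 𝔸̇ 𝔸) f'(𝔸²))` (`exists_deriv_aeval`). Since
`f'(𝔸²)` commutes with `𝔸`, this is the supertrace of `𝔸 X + X 𝔸` for `X = 𝔸̇ f'(𝔸²)`, hence `∂ 𝐒𝐭𝐫 X`.
-/

namespace PrimitiveChernWeil

noncomputable section

set_option linter.unusedSectionVars false

/-! ### Exterior products at a point -/

section ExteriorProduct

variable {T N₁ N₂ N₃ N₄ N N' : Type*} [AddCommGroup T] [Module ℝ T] [AddCommGroup N₁] [Module ℝ N₁]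
  [AddCommGroup N₂] [Module ℝ N₂] [AddCommGroup N₃] [Module ℝ N₃] [AddCommGroup N₄] [Module ℝ N₄]
  [AddCommGroup N] [Module ℝ N] [AddCommGroup N'] [Module ℝ N']

/-- Expansion of a signed sum over the permutations of `Fin (n + 1)` by the position of `0`. -/
theorem sum_perm_succ_cons {n : ℕ} (g : (Fin (n + 1) → T) → N) (x : T) (u : Fin n → T) :
    ∑ s : Equiv.Perm (Fin (n + 1)), ((Equiv.Perm.sign s : ℤ) : ℝ) •
        g (fun k => (Fin.cons x u : Fin (n + 1) → T) (s k)) =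
      ∑ p : Fin (n + 1), (-1 : ℝ) ^ (p : ℕ) • ∑ e : Equiv.Perm (Fin n),
        ((Equiv.Perm.sign e : ℤ) : ℝ) • g (p.insertNth (α := fun _ => T) x fun k => u (e k)) := by
  -- `F (p, e)` is the permutation that takes `p` to `0` and is `e` on the remaining indices.
  let F : Fin (n + 1) × Equiv.Perm (Fin n) → Equiv.Perm (Fin (n + 1)) := fun q =>
    Equiv.Perm.decomposeFin.symm (0, q.2) * q.1.cycleRange
  have hF0 : ∀ q, F q q.1 = 0 := by
    intro q
    simp [F, Fin.cycleRange_self]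
  have hFs : ∀ q k, F q (q.1.succAbove k) = (q.2 k).succ := by
    intro q k
    simp [F, Fin.cycleRange_succAbove, Equiv.Perm.decomposeFin_symm_apply_succ]
  have hinj : Function.Injective F := by
    rintro ⟨p, e⟩ ⟨p', e'⟩ h
    have hp : p = p' := by
      have h1 := hF0 ⟨p, e⟩
      rw [h, ← hF0 ⟨p', e'⟩] at h1
      exact (F ⟨p', e'⟩).injective h1
    subst hp
    have : e = e' := by
      ext k
      have h1 := hFs ⟨p, e⟩ k
      rw [h, hFs ⟨p, e'⟩] at h1
      exact congrArg Fin.val (Fin.succ_injective _ h1).symm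
    rw [this]
  have hbij : Function.Bijective F := by
    rw [Fintype.bijective_iff_injective_and_card]
    refine ⟨hinj, ?_⟩
    simp [Fintype.card_perm, Nat.factorial_succ]
  rw [← hbij.sum_comp, Fintype.sum_prod_type]
  refine Finset.sum_congr rfl fun p _ => ?_
  rw [Finset.smul_sum]
  refine Finset.sum_congr rfl fun e _ => ?_
  have hs : ((Equiv.Perm.sign (F (p, e)) : ℤ) : ℝ) = (-1) ^ (p : ℕ) * ((Equiv.Perm.sign e : ℤ) : ℝ) := by
    simp [F, Equiv.Perm.sign_mul, Fin.sign_cycleRange, mul_comm]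
  rw [hs, mul_smul]
  congr 3
  funext k
  rcases Fin.eq_self_or_eq_succAbove p k with rfl | ⟨k, rfl⟩
  · rw [hF0]; simp
  · rw [hFs]; simp

/-- The exterior product of two homogeneous forms, whose values are multiplied by `B`. -/
def homProd {i j n : ℕ} (h : i + j = n) (B : N₁ →ₗ[ℝ] N₂ →ₗ[ℝ] N) (a : T [⋀^Fin i]→ₗ[ℝ] N₁)
    (c : T [⋀^Fin j]→ₗ[ℝ] N₂) : T [⋀^Fin n]→ₗ[ℝ] N :=
  ((TensorProduct.lift B).compAlternatingMap (a.domCoprod c)).domDomCongr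
    (finSumFinEquiv.trans (finCongr h))

/-- The inclusion of the first block. -/
def blockLeft {i j n : ℕ} (h : i + j = n) (k : Fin i) : Fin n := Fin.cast h (Fin.castAdd j k)

/-- The inclusion of the second block. -/
def blockRight {i j n : ℕ} (h : i + j = n) (k : Fin j) : Fin n := Fin.cast h (Fin.natAdd i k)

/-- Multiplied by `i! j!`, the sum over shuffles that defines the product becomes a sum over all
permutations, in which no representatives of cosets have to be chosen. -/
theorem factorial_smul_homProd_apply {i j n : ℕ} (h : i + j = n) (B : N₁ →ₗ[ℝ] N₂ →ₗ[ℝ] N)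
    (a : T [⋀^Fin i]→ₗ[ℝ] N₁) (c : T [⋀^Fin j]→ₗ[ℝ] N₂) (v : Fin n → T) :
    ((i.factorial * j.factorial : ℕ) : ℝ) • homProd h B a c v =
      ∑ s : Equiv.Perm (Fin n), ((Equiv.Perm.sign s : ℤ) : ℝ) •
        B (a fun k => v (s (blockLeft h k))) (c fun k => v (s (blockRight h k))) := by
  subst h
  have h1 := congrArg (fun f => TensorProduct.lift B (f (v ∘ finSumFinEquiv)))
    (MultilinearMap.domCoprod_alternization_eq a c)
  simp only [MultilinearMap.alternatization_apply, AlternatingMap.smul_apply, Fintype.card_fin,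
    map_sum, map_nsmul] at h1
  rw [Nat.cast_smul_eq_nsmul]
  refine Eq.trans ?_ (h1.symm.trans ?_)
  · rfl
  · rw [← (Equiv.permCongr finSumFinEquiv).sum_comp]
    refine Finset.sum_congr rfl fun s _ => ?_
    rw [Equiv.Perm.sign_permCongr, Int.cast_smul_eq_zsmul, Units.smul_def, map_zsmul]
    congr 1
    simp [MultilinearMap.domCoprod, blockLeft, blockRight]

theorem homProd_smul {i j n : ℕ} (h : i + j = n) (r : ℝ) (B : N₁ →ₗ[ℝ] N₂ →ₗ[ℝ] N)
    (a : T [⋀^Fin i]→ₗ[ℝ] N₁) (c : T [⋀^Fin j]→ₗ[ℝ] N₂) :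
    homProd h (r • B) a c = r • homProd h B a c := by
  have : TensorProduct.lift (r • B) = r • TensorProduct.lift B := by ext; simp
  rw [homProd, this]
  rfl

theorem map_insertNth_eq_curryLeft {n : ℕ} (f : T [⋀^Fin (n + 1)]→ₗ[ℝ] N) (p : Fin (n + 1)) (x : T)
    (v : Fin n → T) :
    f (p.insertNth (α := fun _ => T) x v) = (-1 : ℝ) ^ (p : ℕ) • f.curryLeft x v := by
  rw [AlternatingMap.map_insertNth, ← Int.cast_smul_eq_zsmul ℝ]
  push_cast
  rfl

/-- If `x` is inserted at a position `p` of the first block, moving it to the front of that block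
costs the sign `(-1)^p`. -/
theorem homProd_curryLeft_aux_left {i j n : ℕ} (h : i + 1 + j = n + 1) (h' : i + j = n)
    (B : N₁ →ₗ[ℝ] N₂ →ₗ[ℝ] N) (a : T [⋀^Fin (i + 1)]→ₗ[ℝ] N₁) (c : T [⋀^Fin j]→ₗ[ℝ] N₂)
    (x : T) (y : Fin n → T) (p : Fin (i + 1)) :
    (-1 : ℝ) ^ (p : ℕ) • B
        (a fun k => (blockLeft h p).insertNth (α := fun _ => T) x y (blockLeft h k))
        (c fun k => (blockLeft h p).insertNth (α := fun _ => T) x y (blockRight h k)) =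
      B (a.curryLeft x fun k => y (blockLeft h' k)) (c fun k => y (blockRight h' k)) := by
  have h1 : (fun k => (blockLeft h p).insertNth (α := fun _ => T) x y (blockLeft h k)) =
      p.insertNth (α := fun _ => T) x fun k => y (blockLeft h' k) := by
    funext k
    rcases Fin.eq_self_or_eq_succAbove p k with rfl | ⟨k, rfl⟩
    · simp
    · have : blockLeft h (p.succAbove k) = (blockLeft h p).succAbove (blockLeft h' k) := by
        simp only [blockLeft, Fin.succAbove, Fin.lt_def, Fin.ext_iff]
        split_ifs <;> simp_all <;> omega
      rw [this, Fin.insertNth_apply_succAbove, Fin.insertNth_apply_succAbove]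
  have h2 : (fun k => (blockLeft h p).insertNth (α := fun _ => T) x y (blockRight h k)) =
      fun k => y (blockRight h' k) := by
    funext k
    have : blockRight h k = (blockLeft h p).succAbove (blockRight h' k) := by
      have := p.2
      simp only [blockLeft, blockRight, Fin.succAbove, Fin.lt_def, Fin.ext_iff]
      split_ifs with h3
      · simp at h3; omega
      · simp; omega
    rw [this, Fin.insertNth_apply_succAbove]
  rw [h1, h2, map_insertNth_eq_curryLeft, map_smul, LinearMap.smul_apply, smul_smul, ← mul_pow]
  simp

/-- If `x` is inserted at the position `p` of the second block, moving it to the front of that block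
costs the sign `(-1)^p`. (Moving it to the front of both blocks costs another `(-1)^i`.) -/
theorem homProd_curryLeft_aux_right {i j n : ℕ} (h : i + (j + 1) = n + 1) (h' : i + j = n)
    (B : N₁ →ₗ[ℝ] N₂ →ₗ[ℝ] N) (a : T [⋀^Fin i]→ₗ[ℝ] N₁) (c : T [⋀^Fin (j + 1)]→ₗ[ℝ] N₂)
    (x : T) (y : Fin n → T) (p : Fin (j + 1)) :
    (-1 : ℝ) ^ (p : ℕ) • B
        (a fun k => (blockRight h p).insertNth (α := fun _ => T) x y (blockLeft h k))
        (c fun k => (blockRight h p).insertNth (α := fun _ => T) x y (blockRight h k)) =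
      B (a fun k => y (blockLeft h' k)) (c.curryLeft x fun k => y (blockRight h' k)) := by
  have h1 : (fun k => (blockRight h p).insertNth (α := fun _ => T) x y (blockRight h k)) =
      p.insertNth (α := fun _ => T) x fun k => y (blockRight h' k) := by
    funext k
    rcases Fin.eq_self_or_eq_succAbove p k with rfl | ⟨k, rfl⟩
    · simp
    · have : blockRight h (p.succAbove k) = (blockRight h p).succAbove (blockRight h' k) := by
        simp only [blockRight, Fin.succAbove, Fin.lt_def, Fin.ext_iff]
        split_ifs <;> simp_all <;> omega
      rw [this, Fin.insertNth_apply_succAbove, Fin.insertNth_apply_succAbove]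
  have h2 : (fun k => (blockRight h p).insertNth (α := fun _ => T) x y (blockLeft h k)) =
      fun k => y (blockLeft h' k) := by
    funext k
    have : blockLeft h k = (blockRight h p).succAbove (blockLeft h' k) := by
      have := k.2
      simp only [blockLeft, blockRight, Fin.succAbove, Fin.lt_def, Fin.ext_iff]
      split_ifs with h3
      · simp
      · simp at h3; omega
    rw [this, Fin.insertNth_apply_succAbove]
  rw [h1, h2, map_insertNth_eq_curryLeft, map_smul, smul_smul, ← mul_pow]
  simp

/-- The part of the interior product of `a ∧ c` in which the vector is inserted into `a`. -/
def insLeft {i j n : ℕ} (h : i + j = n + 1) (B : N₁ →ₗ[ℝ] N₂ →ₗ[ℝ] N)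
    (a : T [⋀^Fin i]→ₗ[ℝ] N₁) (c : T [⋀^Fin j]→ₗ[ℝ] N₂) (x : T) : T [⋀^Fin n]→ₗ[ℝ] N :=
  match i, h, a with
  | 0, _, _ => 0
  | _ + 1, h, a => homProd (by omega) B (a.curryLeft x) c

/-- The part of the interior product of `a ∧ c` in which the vector is inserted into `c`. -/
def insRight {i j n : ℕ} (h : i + j = n + 1) (B : N₁ →ₗ[ℝ] N₂ →ₗ[ℝ] N)
    (a : T [⋀^Fin i]→ₗ[ℝ] N₁) (c : T [⋀^Fin j]→ₗ[ℝ] N₂) (x : T) : T [⋀^Fin n]→ₗ[ℝ] N :=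
  match j, h, c with
  | 0, _, _ => 0
  | _ + 1, h, c => (-1 : ℝ) ^ i • homProd (by omega) B a (c.curryLeft x)

/-- The interior product is an antiderivation, for homogeneous forms. -/
theorem homProd_cons {i j n : ℕ} (h : i + j = n + 1) (B : N₁ →ₗ[ℝ] N₂ →ₗ[ℝ] N)
    (a : T [⋀^Fin i]→ₗ[ℝ] N₁) (c : T [⋀^Fin j]→ₗ[ℝ] N₂) (x : T) (u : Fin n → T) :
    homProd h B a c (Fin.cons x u) = insLeft h B a c x u + insRight h B a c x u := by
  -- After multiplication by `i! j!`, split the sum over permutations by the position of `x`: the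
  -- positions in the first block all contribute equally, and so do those in the second.
  have hne : ((i.factorial * j.factorial : ℕ) : ℝ) ≠ 0 := by
    exact_mod_cast Nat.mul_ne_zero (Nat.factorial_ne_zero _) (Nat.factorial_ne_zero _)
  refine smul_right_injective N hne ?_
  beta_reduce
  rw [factorial_smul_homProd_apply, smul_add]
  rw [sum_perm_succ_cons (fun w => B (a fun k => w (blockLeft h k)) (c fun k => w (blockRight h k)))]
  rw [← (finSumFinEquiv.trans (finCongr h)).sum_comp, Fintype.sum_sum_type]
  congr 1
  · match i, h, a with
    | 0, _, _ => simp [insLeft]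
    | i + 1, h, a =>
      have h' : i + j = n := by omega
      have : ∀ p : Fin (i + 1), (-1 : ℝ) ^ ((finSumFinEquiv.trans (finCongr h) (Sum.inl p) : Fin (n + 1)) : ℕ) •
          ∑ e : Equiv.Perm (Fin n), ((Equiv.Perm.sign e : ℤ) : ℝ) •
            B (a fun k => (finSumFinEquiv.trans (finCongr h) (Sum.inl p)).insertNth (α := fun _ => T) x
                (fun k => u (e k)) (blockLeft h k))
              (c fun k => (finSumFinEquiv.trans (finCongr h) (Sum.inl p)).insertNth (α := fun _ => T) x
                (fun k => u (e k)) (blockRight h k)) =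
          ((i.factorial * j.factorial : ℕ) : ℝ) • homProd h' B (a.curryLeft x) c u := by
        intro p
        rw [factorial_smul_homProd_apply, Finset.smul_sum]
        refine Finset.sum_congr rfl fun e _ => ?_
        rw [smul_comm, ← homProd_curryLeft_aux_left h h' B a c x (fun k => u (e k)) p]
        rfl
      simp only [this, Finset.sum_const, Finset.card_univ, Fintype.card_fin, insLeft]
      rw [← Nat.cast_smul_eq_nsmul ℝ, smul_smul]
      congr 1
      push_cast [Nat.factorial_succ]
      ring
  · match j, h, c with
    | 0, _, _ => simp [insRight]
    | j + 1, h, c =>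
      have h' : i + j = n := by omega
      have : ∀ p : Fin (j + 1), (-1 : ℝ) ^ ((finSumFinEquiv.trans (finCongr h) (Sum.inr p) : Fin (n + 1)) : ℕ) •
          ∑ e : Equiv.Perm (Fin n), ((Equiv.Perm.sign e : ℤ) : ℝ) •
            B (a fun k => (finSumFinEquiv.trans (finCongr h) (Sum.inr p)).insertNth (α := fun _ => T) x
                (fun k => u (e k)) (blockLeft h k))
              (c fun k => (finSumFinEquiv.trans (finCongr h) (Sum.inr p)).insertNth (α := fun _ => T) x
                (fun k => u (e k)) (blockRight h k)) =
          ((i.factorial * j.factorial : ℕ) : ℝ) • (-1 : ℝ) ^ i • homProd h' B a (c.curryLeft x) u := by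
        intro p
        rw [smul_comm _ ((-1 : ℝ) ^ i), factorial_smul_homProd_apply, Finset.smul_sum, Finset.smul_sum]
        refine Finset.sum_congr rfl fun e _ => ?_
        rw [← homProd_curryLeft_aux_right h h' B a c x (fun k => u (e k)) p,
          smul_comm _ ((-1 : ℝ) ^ (p : ℕ)), smul_smul _ ((-1 : ℝ) ^ (p : ℕ)), ← pow_add]
        rfl
      simp only [this, Finset.sum_const, Finset.card_univ, Fintype.card_fin, insRight]
      rw [← Nat.cast_smul_eq_nsmul ℝ, smul_smul, AlternatingMap.smul_apply]
      congr 1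
      push_cast [Nat.factorial_succ]
      ring

/-- The exterior product of the inhomogeneous forms `α` and `β`; the values of the components of
degrees `i` and `j` are multiplied by `b i j`. -/
def xprod (b : ℕ → ℕ → N₁ →ₗ[ℝ] N₂ →ₗ[ℝ] N) (α : ∀ n : ℕ, T [⋀^Fin n]→ₗ[ℝ] N₁)
    (β : ∀ n : ℕ, T [⋀^Fin n]→ₗ[ℝ] N₂) (n : ℕ) : T [⋀^Fin n]→ₗ[ℝ] N :=
  ∑ i : Fin (n + 1), homProd (by omega : (i : ℕ) + (n - i) = n) (b i (n - i)) (α i) (β (n - i))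

/-- The interior product of an inhomogeneous form with a vector. -/
def inner1 (x : T) (α : ∀ n : ℕ, T [⋀^Fin n]→ₗ[ℝ] N) (n : ℕ) : T [⋀^Fin n]→ₗ[ℝ] N :=
  (α (n + 1)).curryLeft x

theorem apply_cons_eq_inner1 (α : ∀ n : ℕ, T [⋀^Fin n]→ₗ[ℝ] N) {n : ℕ} (x : T) (u : Fin n → T) :
    α (n + 1) (Fin.cons x u) = inner1 x α n u := rfl

/-- The sum defining `xprod`, as a sum over all pairs of degrees. -/
theorem xprod_eq_sum_antidiagonal (b : ℕ → ℕ → N₁ →ₗ[ℝ] N₂ →ₗ[ℝ] N)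
    (α : ∀ n : ℕ, T [⋀^Fin n]→ₗ[ℝ] N₁) (β : ∀ n : ℕ, T [⋀^Fin n]→ₗ[ℝ] N₂) (n : ℕ) :
    xprod b α β n = ∑ p ∈ Finset.HasAntidiagonal.antidiagonal n, if h : p.1 + p.2 = n then
      homProd h (b p.1 p.2) (α p.1) (β p.2) else 0 := by
  rw [Finset.Nat.sum_antidiagonal_eq_sum_range_succ_mk, Finset.sum_range, xprod]
  refine Finset.sum_congr rfl fun i _ => ?_
  rw [dif_pos]

theorem xprod_zero_apply (b : ℕ → ℕ → N₁ →ₗ[ℝ] N₂ →ₗ[ℝ] N) (α : ∀ n : ℕ, T [⋀^Fin n]→ₗ[ℝ] N₁)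
    (β : ∀ n : ℕ, T [⋀^Fin n]→ₗ[ℝ] N₂) (v : Fin 0 → T) :
    xprod b α β 0 v = b 0 0 (α 0 v) (β 0 v) := by
  have h := factorial_smul_homProd_apply (show 0 + 0 = 0 from rfl) (b 0 0) (α 0) (β 0) v
  have h0 : xprod b α β 0 = homProd (show 0 + 0 = 0 from rfl) (b 0 0) (α 0) (β 0) :=
    Fin.sum_univ_one _
  rw [h0]
  simp only [Nat.factorial_zero, mul_one, Nat.cast_one, one_smul, Finset.univ_unique,
    Finset.sum_singleton, Equiv.Perm.default_eq, Equiv.Perm.sign_one, Units.val_one, Int.cast_one]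
    at h
  refine Eq.trans h ?_
  congr 2 <;> exact Subsingleton.elim (α := Fin 0 → T) _ _

/-- The interior product with a vector is an antiderivation of the exterior product. -/
theorem inner1_xprod (b : ℕ → ℕ → N₁ →ₗ[ℝ] N₂ →ₗ[ℝ] N) (α : ∀ n : ℕ, T [⋀^Fin n]→ₗ[ℝ] N₁)
    (β : ∀ n : ℕ, T [⋀^Fin n]→ₗ[ℝ] N₂) (x : T) (n : ℕ) :
    inner1 x (xprod b α β) n = xprod (fun i j => b (i + 1) j) (inner1 x α) β n +
      xprod (fun i j => (-1 : ℝ) ^ i • b i (j + 1)) α (inner1 x β) n := by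
  ext u
  rw [AlternatingMap.add_apply, ← apply_cons_eq_inner1]
  simp only [xprod_eq_sum_antidiagonal, alternating_sum_apply]
  have hsplit : ∀ p ∈ Finset.HasAntidiagonal.antidiagonal (n + 1),
      (if h : p.1 + p.2 = n + 1 then homProd h (b p.1 p.2) (α p.1) (β p.2) else 0) (Fin.cons x u) =
      (if h : p.1 + p.2 = n + 1 then insLeft h (b p.1 p.2) (α p.1) (β p.2) x u else 0) +
      (if h : p.1 + p.2 = n + 1 then insRight h (b p.1 p.2) (α p.1) (β p.2) x u else 0) := by
    intro p hp
    have hp' := Finset.HasAntidiagonal.mem_antidiagonal.1 hp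
    simp only [dif_pos hp', homProd_cons]
  rw [Finset.sum_congr rfl hsplit, Finset.sum_add_distrib, Finset.Nat.sum_antidiagonal_succ,
    Finset.Nat.sum_antidiagonal_succ']
  congr 1
  · simp only [insLeft, AlternatingMap.zero_apply, zero_add, dite_true]
    refine Finset.sum_congr rfl fun p hp => ?_
    have hp' := Finset.HasAntidiagonal.mem_antidiagonal.1 hp
    rw [dif_pos (by omega), dif_pos hp']
    rfl
  · simp only [insRight, AlternatingMap.zero_apply, zero_add, add_zero, dite_true]
    refine Finset.sum_congr rfl fun p hp => ?_
    have hp' := Finset.HasAntidiagonal.mem_antidiagonal.1 hp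
    rw [dif_pos (by omega), dif_pos hp', homProd_smul]
    rfl

/-- A form of positive degree is determined by its interior products. -/
theorem ext_inner1 {α β : ∀ n : ℕ, T [⋀^Fin n]→ₗ[ℝ] N} {n : ℕ}
    (h : ∀ x, inner1 x α n = inner1 x β n) : α (n + 1) = β (n + 1) := by
  ext v
  have := congrArg (fun f => f (Fin.tail v)) (h (v 0))
  simpa [inner1, Matrix.vecCons, AlternatingMap.curryLeft_apply_apply] using this

theorem xprod_add_left (b : ℕ → ℕ → N₁ →ₗ[ℝ] N₂ →ₗ[ℝ] N) (α α' : ∀ n : ℕ, T [⋀^Fin n]→ₗ[ℝ] N₁)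
    (β : ∀ n : ℕ, T [⋀^Fin n]→ₗ[ℝ] N₂) :
    xprod b (α + α') β = xprod b α β + xprod b α' β := by
  funext n
  induction n generalizing b α α' β with
  | zero => ext v; simp [xprod_zero_apply]
  | succ n ih =>
    refine ext_inner1 fun x => ?_
    have h1 : inner1 x (α + α') = inner1 x α + inner1 x α' := rfl
    have h2 : inner1 x (xprod b α β + xprod b α' β) n =
      inner1 x (xprod b α β) n + inner1 x (xprod b α' β) n := rfl
    rw [h2, inner1_xprod, inner1_xprod, inner1_xprod, h1, ih, ih]
    simp only [Pi.add_apply]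
    abel

theorem xprod_add_right (b : ℕ → ℕ → N₁ →ₗ[ℝ] N₂ →ₗ[ℝ] N) (α : ∀ n : ℕ, T [⋀^Fin n]→ₗ[ℝ] N₁)
    (β β' : ∀ n : ℕ, T [⋀^Fin n]→ₗ[ℝ] N₂) :
    xprod b α (β + β') = xprod b α β + xprod b α β' := by
  funext n
  induction n generalizing b α β β' with
  | zero => ext v; simp [xprod_zero_apply]
  | succ n ih =>
    refine ext_inner1 fun x => ?_
    have h1 : inner1 x (β + β') = inner1 x β + inner1 x β' := rfl
    have h2 : inner1 x (xprod b α β + xprod b α β') n =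
      inner1 x (xprod b α β) n + inner1 x (xprod b α β') n := rfl
    rw [h2, inner1_xprod, inner1_xprod, inner1_xprod, h1, ih, ih]
    simp only [Pi.add_apply]
    abel

/-- Linear maps that intertwine two pairings intertwine the exterior products. The maps may depend on
the degree, and the hypothesis is needed only for the values that the forms take. -/
theorem xprod_map {b : ℕ → ℕ → N₁ →ₗ[ℝ] N₂ →ₗ[ℝ] N} {b' : ℕ → ℕ → N₃ →ₗ[ℝ] N₄ →ₗ[ℝ] N'}
    {f : ℕ → N₁ →ₗ[ℝ] N₃} {g : ℕ → N₂ →ₗ[ℝ] N₄} {k : ℕ → N →ₗ[ℝ] N'}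
    {α : ∀ n : ℕ, T [⋀^Fin n]→ₗ[ℝ] N₁} {β : ∀ n : ℕ, T [⋀^Fin n]→ₗ[ℝ] N₂}
    (h : ∀ i j v w, k (i + j) (b i j (α i v) (β j w)) = b' i j (f i (α i v)) (g j (β j w))) (n : ℕ) :
    (k n).compAlternatingMap (xprod b α β n) =
      xprod b' (fun i => (f i).compAlternatingMap (α i)) (fun j => (g j).compAlternatingMap (β j))
        n := by
  induction n generalizing b b' f g k α β with
  | zero =>
    ext v
    rw [LinearMap.compAlternatingMap_apply, xprod_zero_apply, xprod_zero_apply]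
    exact h 0 0 v v
  | succ n ih =>
    refine ext_inner1 (α := fun n => (k n).compAlternatingMap (xprod b α β n)) fun x => ?_
    rw [inner1_xprod]
    have h1 : inner1 x (fun n => (k n).compAlternatingMap (xprod b α β n)) n =
        (k (n + 1)).compAlternatingMap (inner1 x (xprod b α β) n) := rfl
    rw [h1, inner1_xprod]
    have h2 := ih (b := fun i j => b (i + 1) j) (b' := fun i j => b' (i + 1) j)
      (f := fun i => f (i + 1)) (g := g) (k := fun n => k (n + 1)) (α := inner1 x α) (β := β)
      fun i j v w => by
        have := h (i + 1) j (Fin.cons x v) w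
        rwa [show i + 1 + j = i + j + 1 by omega] at this
    have h3 := ih (b := fun i j => (-1 : ℝ) ^ i • b i (j + 1))
      (b' := fun i j => (-1 : ℝ) ^ i • b' i (j + 1))
      (f := f) (g := fun j => g (j + 1)) (k := fun n => k (n + 1)) (α := α) (β := inner1 x β)
      fun i j v w => by
        have := h i (j + 1) v (Fin.cons x w)
        simp only [LinearMap.smul_apply, map_smul]
        congr 1
    refine Eq.trans ?_ (congrArg₂ (· + ·) h2 h3)
    ext u
    simp

theorem id_compAlternatingMap {n : ℕ} (α : T [⋀^Fin n]→ₗ[ℝ] N) :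
    (LinearMap.id : N →ₗ[ℝ] N).compAlternatingMap α = α := rfl

theorem xprod_map_left {b : ℕ → ℕ → N₁ →ₗ[ℝ] N₂ →ₗ[ℝ] N} {b' : ℕ → ℕ → N₃ →ₗ[ℝ] N₂ →ₗ[ℝ] N}
    (f : ℕ → N₁ →ₗ[ℝ] N₃) {α : ∀ n : ℕ, T [⋀^Fin n]→ₗ[ℝ] N₁} {β : ∀ n : ℕ, T [⋀^Fin n]→ₗ[ℝ] N₂}
    (h : ∀ i j v w, b i j (α i v) (β j w) = b' i j (f i (α i v)) (β j w)) :
    xprod b α β = xprod b' (fun i => (f i).compAlternatingMap (α i)) β := by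
  funext n
  have := xprod_map (b := b) (b' := b') (f := f) (g := fun _ => LinearMap.id)
    (k := fun _ => LinearMap.id) (α := α) (β := β) h n
  simpa only [id_compAlternatingMap] using this

theorem xprod_map_right {b : ℕ → ℕ → N₁ →ₗ[ℝ] N₂ →ₗ[ℝ] N} {b' : ℕ → ℕ → N₁ →ₗ[ℝ] N₃ →ₗ[ℝ] N'}
    (g : ℕ → N₂ →ₗ[ℝ] N₃) (k : ℕ → N →ₗ[ℝ] N') {α : ∀ n : ℕ, T [⋀^Fin n]→ₗ[ℝ] N₁}
    {β : ∀ n : ℕ, T [⋀^Fin n]→ₗ[ℝ] N₂}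
    (h : ∀ i j v w, k (i + j) (b i j (α i v) (β j w)) = b' i j (α i v) (g j (β j w))) (n : ℕ) :
    (k n).compAlternatingMap (xprod b α β n) =
      xprod b' α (fun j => (g j).compAlternatingMap (β j)) n := by
  have := xprod_map (b := b) (b' := b') (f := fun _ => LinearMap.id) (g := g)
    (k := k) (α := α) (β := β) h n
  simpa only [id_compAlternatingMap] using this

theorem xprod_map_out {b : ℕ → ℕ → N₁ →ₗ[ℝ] N₂ →ₗ[ℝ] N} {b' : ℕ → ℕ → N₁ →ₗ[ℝ] N₂ →ₗ[ℝ] N'}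
    (k : ℕ → N →ₗ[ℝ] N') {α : ∀ n : ℕ, T [⋀^Fin n]→ₗ[ℝ] N₁} {β : ∀ n : ℕ, T [⋀^Fin n]→ₗ[ℝ] N₂}
    (h : ∀ i j v w, k (i + j) (b i j (α i v) (β j w)) = b' i j (α i v) (β j w)) (n : ℕ) :
    (k n).compAlternatingMap (xprod b α β n) = xprod b' α β n := by
  have := xprod_map_right (b := b) (b' := b') (fun _ => LinearMap.id) k (α := α) (β := β) h n
  simpa only [id_compAlternatingMap] using this

/-- Associativity of exterior products, for compatible pairings. -/
theorem xprod_assoc {N₁₂ N₂₃ : Type*} [AddCommGroup N₁₂] [Module ℝ N₁₂] [AddCommGroup N₂₃]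
    [Module ℝ N₂₃] {b : ℕ → ℕ → N₁ →ₗ[ℝ] N₂₃ →ₗ[ℝ] N} {b' : ℕ → ℕ → N₂ →ₗ[ℝ] N₃ →ₗ[ℝ] N₂₃}
    {c : ℕ → ℕ → N₁₂ →ₗ[ℝ] N₃ →ₗ[ℝ] N} {c' : ℕ → ℕ → N₁ →ₗ[ℝ] N₂ →ₗ[ℝ] N₁₂}
    (h : ∀ i j k x y z, b i (j + k) x (b' j k y z) = c (i + j) k (c' i j x y) z)
    (α : ∀ n : ℕ, T [⋀^Fin n]→ₗ[ℝ] N₁) (β : ∀ n : ℕ, T [⋀^Fin n]→ₗ[ℝ] N₂)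
    (γ : ∀ n : ℕ, T [⋀^Fin n]→ₗ[ℝ] N₃) :
    xprod b α (xprod b' β γ) = xprod c (xprod c' α β) γ := by
  funext n
  induction n generalizing b b' c c' α β γ with
  | zero => ext v; simpa only [xprod_zero_apply] using h 0 0 0 _ _ _
  | succ n ih =>
    refine ext_inner1 fun x => ?_
    rw [inner1_xprod, inner1_xprod]
    have e1 : inner1 x (xprod b' β γ) = xprod (fun i j => b' (i + 1) j) (inner1 x β) γ +
      xprod (fun i j => (-1 : ℝ) ^ i • b' i (j + 1)) β (inner1 x γ) := funext (inner1_xprod _ _ _ _)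
    have e2 : inner1 x (xprod c' α β) = xprod (fun i j => c' (i + 1) j) (inner1 x α) β +
      xprod (fun i j => (-1 : ℝ) ^ i • c' i (j + 1)) α (inner1 x β) := funext (inner1_xprod _ _ _ _)
    rw [e1, e2, xprod_add_right, xprod_add_left, Pi.add_apply, Pi.add_apply]
    have h1 := ih (b := fun i j => b (i + 1) j) (b' := b') (c := fun i j => c (i + 1) j)
      (c' := fun i j => c' (i + 1) j) (fun i j k x y z => by
        have := h (i + 1) j k x y z
        rwa [show i + 1 + j = i + j + 1 by omega] at this) (inner1 x α) β γ
    have h2 := ih (b := fun i j => (-1 : ℝ) ^ i • b i (j + 1)) (b' := fun i j => b' (i + 1) j)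
      (c := fun i j => c (i + 1) j) (c' := fun i j => (-1 : ℝ) ^ i • c' i (j + 1))
      (fun i j k x y z => by
        have := h i (j + 1) k x y z
        rw [show j + 1 + k = j + k + 1 by omega] at this
        simp only [LinearMap.smul_apply, map_smul, this]
        rfl) α (inner1 x β) γ
    have h3 := ih (b := fun i j => (-1 : ℝ) ^ i • b i (j + 1))
      (b' := fun i j => (-1 : ℝ) ^ i • b' i (j + 1))
      (c := fun i j => (-1 : ℝ) ^ i • c i (j + 1)) (c' := c')
      (fun i j k x y z => by
        have := h i j (k + 1) x y z
        simp only [LinearMap.smul_apply, map_smul, pow_add, smul_smul]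
        rw [mul_comm]
        congr 1) α β (inner1 x γ)
    rw [h1, h2, h3]
    abel

/-- Graded commutativity of exterior products. For pairings that depend on parities, such as those of
endomorphism-valued forms, the hypothesis is needed only for the values that the forms take. -/
theorem xprod_comm {b : ℕ → ℕ → N₁ →ₗ[ℝ] N₂ →ₗ[ℝ] N} {c : ℕ → ℕ → N₂ →ₗ[ℝ] N₁ →ₗ[ℝ] N}
    {α : ∀ n : ℕ, T [⋀^Fin n]→ₗ[ℝ] N₁} {β : ∀ n : ℕ, T [⋀^Fin n]→ₗ[ℝ] N₂}
    (h : ∀ i j v w, b i j (α i v) (β j w) = (-1 : ℝ) ^ (i * j) • c j i (β j w) (α i v)) :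
    xprod b α β = xprod c β α := by
  funext n
  induction n generalizing b c α β with
  | zero => ext v; simpa only [xprod_zero_apply, mul_zero, pow_zero, one_smul] using h 0 0 v v
  | succ n ih =>
    refine ext_inner1 fun x => ?_
    rw [inner1_xprod, inner1_xprod, add_comm]
    congr 1
    -- The sign `(-1)^i` of the antiderivation turns `(-1)^(i (j + 1))` into `(-1)^(i j)`.
    · refine ih fun i j v w => ?_
      have := h i (j + 1) v (Fin.cons x w)
      simp only [LinearMap.smul_apply]
      refine (congrArg _ this).trans ?_
      rw [smul_smul, ← pow_add, mul_add, mul_one, add_comm, add_assoc, pow_add, ← two_mul, pow_mul]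
      simp
      rfl
    · refine ih fun i j v w => ?_
      have := h (i + 1) j (Fin.cons x v) w
      simp only [LinearMap.smul_apply]
      refine this.trans ?_
      rw [smul_smul, ← pow_add, add_mul, one_mul]
      rfl

/-- The homogeneous form of degree zero with value `e`. -/
def form0 (T : Type*) [AddCommGroup T] [Module ℝ T] (e : N) : ∀ n : ℕ, T [⋀^Fin n]→ₗ[ℝ] N
  | 0 => AlternatingMap.constOfIsEmpty ℝ T (Fin 0) e
  | _ + 1 => 0

theorem form0_zero_apply (e : N) (v : Fin 0 → T) : form0 T e 0 v = e := rfl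

theorem form0_succ (e : N) (n : ℕ) : form0 T e (n + 1) = 0 := rfl

theorem inner1_form0 (e : N) (x : T) : inner1 x (form0 T e) = 0 := rfl

theorem xprod_zero_right (b : ℕ → ℕ → N₁ →ₗ[ℝ] N₂ →ₗ[ℝ] N) (α : ∀ n : ℕ, T [⋀^Fin n]→ₗ[ℝ] N₁) :
    xprod b α (0 : ∀ n : ℕ, T [⋀^Fin n]→ₗ[ℝ] N₂) = 0 := by
  have h := xprod_add_right b α 0 0
  rw [add_zero] at h
  exact left_eq_add.1 h

theorem xprod_zero_left (b : ℕ → ℕ → N₁ →ₗ[ℝ] N₂ →ₗ[ℝ] N) (β : ∀ n : ℕ, T [⋀^Fin n]→ₗ[ℝ] N₂) :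
    xprod b (0 : ∀ n : ℕ, T [⋀^Fin n]→ₗ[ℝ] N₁) β = 0 := by
  have h := xprod_add_left b 0 0 β
  rw [add_zero] at h
  exact left_eq_add.1 h

theorem xprod_form0_right (b : ℕ → ℕ → N₁ →ₗ[ℝ] N₂ →ₗ[ℝ] N) (α : ∀ n : ℕ, T [⋀^Fin n]→ₗ[ℝ] N₁)
    (e : N₂) (n : ℕ) (v : Fin n → T) : xprod b α (form0 T e) n v = b n 0 (α n v) e := by
  induction n generalizing b α with
  | zero => rw [xprod_zero_apply, form0_zero_apply]
  | succ n ih =>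
    have h := congrArg (fun f => f (Fin.tail v)) (inner1_xprod b α (form0 T e) (v 0) n)
    simp only [inner1_form0, xprod_zero_right, Pi.zero_apply, add_zero, ih] at h
    rw [← apply_cons_eq_inner1, ← apply_cons_eq_inner1, Fin.cons_self_tail] at h
    exact h

theorem xprod_form0_left (b : ℕ → ℕ → N₁ →ₗ[ℝ] N₂ →ₗ[ℝ] N) (β : ∀ n : ℕ, T [⋀^Fin n]→ₗ[ℝ] N₂)
    (e : N₁) (n : ℕ) (v : Fin n → T) : xprod b (form0 T e) β n v = b 0 n e (β n v) := by
  have h : xprod b (form0 T e) β = xprod (fun j i => (-1 : ℝ) ^ (i * j) • (b i j).flip) β (form0 T e) :=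
    xprod_comm fun i j v w => by simp [smul_smul, ← mul_pow]
  rw [h, xprod_form0_right]
  simp

end ExteriorProduct

/-! ### The graded algebra of endomorphism-valued forms at a point -/

section Pointwise

variable {𝕜 : Type*} [RCLike 𝕜] {T : Type*} [AddCommGroup T] [Module ℝ T]
  {N : Type*} [AddCommGroup N] [Module ℝ N] [Module 𝕜 N] [IsScalarTower ℝ 𝕜 N]
  {P Q : Type*} [AddCommGroup P] [Module ℝ P] [Module 𝕜 P] [IsScalarTower ℝ 𝕜 P]
  [AddCommGroup Q] [Module ℝ Q] [Module 𝕜 Q] [IsScalarTower ℝ 𝕜 Q]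

theorem grading_mul_self : (grading 𝕜 * grading 𝕜 : Module.End 𝕜 (P × Q)) = 1 := by
  ext v <;> simp [grading]

theorem grading_grading (v : P × Q) : grading 𝕜 (grading 𝕜 v) = v := by
  simp [grading]

/-- Multiplication of inhomogeneous forms by `(-1)^{pn}` in degree `n`. -/
def sgn (p : ℕ) (α : ∀ n : ℕ, T [⋀^Fin n]→ₗ[ℝ] N) (n : ℕ) : T [⋀^Fin n]→ₗ[ℝ] N :=
  (-1 : ℝ) ^ (p * n) • α n

/-- The exterior product of a scalar form with a form, at a point. -/
def wedgeAt (α : ∀ n : ℕ, T [⋀^Fin n]→ₗ[ℝ] 𝕜) (θ : ∀ n : ℕ, T [⋀^Fin n]→ₗ[ℝ] N) :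
    ∀ n : ℕ, T [⋀^Fin n]→ₗ[ℝ] N :=
  xprod (fun _ _ => smulBilin N) α θ

/-- The action of an endomorphism-valued form, at a point. -/
def actAt (S : ∀ n : ℕ, T [⋀^Fin n]→ₗ[ℝ] Module.End 𝕜 (P × Q))
    (θ : ∀ n : ℕ, T [⋀^Fin n]→ₗ[ℝ] (P × Q)) : ∀ n : ℕ, T [⋀^Fin n]→ₗ[ℝ] (P × Q) :=
  xprod (fun _ j => signedApply 𝕜 j) S θ

/-- The pairing `(L, L') ↦ (-1)^{|L| j} L L'` of endomorphisms. Conjugation with the `j`-th power of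
the grading operator encodes the sign for inhomogeneous `L`. -/
def signedMul (j : ℕ) :
    Module.End 𝕜 (P × Q) →ₗ[ℝ] Module.End 𝕜 (P × Q) →ₗ[ℝ] Module.End 𝕜 (P × Q) :=
  LinearMap.mk₂ ℝ (fun L L' => grading 𝕜 ^ j * L * grading 𝕜 ^ j * L')
    (fun L L' v => by simp [mul_add, add_mul]) (fun r L v => by simp)
    (fun L v v' => by simp [mul_add]) (fun r L v => by simp)

/-- The product of endomorphism-valued forms that corresponds to the composition of their actions:
`(α ⊗ L) (β ⊗ L') = (-1)^{|L| |β|} (α ∧ β) ⊗ L L'`. -/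
def mulAt (S S' : ∀ n : ℕ, T [⋀^Fin n]→ₗ[ℝ] Module.End 𝕜 (P × Q)) :
    ∀ n : ℕ, T [⋀^Fin n]→ₗ[ℝ] Module.End 𝕜 (P × Q) :=
  xprod (fun _ j => signedMul j) S S'

/-- The supertrace of an endomorphism-valued form at a point. -/
def strAt (S : ∀ n : ℕ, T [⋀^Fin n]→ₗ[ℝ] Module.End 𝕜 (P × Q)) (n : ℕ) : T [⋀^Fin n]→ₗ[ℝ] 𝕜 :=
  (supertrace 𝕜).compAlternatingMap (S n)

/-- The form `θ` at a point has total parity `p`, the sum of the degree and of the parity of the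
values. Only `p` modulo `2` matters. -/
def HasParity (𝕜 : Type*) [RCLike 𝕜] [Module 𝕜 P] [Module 𝕜 Q] (p : ℕ)
    (θ : ∀ n : ℕ, T [⋀^Fin n]→ₗ[ℝ] (P × Q)) : Prop :=
  ∀ n v, grading 𝕜 (θ n v) = (-1 : ℝ) ^ (p + n) • θ n v

/-- The endomorphism-valued form `S` at a point has total parity `p`. -/
def HasEndParity (p : ℕ) (S : ∀ n : ℕ, T [⋀^Fin n]→ₗ[ℝ] Module.End 𝕜 (P × Q)) : Prop :=
  ∀ n v, grading 𝕜 * S n v * grading 𝕜 = (-1 : ℝ) ^ (p + n) • S n v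

theorem signedApply_apply (j : ℕ) (L : Module.End 𝕜 (P × Q)) (v : P × Q) :
    signedApply 𝕜 j L v = (grading 𝕜 ^ j * L * grading 𝕜 ^ j : Module.End 𝕜 (P × Q)) v := rfl

theorem signedMul_apply (j : ℕ) (L L' : Module.End 𝕜 (P × Q)) :
    signedMul j L L' = grading 𝕜 ^ j * L * grading 𝕜 ^ j * L' := rfl

theorem smulBilin_apply (c : 𝕜) (v : N) : smulBilin N c v = c • v := rfl

theorem grading_pow_mul_self (j : ℕ) :
    (grading 𝕜 ^ j * grading 𝕜 ^ j : Module.End 𝕜 (P × Q)) = 1 := by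
  rw [← (Commute.refl (grading 𝕜 : Module.End 𝕜 (P × Q))).mul_pow, grading_mul_self, one_pow]

theorem grading_conj_pow {L : Module.End 𝕜 (P × Q)} {q : ℕ}
    (h : grading 𝕜 * L * grading 𝕜 = (-1 : ℝ) ^ q • L) (j : ℕ) :
    grading 𝕜 ^ j * L * grading 𝕜 ^ j = (-1 : ℝ) ^ (j * q) • L := by
  induction j with
  | zero => simp
  | succ j ih =>
    have : grading 𝕜 ^ (j + 1) * L * grading 𝕜 ^ (j + 1) =
        grading 𝕜 ^ j * (grading 𝕜 * L * grading 𝕜) * grading 𝕜 ^ j := by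
      calc _ = grading 𝕜 ^ j * grading 𝕜 * L * (grading 𝕜 * grading 𝕜 ^ j) := by
            rw [← pow_succ, ← pow_succ']
        _ = _ := by simp only [mul_assoc]
    rw [this, h, mul_smul_comm, smul_mul_assoc, ih, smul_smul, ← pow_add]
    congr 2; ring

theorem neg_one_pow_congr {m n : ℕ} (h : Even (m + n)) : (-1 : ℝ) ^ m = (-1) ^ n := by
  rcases Nat.even_or_odd m with hm | hm
  · rw [hm.neg_one_pow, ((Nat.even_add.1 h).1 hm).neg_one_pow]
  · have hn : Odd n := by
      rw [← Nat.not_even_iff_odd] at hm ⊢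
      exact fun hn => hm ((Nat.even_add.1 h).2 hn)
    rw [hm.neg_one_pow, hn.neg_one_pow]

/-- Conjugation of endomorphisms by a power of the grading operator. -/
def gradingConj (j : ℕ) : Module.End 𝕜 (P × Q) →ₗ[ℝ] Module.End 𝕜 (P × Q) :=
  LinearMap.mulLeft ℝ (grading 𝕜 ^ j) ∘ₗ LinearMap.mulRight ℝ (grading 𝕜 ^ j)

theorem gradingConj_apply (j : ℕ) (L : Module.End 𝕜 (P × Q)) :
    gradingConj j L = grading 𝕜 ^ j * L * grading 𝕜 ^ j := (mul_assoc _ _ _).symm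

/-- `End E`-valued forms act as a module over their algebra: the signs `(-1)^{|L| |β|}` of the action
and of the product match. -/
theorem actAt_actAt (S S' : ∀ n : ℕ, T [⋀^Fin n]→ₗ[ℝ] Module.End 𝕜 (P × Q))
    (θ : ∀ n : ℕ, T [⋀^Fin n]→ₗ[ℝ] (P × Q)) :
    actAt S (actAt S' θ) = actAt (mulAt S S') θ := by
  refine xprod_assoc (fun i j k x y z => ?_) S S' θ
  simp only [signedApply_apply, signedMul_apply, ← Module.End.mul_apply]
  congr 1
  have h : grading 𝕜 ^ (j + k) * x * grading 𝕜 ^ (j + k) * (grading 𝕜 ^ k * y * grading 𝕜 ^ k) =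
      grading 𝕜 ^ k * (grading 𝕜 ^ j * x * grading 𝕜 ^ j) *
        (grading 𝕜 ^ k * grading 𝕜 ^ k) * y * grading 𝕜 ^ k := by
    rw [show grading 𝕜 ^ (j + k) * x = grading 𝕜 ^ k * grading 𝕜 ^ j * x by
      rw [← pow_add, add_comm], pow_add]
    simp only [mul_assoc]
  rw [h, grading_pow_mul_self]
  simp only [mul_assoc, one_mul]

theorem wedgeAt_actAt (α : ∀ n : ℕ, T [⋀^Fin n]→ₗ[ℝ] 𝕜)
    (S : ∀ n : ℕ, T [⋀^Fin n]→ₗ[ℝ] Module.End 𝕜 (P × Q))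
    (θ : ∀ n : ℕ, T [⋀^Fin n]→ₗ[ℝ] (P × Q)) :
    wedgeAt α (actAt S θ) = actAt (wedgeAt α S) θ := by
  refine xprod_assoc (fun i j k x y z => ?_) α S θ
  simp [signedApply_apply, smulBilin_apply]

theorem wedgeAt_sgn (p : ℕ) (α : ∀ n : ℕ, T [⋀^Fin n]→ₗ[ℝ] 𝕜) (θ : ∀ n : ℕ, T [⋀^Fin n]→ₗ[ℝ] N) :
    wedgeAt (sgn p α) θ =
      xprod (fun i _ => (smulBilin N) ∘ₗ ((-1 : ℝ) ^ (p * i) • LinearMap.id)) α θ := by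
  have hs : sgn p α = fun i => ((-1 : ℝ) ^ (p * i) • LinearMap.id :
      𝕜 →ₗ[ℝ] 𝕜).compAlternatingMap (α i) := by
    funext i
    ext v
    simp only [sgn, AlternatingMap.smul_apply, LinearMap.compAlternatingMap_apply,
      LinearMap.smul_apply, LinearMap.id_apply]
  rw [hs, wedgeAt]
  refine (xprod_map_left (b := fun i _ => (smulBilin N) ∘ₗ ((-1 : ℝ) ^ (p * i) • LinearMap.id))
    (b' := fun _ _ => smulBilin N)
    (fun i => (-1 : ℝ) ^ (p * i) • LinearMap.id) fun i j v w => ?_).symm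
  rw [LinearMap.comp_apply]

/-- The pairing `(L, z) ↦ (-1)^{|L| j} z L`. -/
def signedSMulRight (j : ℕ) : Module.End 𝕜 (P × Q) →ₗ[ℝ] 𝕜 →ₗ[ℝ] Module.End 𝕜 (P × Q) :=
  (smulBilin (Module.End 𝕜 (P × Q))).flip ∘ₗ gradingConj j

theorem signedSMulRight_apply (j : ℕ) (L : Module.End 𝕜 (P × Q)) (z : 𝕜) :
    signedSMulRight j L z = z • (grading 𝕜 ^ j * L * grading 𝕜 ^ j) := by
  rw [← gradingConj_apply]; rfl

/-- Endomorphism-valued forms of parity `p` supercommute with scalar forms. -/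
theorem actAt_wedgeAt {p : ℕ} {S : ∀ n : ℕ, T [⋀^Fin n]→ₗ[ℝ] Module.End 𝕜 (P × Q)}
    (hS : HasEndParity p S) (α : ∀ n : ℕ, T [⋀^Fin n]→ₗ[ℝ] 𝕜)
    (θ : ∀ n : ℕ, T [⋀^Fin n]→ₗ[ℝ] (P × Q)) :
    actAt S (wedgeAt α θ) = wedgeAt (sgn p α) (actAt S θ) := by
  have h1 : actAt S (wedgeAt α θ) = actAt (xprod (fun _ j => signedSMulRight j) S α) θ := by
    refine xprod_assoc (fun i j k x y z => ?_) S α θ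
    rw [signedSMulRight_apply, signedApply_apply, signedApply_apply, smulBilin_apply, map_smul,
      mul_smul_comm, smul_mul_assoc, LinearMap.smul_apply]
    congr 2
    rw [show grading 𝕜 ^ (j + k) * x = grading 𝕜 ^ k * grading 𝕜 ^ j * x by
      rw [← pow_add, add_comm], pow_add]
    simp only [mul_assoc]
  have h2 : xprod (fun _ j => signedSMulRight j) S α = wedgeAt (sgn p α) S := by
    rw [wedgeAt_sgn]
    refine xprod_comm fun i j v w => ?_
    rw [signedSMulRight_apply, grading_conj_pow (hS i v), LinearMap.comp_apply,
      LinearMap.smul_apply, LinearMap.id_apply, smulBilin_apply, smul_assoc, smul_smul, smul_comm,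
      ← pow_add]
    congr 2; ring
  rw [wedgeAt_actAt, h1, h2]

theorem actAt_form0 (S : ∀ n : ℕ, T [⋀^Fin n]→ₗ[ℝ] Module.End 𝕜 (P × Q)) (e : P × Q) (n : ℕ)
    (v : Fin n → T) : actAt S (form0 T e) n v = S n v e := by
  rw [actAt, xprod_form0_right, signedApply_apply]
  simp

theorem wedgeAt_form0 (c : 𝕜) (θ : ∀ n : ℕ, T [⋀^Fin n]→ₗ[ℝ] N) (n : ℕ) (v : Fin n → T) :
    wedgeAt (form0 T c) θ n v = c • θ n v := by
  rw [wedgeAt, xprod_form0_left, smulBilin_apply]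

theorem wedgeAt_form0_right (α : ∀ n : ℕ, T [⋀^Fin n]→ₗ[ℝ] 𝕜) (e : N) (n : ℕ) (v : Fin n → T) :
    wedgeAt α (form0 T e) n v = α n v • e := by
  rw [wedgeAt, xprod_form0_right, smulBilin_apply]

theorem sgn_form0 (p : ℕ) (e : N) : sgn p (form0 T e) = form0 T e := by
  funext n
  cases n with
  | zero => simp [sgn]
  | succ n => simp [sgn, form0_succ]

theorem HasParity.actAt {p q : ℕ} {S : ∀ n : ℕ, T [⋀^Fin n]→ₗ[ℝ] Module.End 𝕜 (P × Q)}
    {θ : ∀ n : ℕ, T [⋀^Fin n]→ₗ[ℝ] (P × Q)} (hS : HasEndParity p S) (hθ : HasParity 𝕜 q θ) :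
    HasParity 𝕜 (p + q) (actAt S θ) := by
  intro n v
  -- The map `C` is the identity exactly on forms of parity `p + q`; by `xprod_map_out` it fixes the
  -- product, because it fixes the products of the values.
  let C : ℕ → (P × Q) →ₗ[ℝ] (P × Q) := fun m =>
    (-1 : ℝ) ^ (p + q + m) • (grading 𝕜).restrictScalars ℝ
  have h := xprod_map_out (b := fun _ j => signedApply 𝕜 j) (b' := fun _ j => signedApply 𝕜 j) C
    (α := S) (β := θ)
    (fun i j v w => by
      simp only [C, LinearMap.smul_apply, LinearMap.restrictScalars_apply,
        signedApply_apply, grading_conj_pow (hS i v)]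
      have : grading 𝕜 (S i v (θ j w)) =
          (grading 𝕜 * S i v * grading 𝕜 : Module.End 𝕜 (P × Q)) (grading 𝕜 (θ j w)) := by
        rw [Module.End.mul_apply, Module.End.mul_apply, grading_grading]
      rw [LinearMap.map_smul_of_tower, this, hS i v, hθ j w, LinearMap.smul_apply,
        LinearMap.map_smul_of_tower, smul_smul, smul_smul, smul_smul]
      congr 1
      simp only [← pow_add]
      exact neg_one_pow_congr ⟨p + q + i + j + j * (p + i), by ring⟩) n
  have h' : (-1 : ℝ) ^ (p + q + n) • grading 𝕜 (PrimitiveChernWeil.actAt S θ n v) =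
      PrimitiveChernWeil.actAt S θ n v :=
    congrArg (fun f => f v) h
  nth_rewrite 2 [← h']
  rw [smul_smul, ← mul_pow]
  simp

/-- The endomorphism-valued form `α ⊗ 1`. -/
def scalarEndAt (α : ∀ n : ℕ, T [⋀^Fin n]→ₗ[ℝ] 𝕜) (n : ℕ) :
    T [⋀^Fin n]→ₗ[ℝ] Module.End 𝕜 (P × Q) :=
  ((smulBilin (Module.End 𝕜 (P × Q))).flip 1).compAlternatingMap (α n)

theorem mulAt_scalarEndAt (α : ∀ n : ℕ, T [⋀^Fin n]→ₗ[ℝ] 𝕜)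
    (S : ∀ n : ℕ, T [⋀^Fin n]→ₗ[ℝ] Module.End 𝕜 (P × Q)) :
    mulAt (scalarEndAt α) S = wedgeAt α S := by
  refine (xprod_map_left (fun _ => (smulBilin (Module.End 𝕜 (P × Q))).flip 1)
    fun i j v w => ?_).symm
  simp only [signedMul_apply, LinearMap.flip_apply, smulBilin_apply,
    mul_smul_comm, smul_mul_assoc, mul_one, grading_pow_mul_self, one_mul]

theorem actAt_scalarEndAt (α : ∀ n : ℕ, T [⋀^Fin n]→ₗ[ℝ] 𝕜)
    (θ : ∀ n : ℕ, T [⋀^Fin n]→ₗ[ℝ] (P × Q)) : actAt (scalarEndAt α) θ = wedgeAt α θ := by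
  refine (xprod_map_left (fun _ => (smulBilin (Module.End 𝕜 (P × Q))).flip 1)
    fun i j v w => ?_).symm
  simp only [signedApply_apply, LinearMap.flip_apply, smulBilin_apply,
    mul_smul_comm, smul_mul_assoc, mul_one, grading_pow_mul_self, LinearMap.smul_apply,
    Module.End.one_apply]

section Trace

variable [FiniteDimensional 𝕜 P] [FiniteDimensional 𝕜 Q]

/-- The supertrace is the trace of the composition with the grading operator. -/
theorem supertrace_eq_trace (L : Module.End 𝕜 (P × Q)) :
    supertrace 𝕜 L = LinearMap.trace 𝕜 (P × Q) (grading 𝕜 * L) := by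
  have h : ∀ M : Module.End 𝕜 (P × Q), LinearMap.trace 𝕜 (P × Q) M =
      LinearMap.trace 𝕜 P (LinearMap.fst 𝕜 P Q ∘ₗ M ∘ₗ LinearMap.inl 𝕜 P Q) +
      LinearMap.trace 𝕜 Q (LinearMap.snd 𝕜 P Q ∘ₗ M ∘ₗ LinearMap.inr 𝕜 P Q) := by
    intro M
    have h1 := LinearMap.trace_comp_comm' (LinearMap.fst 𝕜 P Q) (M ∘ₗ LinearMap.inl 𝕜 P Q)
    have h2 := LinearMap.trace_comp_comm' (LinearMap.snd 𝕜 P Q) (M ∘ₗ LinearMap.inr 𝕜 P Q)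
    rw [← h1, ← h2, ← map_add]
    congr 1
    ext v <;> simp [← Prod.zero_eq_mk]
  rw [h, supertrace]
  simp only [LinearMap.coe_mk, AddHom.coe_mk]
  rw [sub_eq_add_neg, ← map_neg]
  congr 2

theorem supertrace_smul (c : 𝕜) (L : Module.End 𝕜 (P × Q)) :
    supertrace 𝕜 (c • L) = c • supertrace 𝕜 L := by
  rw [supertrace_eq_trace, supertrace_eq_trace, mul_smul_comm, map_smul]

/-- The supertrace is supersymmetric on homogeneous endomorphisms. If their parities differ, the
product is odd and both sides vanish. -/
theorem supertrace_mul_comm {L M : Module.End 𝕜 (P × Q)} {a b : ℕ}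
    (hL : grading 𝕜 * L * grading 𝕜 = (-1 : ℝ) ^ a • L)
    (hM : grading 𝕜 * M * grading 𝕜 = (-1 : ℝ) ^ b • M) :
    supertrace 𝕜 (L * M) = (-1 : ℝ) ^ (a * b) • supertrace 𝕜 (M * L) := by
  -- Cyclicity of the trace gives the sign `(-1)^b`.
  have h1 : supertrace 𝕜 (L * M) = (-1 : ℝ) ^ b • supertrace 𝕜 (M * L) := by
    rw [← map_smul, ← smul_mul_assoc, ← hM, supertrace_eq_trace, supertrace_eq_trace, ← mul_assoc,
      LinearMap.trace_mul_comm]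
    congr 1
    simp only [← mul_assoc, grading_mul_self, one_mul]
  -- An endomorphism of odd parity has supertrace zero.
  have h2 : supertrace 𝕜 (M * L) = (-1 : ℝ) ^ (a + b) • supertrace 𝕜 (M * L) := by
    have : (-1 : ℝ) ^ (a + b) • (M * L) = grading 𝕜 * (M * L) * grading 𝕜 := by
      rw [show grading 𝕜 * (M * L) * grading 𝕜 =
        (grading 𝕜 * M * grading 𝕜) * (grading 𝕜 * L * grading 𝕜) by
          rw [mul_assoc (grading 𝕜 * M), ← mul_assoc (grading 𝕜) (grading 𝕜 * L),
            ← mul_assoc (grading 𝕜) (grading 𝕜), grading_mul_self]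
          simp [mul_assoc], hL, hM, smul_mul_smul_comm, ← pow_add, add_comm]
    rw [← map_smul, this, supertrace_eq_trace, supertrace_eq_trace,
      ← mul_assoc (grading 𝕜) (_ * _) (grading 𝕜), ← mul_assoc (grading 𝕜) (grading 𝕜),
      grading_mul_self, one_mul, LinearMap.trace_mul_comm]
  rw [h1]
  rcases Nat.even_or_odd b with hb | hb
  · rw [hb.neg_one_pow, (hb.mul_left a).neg_one_pow]
  · rcases Nat.even_or_odd a with ha | ha
    · rw [(ha.add_odd hb).neg_one_pow] at h2
      have h3 : supertrace 𝕜 (M * L) = 0 := by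
        have h4 : (2 : ℝ) • supertrace 𝕜 (M * L) = 0 := by
          rw [two_smul]; nth_rewrite 2 [h2]; simp
        simpa using h4
      rw [h3]; simp
    · rw [hb.neg_one_pow, (ha.mul hb).neg_one_pow]

/-- The supertrace of forms vanishes on supercommutators: the signs from exchanging the forms, from
the product of `End E`-valued forms and from `supertrace_mul_comm` combine to `(-1)^{pq}`. -/
theorem strAt_mulAt_comm {p q : ℕ} {S S' : ∀ n : ℕ, T [⋀^Fin n]→ₗ[ℝ] Module.End 𝕜 (P × Q)}
    (hS : HasEndParity p S) (hS' : HasEndParity q S') :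
    strAt (mulAt S S') = (-1 : ℝ) ^ (p * q) • strAt (mulAt S' S) := by
  let B : ℕ → Module.End 𝕜 (P × Q) →ₗ[ℝ] Module.End 𝕜 (P × Q) →ₗ[ℝ] 𝕜 := fun j =>
    (signedMul j).compr₂ (supertrace 𝕜)
  have hB : ∀ S S' : ∀ n : ℕ, T [⋀^Fin n]→ₗ[ℝ] Module.End 𝕜 (P × Q),
      strAt (mulAt S S') = xprod (fun _ j => B j) S S' := by
    intro S S'
    funext n
    exact xprod_map_out (b := fun _ j => signedMul j) (b' := fun _ j => B j) (α := S) (β := S')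
      (fun _ => supertrace 𝕜) (fun i j v w => rfl) n
  have h1 : xprod (fun _ j => B j) S S' = xprod (fun _ j => (-1 : ℝ) ^ (p * q) • B j) S' S := by
    refine xprod_comm fun i j v w => ?_
    simp only [B, LinearMap.compr₂_apply, signedMul_apply, grading_conj_pow (hS i v),
      grading_conj_pow (hS' j w), LinearMap.smul_apply, smul_mul_assoc, map_smul, smul_smul]
    rw [supertrace_mul_comm (hS i v) (hS' j w), smul_smul]
    simp only [← pow_add]
    congr 1
    exact neg_one_pow_congr ⟨p * j + i * j + p * q + i * q + i * j, by ring⟩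
  rw [hB, hB, h1]
  funext n
  exact (xprod_map_out (b := fun _ j => B j) (b' := fun _ j => (-1 : ℝ) ^ (p * q) • B j) (α := S') (β := S)
    (fun _ => (-1 : ℝ) ^ (p * q) • LinearMap.id) (fun i j v w => rfl) n).symm

theorem strAt_wedgeAt (α : ∀ n : ℕ, T [⋀^Fin n]→ₗ[ℝ] 𝕜)
    (S : ∀ n : ℕ, T [⋀^Fin n]→ₗ[ℝ] Module.End 𝕜 (P × Q)) :
    strAt (wedgeAt α S) = wedgeAt α (strAt S) := by
  funext n
  exact xprod_map_right (b := fun _ _ => smulBilin (Module.End 𝕜 (P × Q)))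
    (b' := fun _ _ => smulBilin 𝕜) (α := α) (β := S) (fun _ => supertrace 𝕜) (fun _ => supertrace 𝕜)
    (fun i j v w => supertrace_smul _ _) n

end Trace

end Pointwise

/-! ### The exterior derivative -/

section ExteriorDerivative

open Topology Filter

variable {V : Type*} [NormedAddCommGroup V] [NormedSpace ℝ V] [FiniteDimensional ℝ V]
  {K : Type*} [NormedAddCommGroup K] [NormedSpace ℝ K]

/-- A map into alternating forms on a finite-dimensional space is smooth if its values on constant
vectors are smooth. -/
theorem contDiffAt_alternating [FiniteDimensional ℝ K] {H : Type*} [NormedAddCommGroup H]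
    [NormedSpace ℝ H] {n : ℕ}
    {f : H → V [⋀^Fin n]→L[ℝ] K} {x : H} (hf : ∀ u : Fin n → V, ContDiffAt ℝ ∞ (fun y => f y u) x) :
    ContDiffAt ℝ ∞ f x := by
  let b := Module.finBasis ℝ V
  let L : (V [⋀^Fin n]→L[ℝ] K) →ₗ[ℝ] ((Fin n → Fin (Module.finrank ℝ V)) → K) :=
    { toFun := fun g r => g fun i => b (r i)
      map_add' := fun _ _ => rfl
      map_smul' := fun _ _ => rfl }
  have hL : LinearMap.ker L = ⊥ := by
    rw [LinearMap.ker_eq_bot]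
    intro g g' h
    have : g.toAlternatingMap = g'.toAlternatingMap :=
      b.ext_alternating fun r _ => congrFun h r
    exact ContinuousAlternatingMap.toAlternatingMap_injective this
  obtain ⟨L', hL'⟩ := L.exists_leftInverse_of_injective hL
  have h1 : f = fun y => LinearMap.toContinuousLinearMap L' (fun r => f y fun i => b (r i)) :=
    funext fun y => (congrArg (fun g => g (f y)) hL').symm
  rw [h1]
  exact (LinearMap.toContinuousLinearMap L').contDiff.contDiffAt.comp x
    (contDiffAt_pi.2 fun r => hf _)

theorem minSmoothness_two_le : minSmoothness ℝ 2 ≤ ∞ := by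
  rw [minSmoothness_of_isRCLikeNormedField]
  exact WithTop.coe_le_coe.2 (le_top : (2 : ℕ∞) ≤ ⊤)

/-- Expansion of an alternating form in a basis. -/
theorem alternating_apply_eq_sum {n : ℕ} {ι : Type*} [Fintype ι] (b : Module.Basis ι ℝ V)
    (f : V [⋀^Fin n]→L[ℝ] K) (u : Fin n → V) :
    f u = ∑ r : Fin n → ι, (∏ i, b.repr (u i) (r i)) • f (fun i => b (r i)) := by
  classical
  have : u = fun i => ∑ j, b.repr (u i) j • b j := by
    funext i; exact (b.sum_repr (u i)).symm
  conv_lhs => rw [this]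
  rw [← ContinuousAlternatingMap.coe_toAlternatingMap, ← AlternatingMap.coe_multilinearMap,
    MultilinearMap.map_sum]
  refine Finset.sum_congr rfl fun r _ => ?_
  rw [MultilinearMap.map_smul_univ]

variable {M : Type*} [TopologicalSpace M] [ChartedSpace V M]

theorem contMDiffAt_alternating_apply {n : ℕ} {f : M → V [⋀^Fin n]→L[ℝ] K} {u : Fin n → M → V} {x : M}
    (hf : ContMDiffAt 𝓘(ℝ, V) 𝓘(ℝ, V [⋀^Fin n]→L[ℝ] K) ∞ f x)
    (hu : ∀ i, ContMDiffAt 𝓘(ℝ, V) 𝓘(ℝ, V) ∞ (u i) x) :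
    ContMDiffAt 𝓘(ℝ, V) 𝓘(ℝ, K) ∞ (fun y => f y fun i => u i y) x := by
  let b := Module.finBasis ℝ V
  have h : (fun y => f y fun i => u i y) = fun y => ∑ r : Fin n → Fin (Module.finrank ℝ V),
      (∏ i, b.repr (u i y) (r i)) • f y (fun i => b (r i)) :=
    funext fun y => alternating_apply_eq_sum b _ _
  rw [h]
  refine ContMDiffAt.sum fun r _ => ?_
  have h1 : ∀ i, ContMDiffAt 𝓘(ℝ, V) 𝓘(ℝ, ℝ) ∞ (fun y => b.repr (u i y) (r i)) x := fun i =>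
    ((LinearMap.toContinuousLinearMap (b.coord (r i))).contMDiff _).comp x (hu i)
  have h2 : ContMDiffAt 𝓘(ℝ, V) 𝓘(ℝ, ℝ) ∞ (fun y => ∏ i, b.repr (u i y) (r i)) x :=
    contMDiffAt_finsetProd fun i _ => h1 i
  have h3 : ContMDiffAt 𝓘(ℝ, V) 𝓘(ℝ, K) ∞ (fun y => f y fun i => b (r i)) x :=
    ((ContinuousAlternatingMap.apply ℝ V K fun i => b (r i)).contMDiff _).comp x hf
  exact h2.smul h3

/-- The coordinate expression of the form `α` in the chart at `x`. -/
def chartRep {n : ℕ} (x : M) (α : ∀ y : M, TangentSpace 𝓘(ℝ, V) y [⋀^Fin n]→ₗ[ℝ] K) (y : V) :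
    V [⋀^Fin n]→L[ℝ] K :=
  toContinuousAlternating ((α ((extChartAt 𝓘(ℝ, V) x).symm y)).compLinearMap
    (mfderiv 𝓘(ℝ, V) 𝓘(ℝ, V) (extChartAt 𝓘(ℝ, V) x).symm y : V →L[ℝ] _).toLinearMap)

theorem chartRep_apply {n : ℕ} (x : M) (α : ∀ y : M, TangentSpace 𝓘(ℝ, V) y [⋀^Fin n]→ₗ[ℝ] K) (y : V)
    (u : Fin n → V) : chartRep x α y u = α ((extChartAt 𝓘(ℝ, V) x).symm y)
      fun i => mfderiv 𝓘(ℝ, V) 𝓘(ℝ, V) (extChartAt 𝓘(ℝ, V) x).symm y (u i) := rfl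

theorem extDerivForm_apply {n : ℕ} (α : ∀ y : M, TangentSpace 𝓘(ℝ, V) y [⋀^Fin n]→ₗ[ℝ] K) (x : M)
    (v : Fin (n + 1) → TangentSpace 𝓘(ℝ, V) x) :
    extDerivForm α x v = extDeriv (chartRep x α) (extChartAt 𝓘(ℝ, V) x x)
      fun i => mfderiv 𝓘(ℝ, V) 𝓘(ℝ, V) (extChartAt 𝓘(ℝ, V) x) x (v i) := rfl

theorem chartRep_congr {n : ℕ} {x : M} {α β : ∀ y : M, TangentSpace 𝓘(ℝ, V) y [⋀^Fin n]→ₗ[ℝ] K}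
    (h : ∀ᶠ y in 𝓝 x, α y = β y) :
    chartRep x α =ᶠ[𝓝 (extChartAt 𝓘(ℝ, V) x x)] chartRep x β := by
  have h1 : Tendsto (extChartAt 𝓘(ℝ, V) x).symm (𝓝 (extChartAt 𝓘(ℝ, V) x x)) (𝓝 x) := by
    have := continuousAt_extChartAt_symm (I := 𝓘(ℝ, V)) x
    rwa [ContinuousAt, extChartAt_to_inv] at this
  filter_upwards [h1.eventually h] with y hy
  rw [chartRep, chartRep, hy]

theorem extDerivForm_congr {n : ℕ} {x : M} {α β : ∀ y : M, TangentSpace 𝓘(ℝ, V) y [⋀^Fin n]→ₗ[ℝ] K}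
    (h : ∀ᶠ y in 𝓝 x, α y = β y) : extDerivForm α x = extDerivForm β x := by
  ext v
  rw [extDerivForm_apply, extDerivForm_apply, (chartRep_congr h).extDeriv_eq]

theorem extDerivForm_smul {n : ℕ} (c : ℝ) (α : ∀ y : M, TangentSpace 𝓘(ℝ, V) y [⋀^Fin n]→ₗ[ℝ] K)
    (x : M) : extDerivForm (fun y => c • α y) x = c • extDerivForm α x := by
  ext v
  have h : chartRep x (fun y => c • α y) = c • chartRep x α := by
    funext y; ext u; rfl
  rw [extDerivForm_apply, h, extDeriv_smul]
  rfl

variable [IsManifold 𝓘(ℝ, V) ∞ M]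

/-- In the trivialization of `TM` given by the chart at `x`, a tangent vector is represented by its
image under the derivative of the chart. -/
theorem mfderiv_extChartAt_eq_trivializationAt {x y : M} (hy : y ∈ (chartAt V x).source)
    (v : TangentSpace 𝓘(ℝ, V) y) :
    (mfderiv 𝓘(ℝ, V) 𝓘(ℝ, V) (extChartAt 𝓘(ℝ, V) x) y v : V) =
      (trivializationAt V (TangentSpace 𝓘(ℝ, V)) x ⟨y, v⟩).2 := by
  have h := TangentBundle.continuousLinearMapAt_trivializationAt (𝕜 := ℝ) (I := 𝓘(ℝ, V)) (x₀ := x)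
    (x := y) hy
  have hy' : y ∈ (trivializationAt V (TangentSpace 𝓘(ℝ, V) : M → Type _) x).baseSet := by
    rwa [TangentBundle.trivializationAt_baseSet]
  have h2 : (trivializationAt V (TangentSpace 𝓘(ℝ, V) : M → Type _) x).continuousLinearMapAt ℝ y v =
      (trivializationAt V (TangentSpace 𝓘(ℝ, V)) x ⟨y, v⟩).2 := by
    rw [Trivialization.continuousLinearMapAt_apply, Trivialization.coe_linearMapAt_of_mem _ hy']
  exact (congrArg (fun f => f v) h).symm.trans h2

theorem mfderiv_extChartAt_symm_eq_trivializationAt {x y : M} (hy : y ∈ (chartAt V x).source)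
    (u : V) :
    ((trivializationAt V (TangentSpace 𝓘(ℝ, V)) x).symm y u) =
      mfderiv 𝓘(ℝ, V) 𝓘(ℝ, V) (extChartAt 𝓘(ℝ, V) x).symm (extChartAt 𝓘(ℝ, V) x y) u := by
  have h := TangentBundle.symmL_trivializationAt (𝕜 := ℝ) (I := 𝓘(ℝ, V)) (x₀ := x) (x := y) hy
  simp only [modelWithCornersSelf_coe, Set.range_id, mfderivWithin_univ] at h
  have h2 : (trivializationAt V (TangentSpace 𝓘(ℝ, V) : M → Type _) x).symmL ℝ y u =
      (trivializationAt V (TangentSpace 𝓘(ℝ, V)) x).symm y u := by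
    rw [Trivialization.symmL_apply]
    rwa [TangentBundle.trivializationAt_baseSet]
  exact h2.symm.trans (congrArg (fun f => f u) h)

variable [T2Space M]

/-- The coordinate expression of a smooth family of forms is smooth. -/
theorem contDiffAt_chartRep [FiniteDimensional ℝ K] {n : ℕ}
    {α : ℝ → ∀ y : M, TangentSpace 𝓘(ℝ, V) y [⋀^Fin n]→ₗ[ℝ] K}
    (hα : ∀ X : Fin n → VectorField V M, ContMDiff (𝓘(ℝ, ℝ).prod 𝓘(ℝ, V)) 𝓘(ℝ, K) ∞
      fun p : ℝ × M => α p.1 p.2 fun i => X i p.2) (t : ℝ) (x : M) :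
    ContDiffAt ℝ ∞ (fun p : ℝ × V => chartRep x (α p.1) p.2) (t, extChartAt 𝓘(ℝ, V) x x) := by
  refine contDiffAt_alternating fun u => ?_
  set e := trivializationAt V (TangentSpace 𝓘(ℝ, V) : M → Type _) x with he
  have hx : x ∈ e.baseSet := FiberBundle.mem_baseSet_trivializationAt' x
  -- Constant vectors in the chart are extended to global vector fields.
  choose X hX using fun i => exists_section_extending (V := V) V
    (W := (TangentSpace 𝓘(ℝ, V) : M → Type _)) (e.symm x (u i))
  have h1 : ContMDiffAt 𝓘(ℝ, V) 𝓘(ℝ, V) ∞ (extChartAt 𝓘(ℝ, V) x).symm (extChartAt 𝓘(ℝ, V) x x) :=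
    (contMDiffOn_extChartAt_symm x).contMDiffAt (extChartAt_target_mem_nhds x)
  have h2 : ContMDiffAt (𝓘(ℝ, ℝ).prod 𝓘(ℝ, V)) (𝓘(ℝ, ℝ).prod 𝓘(ℝ, V)) ∞
      (fun p : ℝ × V => (p.1, (extChartAt 𝓘(ℝ, V) x).symm p.2)) (t, extChartAt 𝓘(ℝ, V) x x) :=
    contMDiffAt_fst.prodMk (h1.comp (t, extChartAt 𝓘(ℝ, V) x x) contMDiffAt_snd)
  have h3 := (hα X _).comp (t, extChartAt 𝓘(ℝ, V) x x) h2
  rw [← modelWithCornersSelf_prod, chartedSpaceSelf_prod, contMDiffAt_iff_contDiffAt] at h3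
  refine h3.congr_of_eventuallyEq ?_
  have h4 : Tendsto (fun p : ℝ × V => (extChartAt 𝓘(ℝ, V) x).symm p.2)
      (𝓝 (t, extChartAt 𝓘(ℝ, V) x x)) (𝓝 x) := by
    have := (continuousAt_extChartAt_symm (I := 𝓘(ℝ, V)) x).comp
      (x := (t, extChartAt 𝓘(ℝ, V) x x)) (f := Prod.snd) continuousAt_snd
    rwa [ContinuousAt, Function.comp_apply, extChartAt_to_inv] at this
  have h5 : ∀ᶠ p : ℝ × V in 𝓝 (t, extChartAt 𝓘(ℝ, V) x x), p.2 ∈ (extChartAt 𝓘(ℝ, V) x).target :=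
    (continuousAt_snd : ContinuousAt Prod.snd (t, extChartAt 𝓘(ℝ, V) x x)).eventually
      (extChartAt_target_mem_nhds (I := 𝓘(ℝ, V)) x)
  filter_upwards [h4.eventually (Filter.eventually_all.2 hX), h5,
    h4.eventually (extChartAt_source_mem_nhds (I := 𝓘(ℝ, V)) x)] with p hp hp2 hp3
  rw [extChartAt_source] at hp3
  rw [chartRep_apply, Function.comp_apply]
  refine congrArg _ (funext fun i => ?_)
  have h6 := mfderiv_extChartAt_symm_eq_trivializationAt hp3 (u i)
  rw [(extChartAt 𝓘(ℝ, V) x).right_inv hp2] at h6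
  refine h6.symm.trans ?_
  refine Eq.trans ?_ (hp i).symm
  rw [FiberBundle.extend, ← he]
  exact (congrArg (fun w : M × V => e.symm _ w.2) (e.apply_mk_symm hx (u i))).symm

/-- The coordinate expression of a smooth form is smooth. -/
theorem contDiffAt_chartRep_const [FiniteDimensional ℝ K] {n : ℕ}
    {α : ∀ y : M, TangentSpace 𝓘(ℝ, V) y [⋀^Fin n]→ₗ[ℝ] K}
    (hα : ∀ X : Fin n → VectorField V M, ContMDiff 𝓘(ℝ, V) 𝓘(ℝ, K) ∞
      fun y => α y fun i => X i y) (x : M) :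
    ContDiffAt ℝ ∞ (chartRep x α) (extChartAt 𝓘(ℝ, V) x x) := by
  have h := contDiffAt_chartRep (α := fun _ : ℝ => α) (fun X => (hα X).comp contMDiff_snd) 0 x
  exact h.comp (extChartAt 𝓘(ℝ, V) x x) (f := fun y : V => ((0 : ℝ), y))
    (contDiffAt_const.prodMk contDiffAt_id)

/-- The exterior derivative does not depend on the chart. -/
theorem extDerivForm_eq_of_chart {n : ℕ} {α : ∀ y : M, TangentSpace 𝓘(ℝ, V) y [⋀^Fin n]→ₗ[ℝ] K}
    {x y : M} (hy : y ∈ (extChartAt 𝓘(ℝ, V) x).source)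
    (hα : DifferentiableAt ℝ (chartRep x α) (extChartAt 𝓘(ℝ, V) x y))
    (v : Fin (n + 1) → TangentSpace 𝓘(ℝ, V) y) :
    extDerivForm α y v = extDeriv (chartRep x α) (extChartAt 𝓘(ℝ, V) x y)
      fun i => mfderiv 𝓘(ℝ, V) 𝓘(ℝ, V) (extChartAt 𝓘(ℝ, V) x) y (v i) := by
  set φ := extChartAt 𝓘(ℝ, V) x with hφ
  set ψ := extChartAt 𝓘(ℝ, V) y with hψ
  -- The two coordinate expressions differ by the pullback with the transition map `τ`, and the
  -- exterior derivative on `V` commutes with pullbacks.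
  let τ : V → V := fun z => φ (ψ.symm z)
  have hψy : ψ.symm (ψ y) = y := extChartAt_to_inv y
  have hy' : y ∈ (chartAt V x).source := by rwa [hφ, extChartAt_source] at hy
  have hsymm : ∀ x : M, ∀ z ∈ (extChartAt 𝓘(ℝ, V) x).target,
      ContMDiffAt 𝓘(ℝ, V) 𝓘(ℝ, V) ∞ (extChartAt 𝓘(ℝ, V) x).symm z := fun x z hz =>
    (contMDiffOn_extChartAt_symm x).contMDiffAt ((isOpen_extChartAt_target x).mem_nhds hz)
  have hev : ∀ᶠ z in 𝓝 (ψ y), z ∈ ψ.target ∧ ψ.symm z ∈ φ.source := by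
    refine Filter.inter_mem (extChartAt_target_mem_nhds y) ?_
    have := continuousAt_extChartAt_symm (I := 𝓘(ℝ, V)) y
    refine this.eventually ?_
    rw [extChartAt_to_inv]
    exact extChartAt_source_mem_nhds' hy
  have hτ : ∀ z, z ∈ ψ.target → ψ.symm z ∈ φ.source → ContDiffAt ℝ ∞ τ z := by
    intro z hz hz'
    rw [← contMDiffAt_iff_contDiffAt]
    refine ContMDiffAt.comp z (contMDiffAt_extChartAt' ?_) (hsymm y z hz)
    rwa [hφ, extChartAt_source] at hz'
  have hrep : chartRep y α =ᶠ[𝓝 (ψ y)]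
      fun z => (chartRep x α (τ z)).compContinuousLinearMap (fderiv ℝ τ z) := by
    filter_upwards [hev, hev.eventually_nhds] with z hz hz2
    have hφt : τ z ∈ φ.target := φ.map_source hz.2
    have hcomp : mfderiv 𝓘(ℝ, V) 𝓘(ℝ, V) ψ.symm z =
        (mfderiv 𝓘(ℝ, V) 𝓘(ℝ, V) φ.symm (τ z)).comp (mfderiv 𝓘(ℝ, V) 𝓘(ℝ, V) τ z) := by
      rw [← mfderiv_comp z ((hsymm x _ hφt).mdifferentiableAt (by simp))
        ((hτ z hz.1 hz.2).contMDiffAt.mdifferentiableAt (by simp))]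
      refine Filter.EventuallyEq.mfderiv_eq ?_
      filter_upwards [hz2] with w hw
      exact (φ.left_inv hw.2).symm
    rw [mfderiv_eq_fderiv] at hcomp
    ext u
    have h1 : ∀ (p q : M) (_ : p = q) (w : Fin n → V),
        (α p : V [⋀^Fin n]→ₗ[ℝ] K) w = (α q : V [⋀^Fin n]→ₗ[ℝ] K) w := by
      rintro p q rfl w; rfl
    refine Eq.trans ?_ (h1 _ _ (φ.left_inv hz.2).symm _)
    exact congrArg (α (ψ.symm z)) (funext fun i => congrArg (fun f : V →L[ℝ] V => f (u i)) hcomp)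
  have hτy : τ (ψ y) = φ y := congrArg φ hψy
  rw [extDerivForm_apply, hrep.extDeriv_eq,
    extDeriv_pullback (r := ∞) (by rw [hτy]; exact hα) (hτ _ hev.self_of_nhds.1 hev.self_of_nhds.2)
      minSmoothness_two_le, hτy]
  have hcomp : mfderiv 𝓘(ℝ, V) 𝓘(ℝ, V) φ y =
      (mfderiv 𝓘(ℝ, V) 𝓘(ℝ, V) τ (ψ y)).comp (mfderiv 𝓘(ℝ, V) 𝓘(ℝ, V) ψ y) := by
    rw [← mfderiv_comp y ((hτ _ hev.self_of_nhds.1 hev.self_of_nhds.2).contMDiffAt.mdifferentiableAt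
      (by simp)) ((contMDiffAt_extChartAt (n := ∞)).mdifferentiableAt (by simp))]
    refine Filter.EventuallyEq.mfderiv_eq ?_
    filter_upwards [extChartAt_source_mem_nhds (I := 𝓘(ℝ, V)) y] with w hw
    exact congrArg φ (ψ.left_inv hw).symm
  rw [mfderiv_eq_fderiv] at hcomp
  exact congrArg (extDeriv (chartRep x α) (φ y))
    (funext fun i => congrArg (fun f : V →L[ℝ] V => f (v i)) hcomp.symm)

/-- Near `x`, the exterior derivative can be computed in the chart at `x`, although it is defined by
the chart at each point. -/
theorem eventually_extDerivForm_eq {n : ℕ}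
    {α : ∀ y : M, TangentSpace 𝓘(ℝ, V) y [⋀^Fin n]→ₗ[ℝ] K} {x : M}
    (hα : ContDiffAt ℝ ∞ (chartRep x α) (extChartAt 𝓘(ℝ, V) x x)) :
    ∀ᶠ y in 𝓝 x, ∀ v : Fin (n + 1) → TangentSpace 𝓘(ℝ, V) y,
      extDerivForm α y v = extDeriv (chartRep x α) (extChartAt 𝓘(ℝ, V) x y)
        fun i => mfderiv 𝓘(ℝ, V) 𝓘(ℝ, V) (extChartAt 𝓘(ℝ, V) x) y (v i) := by
  have h1 : ∀ᶠ z in 𝓝 (extChartAt 𝓘(ℝ, V) x x), ContDiffAt ℝ 1 (chartRep x α) z :=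
    (hα.of_le (by simp)).eventually (by simp)
  filter_upwards [(continuousAt_extChartAt (I := 𝓘(ℝ, V)) x).eventually h1,
    extChartAt_source_mem_nhds (I := 𝓘(ℝ, V)) x] with y hy hy2 v
  exact extDerivForm_eq_of_chart hy2 (hy.differentiableAt (by simp)) v

theorem contDiffAt_extDeriv [FiniteDimensional ℝ K] {n : ℕ} {f : V → V [⋀^Fin n]→L[ℝ] K} {x : V}
    (hf : ContDiffAt ℝ ∞ f x) : ContDiffAt ℝ ∞ (extDeriv f) x := by
  refine contDiffAt_alternating fun u => ?_
  have h1 : ∀ w : Fin n → V, ContDiffAt ℝ ∞ (fun y => f y w) x := fun w =>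
    (ContinuousAlternatingMap.apply ℝ V K w).contDiff.contDiffAt.comp x hf
  have h2 : ContDiffAt ℝ ∞ (fun y => ∑ i : Fin (n + 1), (-1 : ℤ) ^ i.val •
      fderiv ℝ (fun z => f z (i.removeNth u)) y (u i)) x := by
    refine ContDiffAt.sum fun i _ => ?_
    have h3 : ContDiffAt ℝ ∞ (fun y => fderiv ℝ (fun z => f z (i.removeNth u)) y (u i)) x :=
      ((h1 (i.removeNth u)).fderiv_right (m := ∞) (by simp)).clm_apply contDiffAt_const
    rcases neg_one_pow_eq_or ℤ i.val with h | h
    · simpa only [h, one_smul] using h3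
    · simpa only [h, neg_smul, one_smul] using h3.neg
  refine h2.congr_of_eventuallyEq ?_
  have h3 : ∀ᶠ z in 𝓝 x, ContDiffAt ℝ 1 f z := (hf.of_le (by simp)).eventually (by simp)
  filter_upwards [h3] with y hy
  exact extDeriv_apply (hy.differentiableAt (by simp)) u

theorem contMDiff_extDerivForm [FiniteDimensional ℝ K] {n : ℕ}
    {α : ∀ y : M, TangentSpace 𝓘(ℝ, V) y [⋀^Fin n]→ₗ[ℝ] K}
    (hα : ∀ X : Fin n → VectorField V M, ContMDiff 𝓘(ℝ, V) 𝓘(ℝ, K) ∞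
      fun y => α y fun i => X i y) (X : Fin (n + 1) → VectorField V M) :
    ContMDiff 𝓘(ℝ, V) 𝓘(ℝ, K) ∞ fun y => extDerivForm α y fun i => X i y := by
  intro x
  have h1 := contDiffAt_chartRep_const hα x
  have h2 : ContMDiffAt 𝓘(ℝ, V) 𝓘(ℝ, K) ∞
      (fun y => extDeriv (chartRep x α) (extChartAt 𝓘(ℝ, V) x y) fun i =>
        (trivializationAt V (TangentSpace 𝓘(ℝ, V)) x ⟨y, X i y⟩).2) x := by
    refine contMDiffAt_alternating_apply ?_ fun i => ?_
    · exact (contDiffAt_extDeriv h1).contMDiffAt.comp x contMDiffAt_extChartAt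
    · exact (Bundle.contMDiffAt_section x).1 ((X i).contMDiff x)
  refine h2.congr_of_eventuallyEq ?_
  filter_upwards [eventually_extDerivForm_eq h1, extChartAt_source_mem_nhds (I := 𝓘(ℝ, V)) x]
    with y hy hy2
  rw [extChartAt_source] at hy2
  rw [hy]
  exact congrArg _ (funext fun i => mfderiv_extChartAt_eq_trivializationAt hy2 _)

theorem chartRep_extDerivForm {n : ℕ} {α : ∀ y : M, TangentSpace 𝓘(ℝ, V) y [⋀^Fin n]→ₗ[ℝ] K} {x : M}
    (hα : ContDiffAt ℝ ∞ (chartRep x α) (extChartAt 𝓘(ℝ, V) x x)) :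
    chartRep x (extDerivForm α) =ᶠ[𝓝 (extChartAt 𝓘(ℝ, V) x x)] extDeriv (chartRep x α) := by
  have h1 : Tendsto (extChartAt 𝓘(ℝ, V) x).symm (𝓝 (extChartAt 𝓘(ℝ, V) x x)) (𝓝 x) := by
    have := continuousAt_extChartAt_symm (I := 𝓘(ℝ, V)) x
    rwa [ContinuousAt, extChartAt_to_inv] at this
  filter_upwards [h1.eventually (eventually_extDerivForm_eq hα),
    (extChartAt_target_mem_nhds (I := 𝓘(ℝ, V)) x)] with z hz hz2
  have hzs := (extChartAt 𝓘(ℝ, V) x).map_target hz2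
  ext u
  rw [chartRep_apply, hz, (extChartAt 𝓘(ℝ, V) x).right_inv hz2]
  refine congrArg _ (funext fun i => ?_)
  have hcomp : mfderiv 𝓘(ℝ, V) 𝓘(ℝ, V) (id : V → V) z =
      (mfderiv 𝓘(ℝ, V) 𝓘(ℝ, V) (extChartAt 𝓘(ℝ, V) x) ((extChartAt 𝓘(ℝ, V) x).symm z)).comp
        (mfderiv 𝓘(ℝ, V) 𝓘(ℝ, V) (extChartAt 𝓘(ℝ, V) x).symm z) := by
    rw [← mfderiv_comp z ((contMDiffAt_extChartAt' (n := ∞)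
      (by rwa [extChartAt_source] at hzs)).mdifferentiableAt (by simp))
      (((contMDiffOn_extChartAt_symm (n := ∞) x).contMDiffAt
        ((isOpen_extChartAt_target x).mem_nhds hz2)).mdifferentiableAt (by simp))]
    refine Filter.EventuallyEq.mfderiv_eq ?_
    filter_upwards [(isOpen_extChartAt_target (I := 𝓘(ℝ, V)) x).mem_nhds hz2] with w hw
    exact ((extChartAt 𝓘(ℝ, V) x).right_inv hw).symm
  rw [mfderiv_id] at hcomp
  exact congrArg (fun f : V →L[ℝ] V => f (u i)) hcomp.symm

theorem extDerivForm_extDerivForm [FiniteDimensional ℝ K] {n : ℕ}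
    {α : ∀ y : M, TangentSpace 𝓘(ℝ, V) y [⋀^Fin n]→ₗ[ℝ] K}
    (hα : ∀ X : Fin n → VectorField V M, ContMDiff 𝓘(ℝ, V) 𝓘(ℝ, K) ∞
      fun y => α y fun i => X i y) (x : M) : extDerivForm (extDerivForm α) x = 0 := by
  have h1 := contDiffAt_chartRep_const hα x
  ext v
  rw [extDerivForm_apply, (chartRep_extDerivForm h1).extDeriv_eq,
    extDeriv_extDeriv_apply h1 minSmoothness_two_le]
  rfl

theorem extDerivForm_add [FiniteDimensional ℝ K] {n : ℕ}
    {α β : ∀ y : M, TangentSpace 𝓘(ℝ, V) y [⋀^Fin n]→ₗ[ℝ] K}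
    (hα : ∀ X : Fin n → VectorField V M, ContMDiff 𝓘(ℝ, V) 𝓘(ℝ, K) ∞ fun y => α y fun i => X i y)
    (hβ : ∀ X : Fin n → VectorField V M, ContMDiff 𝓘(ℝ, V) 𝓘(ℝ, K) ∞ fun y => β y fun i => X i y)
    (x : M) : extDerivForm (fun y => α y + β y) x = extDerivForm α x + extDerivForm β x := by
  have h : chartRep x (fun y => α y + β y) = chartRep x α + chartRep x β := by
    funext y; ext u; rfl
  ext v
  rw [extDerivForm_apply, h, extDeriv_add
    ((contDiffAt_chartRep_const hα x).differentiableAt (by simp))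
    ((contDiffAt_chartRep_const hβ x).differentiableAt (by simp))]
  rfl

/-- The exterior derivative of a constant function vanishes. -/
theorem extDerivForm_const_zero_form (c : K) (x : M) :
    extDerivForm (fun y : M => AlternatingMap.constOfIsEmpty ℝ (TangentSpace 𝓘(ℝ, V) y) (Fin 0) c) x =
      0 := by
  ext v
  have h : chartRep x (fun y : M =>
      AlternatingMap.constOfIsEmpty ℝ (TangentSpace 𝓘(ℝ, V) y) (Fin 0) c) =
      fun _ => ContinuousAlternatingMap.constOfIsEmpty ℝ V (Fin 0) c := by
    funext y; ext u; rfl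
  rw [extDerivForm_apply, h]
  refine (extDeriv_apply (differentiableAt_const _) _).trans ?_
  simp
  rfl

theorem extDerivForm_map [FiniteDimensional ℝ K] {K' : Type*} [NormedAddCommGroup K']
    [NormedSpace ℝ K'] [FiniteDimensional ℝ K'] (L : K →L[ℝ] K') {n : ℕ}
    {α : ∀ y : M, TangentSpace 𝓘(ℝ, V) y [⋀^Fin n]→ₗ[ℝ] K}
    (hα : ∀ X : Fin n → VectorField V M, ContMDiff 𝓘(ℝ, V) 𝓘(ℝ, K) ∞ fun y => α y fun i => X i y)
    (x : M) : extDerivForm (fun y => L.toLinearMap.compAlternatingMap (α y)) x =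
      L.toLinearMap.compAlternatingMap (extDerivForm α x) := by
  ext v
  have h : chartRep x (fun y => L.toLinearMap.compAlternatingMap (α y)) =
      fun y => L.compContinuousAlternatingMap (chartRep x α y) := by
    funext y; ext u; rfl
  have hd := (contDiffAt_chartRep_const hα x).differentiableAt (by simp)
  have hw : ∀ w : Fin n → V, DifferentiableAt ℝ (fun y => chartRep x α y w)
      (extChartAt 𝓘(ℝ, V) x x) := fun w =>
    (ContinuousAlternatingMap.apply ℝ V K w).differentiableAt.comp _ hd
  have hd2 : DifferentiableAt ℝ (fun y => L.compContinuousAlternatingMap (chartRep x α y))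
      (extChartAt 𝓘(ℝ, V) x x) := by
    refine (contDiffAt_alternating fun w => ?_ : ContDiffAt ℝ ∞ _ _).differentiableAt (by simp)
    exact L.contDiff.contDiffAt.comp _ ((ContinuousAlternatingMap.apply ℝ V K w).contDiff.contDiffAt.comp
      _ (contDiffAt_chartRep_const hα x))
  rw [extDerivForm_apply, h]
  refine (extDeriv_apply hd2 _).trans ?_
  refine Eq.trans ?_ (congrArg L (extDeriv_apply hd _)).symm
  rw [map_sum]
  refine Finset.sum_congr rfl fun i _ => ?_
  rw [map_zsmul]
  congr 1
  have := (L.hasFDerivAt.comp (extChartAt 𝓘(ℝ, V) x x) (hw (i.removeNth fun i =>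
    mfderiv 𝓘(ℝ, V) 𝓘(ℝ, V) (extChartAt 𝓘(ℝ, V) x) x (v i))).hasFDerivAt).fderiv
  exact congrArg (fun f : V →L[ℝ] K' => f _) this

/-- Partial derivatives commute: the time derivative of the spatial derivative is the spatial
derivative of the time derivative. -/
theorem hasDerivAt_fderiv_comm {g : ℝ × V → K} {t : ℝ} {y : V} (hg : ContDiffAt ℝ ∞ g (t, y)) (w : V) :
    HasDerivAt (fun s => fderiv ℝ (fun z => g (s, z)) y w)
      (fderiv ℝ (fun z => fderiv ℝ g (t, z) (1, 0)) y w) t := by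
  have hev : ∀ᶠ p in 𝓝 (t, y), DifferentiableAt ℝ g p := by
    have : ∀ᶠ p in 𝓝 (t, y), ContDiffAt ℝ 1 g p := (hg.of_le (by simp)).eventually (by simp)
    exact this.mono fun p hp => hp.differentiableAt (by simp)
  have hH : DifferentiableAt ℝ (fderiv ℝ g) (t, y) :=
    (hg.fderiv_right (m := ∞) (by simp)).differentiableAt (by simp)
  have h1 : (fun s => fderiv ℝ (fun z => g (s, z)) y w) =ᶠ[𝓝 t] fun s => fderiv ℝ g (s, y) (0, w) := by
    have hc : ContinuousAt (fun s : ℝ => (s, y)) t := by fun_prop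
    filter_upwards [hc.eventually hev] with s hs
    have := (hs.hasFDerivAt.comp y (hasFDerivAt_prodMk_right s y)).fderiv
    have h' := congrArg (fun f : V →L[ℝ] K => f w) this
    exact h'
  have h2 : HasDerivAt (fun s => fderiv ℝ g (s, y) (0, w))
      (fderiv ℝ (fderiv ℝ g) (t, y) (1, 0) (0, w)) t := by
    have ha : HasDerivAt (fun s : ℝ => (s, y)) ((1 : ℝ), (0 : V)) t :=
      (hasDerivAt_id t).prodMk (hasDerivAt_const t y)
    have hb := hH.hasFDerivAt.comp_hasDerivAt t ha
    have hc := hb.clm_apply (hasDerivAt_const t ((0 : ℝ), w))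
    simpa using hc
  have h3 : fderiv ℝ (fun z => fderiv ℝ g (t, z) (1, 0)) y w =
      fderiv ℝ (fderiv ℝ g) (t, y) (0, w) (1, 0) := by
    have ha : HasFDerivAt (fun z => fderiv ℝ g (t, z)) _ y :=
      hH.hasFDerivAt.comp y (hasFDerivAt_prodMk_right t y)
    have hb := (ha.clm_apply (hasFDerivAt_const ((1 : ℝ), (0 : V)) y)).fderiv
    have h' := congrArg (fun f : V →L[ℝ] K => f w) hb
    simpa using h'
  rw [h3, (hg.isSymmSndFDerivAt minSmoothness_two_le) (0, w) (1, 0)]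
  exact h2.congr_of_eventuallyEq h1

/-- The exterior derivative commutes with the time derivative of a smooth family of forms. -/
theorem hasDerivAt_extDerivForm [FiniteDimensional ℝ K] {n : ℕ}
    {α : ℝ → ∀ y : M, TangentSpace 𝓘(ℝ, V) y [⋀^Fin n]→ₗ[ℝ] K}
    (hα : ∀ X : Fin n → VectorField V M, ContMDiff (𝓘(ℝ, ℝ).prod 𝓘(ℝ, V)) 𝓘(ℝ, K) ∞
      fun p : ℝ × M => α p.1 p.2 fun i => X i p.2)
    {α' : ∀ y : M, TangentSpace 𝓘(ℝ, V) y [⋀^Fin n]→ₗ[ℝ] K} {t : ℝ}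
    (hα' : ∀ (y : M) (v : Fin n → TangentSpace 𝓘(ℝ, V) y), HasDerivAt (fun s => α s y v) (α' y v) t)
    (hs : ∀ X : Fin n → VectorField V M, ContMDiff 𝓘(ℝ, V) 𝓘(ℝ, K) ∞ fun y => α' y fun i => X i y)
    (x : M) (v : Fin (n + 1) → TangentSpace 𝓘(ℝ, V) x) :
    HasDerivAt (fun s => extDerivForm (α s) x v) (extDerivForm α' x v) t := by
  have hg := contDiffAt_chartRep hα t x
  have hgw : ∀ w : Fin n → V, ContDiffAt ℝ ∞ (fun p : ℝ × V => chartRep x (α p.1) p.2 w)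
      (t, extChartAt 𝓘(ℝ, V) x x) := fun w =>
    (ContinuousAlternatingMap.apply ℝ V K w).contDiff.contDiffAt.comp _ hg
  have hds : ∀ᶠ s in 𝓝 t, DifferentiableAt ℝ (chartRep x (α s)) (extChartAt 𝓘(ℝ, V) x x) := by
    have : ∀ᶠ p in 𝓝 (t, extChartAt 𝓘(ℝ, V) x x), ContDiffAt ℝ 1
      (fun p : ℝ × V => chartRep x (α p.1) p.2) p := (hg.of_le (by simp)).eventually (by simp)
    have hc : ContinuousAt (fun s : ℝ => (s, extChartAt 𝓘(ℝ, V) x x)) t := by fun_prop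
    filter_upwards [hc.eventually this] with s hs
    exact (hs.differentiableAt (by simp)).comp (extChartAt 𝓘(ℝ, V) x x) (f := fun z : V => (s, z))
      (by fun_prop)
  have hd' : DifferentiableAt ℝ (chartRep x α') (extChartAt 𝓘(ℝ, V) x x) :=
    (contDiffAt_chartRep_const hs x).differentiableAt (by simp)
  have h1 : (fun s => extDerivForm (α s) x v) =ᶠ[𝓝 t] fun s => ∑ i : Fin (n + 1),
      (-1 : ℤ) ^ i.val • fderiv ℝ (fun z => chartRep x (α s) z (i.removeNth fun i =>
        mfderiv 𝓘(ℝ, V) 𝓘(ℝ, V) (extChartAt 𝓘(ℝ, V) x) x (v i))) (extChartAt 𝓘(ℝ, V) x x)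
        (mfderiv 𝓘(ℝ, V) 𝓘(ℝ, V) (extChartAt 𝓘(ℝ, V) x) x (v i)) := by
    filter_upwards [hds] with s hs
    exact extDeriv_apply hs _
  refine HasDerivAt.congr_of_eventuallyEq ?_ h1
  have h2 : extDerivForm α' x v = ∑ i : Fin (n + 1),
      (-1 : ℤ) ^ i.val • fderiv ℝ (fun z => chartRep x α' z (i.removeNth fun i =>
        mfderiv 𝓘(ℝ, V) 𝓘(ℝ, V) (extChartAt 𝓘(ℝ, V) x) x (v i))) (extChartAt 𝓘(ℝ, V) x x)
        (mfderiv 𝓘(ℝ, V) 𝓘(ℝ, V) (extChartAt 𝓘(ℝ, V) x) x (v i)) := extDeriv_apply hd' _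
  rw [h2]
  refine HasDerivAt.fun_sum fun i _ => ?_
  -- It remains to differentiate the directional derivatives of the coefficients, where the time
  -- derivative and the spatial derivative commute.
  have key : ∀ (w : Fin n → V) (u : V), HasDerivAt
      (fun s => fderiv ℝ (fun z => chartRep x (α s) z w) (extChartAt 𝓘(ℝ, V) x x) u)
      (fderiv ℝ (fun z => chartRep x α' z w) (extChartAt 𝓘(ℝ, V) x x) u) t := by
    intro w u
    have h3 := hasDerivAt_fderiv_comm (hgw w) u
    have h4 : (fun z => fderiv ℝ (fun p : ℝ × V => chartRep x (α p.1) p.2 w) (t, z) (1, 0))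
        =ᶠ[𝓝 (extChartAt 𝓘(ℝ, V) x x)] fun z => chartRep x α' z w := by
      have : ∀ᶠ p in 𝓝 (t, extChartAt 𝓘(ℝ, V) x x), ContDiffAt ℝ 1
        (fun p : ℝ × V => chartRep x (α p.1) p.2 w) p := ((hgw w).of_le (by simp)).eventually (by simp)
      have hc : ContinuousAt (fun z : V => (t, z)) (extChartAt 𝓘(ℝ, V) x x) := by fun_prop
      filter_upwards [hc.eventually this] with z hz
      have ha : HasDerivAt (fun s : ℝ => (s, z)) ((1 : ℝ), (0 : V)) t :=
        (hasDerivAt_id t).prodMk (hasDerivAt_const t z)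
      have hb := (hz.differentiableAt (by simp)).hasFDerivAt.comp_hasDerivAt t ha
      have hc : HasDerivAt (fun s => chartRep x (α s) z w) (chartRep x α' z w) t :=
        hα' ((extChartAt 𝓘(ℝ, V) x).symm z)
          fun i => mfderiv 𝓘(ℝ, V) 𝓘(ℝ, V) (extChartAt 𝓘(ℝ, V) x).symm z (w i)
      exact hb.unique hc
    rwa [h4.fderiv_eq] at h3
  rcases neg_one_pow_eq_or ℤ i.val with h | h
  · simpa only [h, one_smul] using key _ _
  · simpa only [h, neg_smul, one_smul] using (key _ _).fun_neg

end ExteriorDerivative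

/-! ### Scalar forms -/

section ScalarForms

open Topology Filter

variable {𝕜 : Type*} [RCLike 𝕜]
  {V : Type*} [NormedAddCommGroup V] [NormedSpace ℝ V] [FiniteDimensional ℝ V]
  {M : Type*} [TopologicalSpace M] [ChartedSpace V M]

theorem d_congr {α β : Form V (fun _ : M => 𝕜)} {x : M} (h : ∀ᶠ y in 𝓝 x, α y = β y) :
    d α x = d β x := by
  funext n
  cases n with
  | zero => rfl
  | succ n =>
    exact extDerivForm_congr (α := fun y => α y n) (β := fun y => β y n)
      (h.mono fun y hy => congrFun hy n)

theorem extDerivForm_zero {n : ℕ} (x : M) :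
    extDerivForm (fun y : M => (0 : TangentSpace 𝓘(ℝ, V) y [⋀^Fin n]→ₗ[ℝ] 𝕜)) x = 0 := by
  have h := extDerivForm_smul (V := V) (0 : ℝ)
    (fun y : M => (0 : TangentSpace 𝓘(ℝ, V) y [⋀^Fin n]→ₗ[ℝ] 𝕜)) x
  simpa only [zero_smul] using h

theorem d_zero : d (0 : Form V (fun _ : M => 𝕜)) = 0 := by
  funext x n
  cases n with
  | zero => rfl
  | succ n => exact extDerivForm_zero x

/-- The exterior derivative raises the degree by one, whence the sign `(-1)^p`. -/
theorem d_sgn (p : ℕ) (α : Form V (fun _ : M => 𝕜)) (x : M) :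
    d (fun y => sgn p (α y)) x = (-1 : ℝ) ^ p • sgn p (d α x) := by
  funext n
  cases n with
  | zero =>
    refine Eq.symm ?_
    change (-1 : ℝ) ^ p • (-1 : ℝ) ^ (p * 0) • (0 : TangentSpace 𝓘(ℝ, V) x [⋀^Fin 0]→ₗ[ℝ] 𝕜) = 0
    rw [smul_zero, smul_zero]
  | succ n =>
    refine (extDerivForm_smul ((-1 : ℝ) ^ (p * n)) (fun y => α y n) x).trans ?_
    change (-1 : ℝ) ^ (p * n) • extDerivForm (fun y => α y n) x =
      (-1 : ℝ) ^ p • (-1 : ℝ) ^ (p * (n + 1)) • extDerivForm (fun y => α y n) x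
    rw [smul_smul, ← pow_add, neg_one_pow_congr (m := p * n) (n := p + p * (n + 1))]
    exact ⟨p * (n + 1), by ring⟩

variable [IsManifold 𝓘(ℝ, V) ∞ M] [T2Space M]

theorem d_mem {α : Form V (fun _ : M => 𝕜)} (hα : α ∈ ScalarForm (V := V) (M := M) 𝕜) :
    d α ∈ ScalarForm (V := V) (M := M) 𝕜 := by
  intro n X
  cases n with
  | zero => exact contMDiff_const
  | succ n => exact contMDiff_extDerivForm (hα n) X

theorem d_d {α : Form V (fun _ : M => 𝕜)} (hα : α ∈ ScalarForm (V := V) (M := M) 𝕜) :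
    d (d α) = 0 := by
  funext x n
  match n with
  | 0 => rfl
  | 1 => exact extDerivForm_zero x
  | n + 2 => exact extDerivForm_extDerivForm (hα n) x

theorem d_add {α β : Form V (fun _ : M => 𝕜)} (hα : α ∈ ScalarForm (V := V) (M := M) 𝕜)
    (hβ : β ∈ ScalarForm (V := V) (M := M) 𝕜) : d (α + β) = d α + d β := by
  funext x n
  cases n with
  | zero => exact (add_zero _).symm
  | succ n => exact extDerivForm_add (hα n) (hβ n) x

theorem d_sum {ι : Type*} (s : Finset ι) (α : ι → ScalarForm (V := V) (M := M) 𝕜) :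
    d (∑ i ∈ s, (α i).1) = ∑ i ∈ s, d (α i).1 := by
  classical
  induction s using Finset.induction_on with
  | empty => simpa using d_zero
  | insert a s ha ih =>
    rw [Finset.sum_insert ha, Finset.sum_insert ha, d_add (α a).2 (Submodule.sum_mem _ fun i _ => (α i).2), ih]

/-- The exterior derivative of a locally constant function vanishes. -/
theorem d_form0_of_eventually_const {h : M → 𝕜} {c : 𝕜} {x : M} (hh : ∀ᶠ y in 𝓝 x, h y = c) :
    d (fun y => form0 (TangentSpace 𝓘(ℝ, V) y) (h y)) x = 0 := by
  rw [d_congr (β := fun y => form0 (TangentSpace 𝓘(ℝ, V) y) c) (hh.mono fun y hy => by rw [hy])]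
  funext n
  match n with
  | 0 => rfl
  | 1 => exact extDerivForm_const_zero_form c x
  | n + 2 => exact extDerivForm_zero x

theorem d_toScalarForm (σ : SymplecticForm V M) : d (σ.toScalarForm 𝕜).1 = 0 := by
  funext x n
  match n with
  | 0 => rfl
  | 1 => exact extDerivForm_zero x
  | 2 => exact extDerivForm_zero x
  | 3 =>
    refine (extDerivForm_map (Algebra.linearMap ℝ 𝕜).toContinuousLinearMap σ.smooth x).trans ?_
    rw [σ.closed x]
    ext v
    exact map_zero (Algebra.linearMap ℝ 𝕜)
  | n + 4 => exact extDerivForm_zero x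

/-- A symplectic form is even, so that it commutes with everything. -/
theorem sgn_toScalarForm (σ : SymplecticForm V M) (p : ℕ) (x : M) :
    sgn p ((σ.toScalarForm 𝕜).1 x) = (σ.toScalarForm 𝕜).1 x := by
  funext n
  have h0 : ∀ m, (σ.toScalarForm 𝕜).1 x m = 0 → sgn p ((σ.toScalarForm 𝕜).1 x) m =
      (σ.toScalarForm 𝕜).1 x m := fun m hm => by rw [sgn, hm, smul_zero]
  match n with
  | 0 => exact h0 _ rfl
  | 1 => exact h0 _ rfl
  | 2 =>
    rw [sgn, Even.neg_one_pow (even_two.mul_left p), one_smul]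
  | n + 3 => exact h0 _ rfl

/-- The time derivative of a smooth family of scalar forms commutes with `d`. -/
theorem hasDerivAt_d {α : ℝ → Form V (fun _ : M => 𝕜)}
    (hα : ∀ (n : ℕ) (X : Fin n → VectorField V M), ContMDiff (𝓘(ℝ, ℝ).prod 𝓘(ℝ, V)) 𝓘(ℝ, 𝕜) ∞
      fun p : ℝ × M => α p.1 p.2 n fun i => X i p.2)
    {α' : Form V (fun _ : M => 𝕜)} {t : ℝ}
    (hα' : ∀ (y : M) (n : ℕ) (v : Fin n → TangentSpace 𝓘(ℝ, V) y),
      HasDerivAt (fun s => α s y n v) (α' y n v) t)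
    (hs : α' ∈ ScalarForm (V := V) (M := M) 𝕜) (x : M) (n : ℕ)
    (v : Fin n → TangentSpace 𝓘(ℝ, V) x) :
    HasDerivAt (fun s => d (α s) x n v) (d α' x n v) t := by
  cases n with
  | zero => exact hasDerivAt_const _ _
  | succ n => exact hasDerivAt_extDerivForm (hα n) (fun y => hα' y n) (hs n) x v

end ScalarForms

/-! ### Derivatives of curves in finite-dimensional spaces without a norm -/

section LinDeriv

variable {N N₁ N₂ : Type*} [AddCommGroup N] [Module ℝ N] [AddCommGroup N₁] [Module ℝ N₁]
  [AddCommGroup N₂] [Module ℝ N₂]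

/-- The curve `g` in the real vector space `N` has the derivative `g'` at `t`, tested with linear
functionals. It is used for curves in finite-dimensional spaces that carry no norm, such as fibres
of vector bundles and their endomorphism rings. -/
def HasLinDeriv (g : ℝ → N) (g' : N) (t : ℝ) : Prop :=
  ∀ ℓ : N →ₗ[ℝ] ℝ, HasDerivAt (fun s => ℓ (g s)) (ℓ g') t

theorem HasLinDeriv.unique {g : ℝ → N} {a b : N} {t : ℝ} (ha : HasLinDeriv g a t)
    (hb : HasLinDeriv g b t) : a = b := by
  rw [← sub_eq_zero, ← Module.forall_dual_apply_eq_zero_iff ℝ]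
  intro ℓ
  rw [map_sub, (ha ℓ).unique (hb ℓ), sub_self]

theorem HasLinDeriv.map {g : ℝ → N} {g' : N} {t : ℝ} (h : HasLinDeriv g g' t) (L : N →ₗ[ℝ] N₁) :
    HasLinDeriv (fun s => L (g s)) (L g') t := fun ℓ => h (ℓ ∘ₗ L)

theorem hasLinDeriv_const (a : N) (t : ℝ) : HasLinDeriv (fun _ => a) 0 t := fun ℓ => by
  simpa using hasDerivAt_const t (ℓ a)

theorem HasLinDeriv.add {g f : ℝ → N} {g' f' : N} {t : ℝ} (hg : HasLinDeriv g g' t)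
    (hf : HasLinDeriv f f' t) : HasLinDeriv (fun s => g s + f s) (g' + f') t := fun ℓ => by
  simpa only [map_add] using (hg ℓ).fun_add (hf ℓ)

theorem HasLinDeriv.sum {ι : Type*} {s : Finset ι} {g : ι → ℝ → N} {g' : ι → N} {t : ℝ}
    (hg : ∀ i ∈ s, HasLinDeriv (g i) (g' i) t) :
    HasLinDeriv (fun r => ∑ i ∈ s, g i r) (∑ i ∈ s, g' i) t := fun ℓ => by
  simpa only [map_sum] using HasDerivAt.fun_sum fun i hi => hg i hi ℓ

theorem hasLinDeriv_of_hasDerivAt {G : Type*} [NormedAddCommGroup G] [NormedSpace ℝ G]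
    [FiniteDimensional ℝ G] {g : ℝ → G} {g' : G} {t : ℝ} (h : HasDerivAt g g' t) :
    HasLinDeriv g g' t := fun ℓ =>
  (LinearMap.toContinuousLinearMap ℓ).hasFDerivAt.comp_hasDerivAt t h

theorem HasLinDeriv.hasDerivAt {G : Type*} [NormedAddCommGroup G] [NormedSpace ℝ G]
    [FiniteDimensional ℝ G] {g : ℝ → G} {g' : G} {t : ℝ} (h : HasLinDeriv g g' t) :
    HasDerivAt g g' t := by
  let b := Module.finBasis ℝ G
  have h1 : ∀ v : G, v = ∑ i, b.coord i v • b i := fun v => (b.sum_repr v).symm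
  rw [h1 g', funext fun s => h1 (g s)]
  exact HasDerivAt.fun_sum fun i _ => (h (b.coord i)).smul_const (b i)

/-- The product rule for a bilinear map whose first argument varies in a finite-dimensional
space. -/
theorem HasLinDeriv.bilin [FiniteDimensional ℝ N₁] (b : N₁ →ₗ[ℝ] N₂ →ₗ[ℝ] N) {f : ℝ → N₁} {f' : N₁}
    {g : ℝ → N₂} {g' : N₂} {t : ℝ} (hf : HasLinDeriv f f' t) (hg : HasLinDeriv g g' t) :
    HasLinDeriv (fun s => b (f s) (g s)) (b f' (g t) + b (f t) g') t := by
  intro ℓ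
  let e := Module.finBasis ℝ N₁
  have h1 : ∀ (v : N₁) (w : N₂), ℓ (b v w) = ∑ i, e.coord i v * ℓ (b (e i) w) := by
    intro v w
    conv_lhs => rw [← e.sum_repr v]
    rw [map_sum, LinearMap.sum_apply, map_sum]
    simp
  rw [map_add, h1, h1, funext fun s => h1 (f s) (g s), ← Finset.sum_add_distrib]
  exact HasDerivAt.fun_sum fun i _ => (hf (e.coord i)).mul (hg (ℓ ∘ₗ b (e i)))

/-- The product rule for forms. -/
theorem hasLinDeriv_wedgeWith {T : Type*} [AddCommGroup T] [Module ℝ T] [FiniteDimensional ℝ N₁]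
    (b : ℕ → N₁ →ₗ[ℝ] N₂ →ₗ[ℝ] N) {α : ℝ → ∀ n : ℕ, T [⋀^Fin n]→ₗ[ℝ] N₁}
    {α' : ∀ n : ℕ, T [⋀^Fin n]→ₗ[ℝ] N₁} {β : ℝ → ∀ n : ℕ, T [⋀^Fin n]→ₗ[ℝ] N₂}
    {β' : ∀ n : ℕ, T [⋀^Fin n]→ₗ[ℝ] N₂} {t : ℝ}
    (hα : ∀ n v, HasLinDeriv (fun s => α s n v) (α' n v) t)
    (hβ : ∀ n v, HasLinDeriv (fun s => β s n v) (β' n v) t) (n : ℕ) (v : Fin n → T) :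
    HasLinDeriv (fun s => wedgeWith b (α s) (β s) n v)
      (wedgeWith b α' (β t) n v + wedgeWith b (α t) β' n v) t := by
  simp only [wedgeWith_apply, ← Finset.sum_add_distrib, ← smul_add]
  refine HasLinDeriv.sum fun i _ => HasLinDeriv.sum fun q _ => ?_
  exact ((hα _ _).bilin (b _) (hβ _ _)).map (((Equiv.Perm.sign q.out : ℤ) : ℝ) • LinearMap.id)

end LinDeriv

/-! ### Parity -/

section Parity

variable {𝕜 : Type*} [RCLike 𝕜] {T : Type*} [AddCommGroup T] [Module ℝ T]
  {P Q : Type*} [AddCommGroup P] [Module ℝ P] [Module 𝕜 P] [IsScalarTower ℝ 𝕜 P]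
  [AddCommGroup Q] [Module ℝ Q] [Module 𝕜 Q] [IsScalarTower ℝ 𝕜 Q]

theorem eq_neg_self_iff_eq_zero {N : Type*} [AddCommGroup N] [Module ℝ N] (v : N) :
    v = -v ↔ v = 0 := by
  rw [eq_neg_iff_add_eq_zero, ← two_smul ℝ v, smul_eq_zero]
  simp

theorem grading_eq_self_iff (w : P × Q) : grading 𝕜 w = w ↔ w.2 = 0 := by
  have h : grading 𝕜 w = (w.1, -w.2) := rfl
  rw [h, Prod.ext_iff]
  simp only [true_and]
  rw [eq_comm, eq_neg_self_iff_eq_zero]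

theorem grading_eq_neg_iff (w : P × Q) : grading 𝕜 w = -w ↔ w.1 = 0 := by
  have h : grading 𝕜 w = (w.1, -w.2) := rfl
  rw [h, Prod.ext_iff]
  simp [eq_neg_self_iff_eq_zero]

theorem hasParity_iff (p : ℕ) (θ : ∀ n : ℕ, T [⋀^Fin n]→ₗ[ℝ] (P × Q)) :
    HasParity 𝕜 p θ ↔ ∀ n v, (Even (p + n) → (θ n v).2 = 0) ∧ (Odd (p + n) → (θ n v).1 = 0) := by
  refine forall_congr' fun n => forall_congr' fun v => ?_
  rcases Nat.even_or_odd (p + n) with h | h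
  · simp [h.neg_one_pow, h, grading_eq_self_iff, Nat.not_odd_iff_even.2 h]
  · simp [h.neg_one_pow, h, grading_eq_neg_iff, Nat.not_even_iff_odd.2 h]

theorem isEvenMap_iff (L : Module.End 𝕜 (P × Q)) :
    IsEvenMap L ↔ grading 𝕜 * L * grading 𝕜 = L := by
  constructor
  · rintro ⟨h1, h2⟩
    refine LinearMap.ext fun w => ?_
    have hw : w = (w.1, 0) + (0, w.2) := by simp
    have e1 := (grading_eq_self_iff (𝕜 := 𝕜) _).2 (h1 w.1)
    have e2 := (grading_eq_neg_iff (𝕜 := 𝕜) _).2 (h2 w.2)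
    have e3 : grading 𝕜 w = (w.1, 0) - (0, w.2) := by simp [grading]
    change grading 𝕜 (L (grading 𝕜 w)) = L w
    rw [e3, map_sub, map_sub, e1, e2, sub_neg_eq_add, ← map_add, ← hw]
  · intro h
    have h' : ∀ w, grading 𝕜 (L (grading 𝕜 w)) = L w := fun w => congrArg (fun f => f w) h
    refine ⟨fun p => ?_, fun q => ?_⟩
    · rw [← grading_eq_self_iff (𝕜 := 𝕜)]
      have := h' (p, 0)
      rwa [(grading_eq_self_iff (𝕜 := 𝕜) (p, (0 : Q))).2 rfl] at this
    · rw [← grading_eq_neg_iff (𝕜 := 𝕜)]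
      have := h' (0, q)
      rw [(grading_eq_neg_iff (𝕜 := 𝕜) ((0 : P), q)).2 rfl, map_neg, map_neg] at this
      exact neg_eq_iff_eq_neg.1 this

theorem isOddMap_iff (L : Module.End 𝕜 (P × Q)) :
    IsOddMap L ↔ grading 𝕜 * L * grading 𝕜 = -L := by
  constructor
  · rintro ⟨h1, h2⟩
    refine LinearMap.ext fun w => ?_
    have hw : w = (w.1, 0) + (0, w.2) := by simp
    have e1 := (grading_eq_neg_iff (𝕜 := 𝕜) _).2 (h1 w.1)
    have e2 := (grading_eq_self_iff (𝕜 := 𝕜) _).2 (h2 w.2)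
    have e3 : grading 𝕜 w = (w.1, 0) - (0, w.2) := by simp [grading]
    change grading 𝕜 (L (grading 𝕜 w)) = -L w
    rw [e3, map_sub, map_sub, e1, e2, ← neg_add', ← map_add, ← hw]
  · intro h
    have h' : ∀ w, grading 𝕜 (L (grading 𝕜 w)) = -L w := fun w => congrArg (fun f => f w) h
    refine ⟨fun p => ?_, fun q => ?_⟩
    · rw [← grading_eq_neg_iff (𝕜 := 𝕜)]
      have := h' (p, 0)
      rwa [(grading_eq_self_iff (𝕜 := 𝕜) (p, (0 : Q))).2 rfl] at this
    · rw [← grading_eq_self_iff (𝕜 := 𝕜)]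
      have := h' (0, q)
      rw [(grading_eq_neg_iff (𝕜 := 𝕜) ((0 : P), q)).2 rfl, map_neg, map_neg] at this
      exact neg_injective this

theorem hasEndParity_iff (p : ℕ) (S : ∀ n : ℕ, T [⋀^Fin n]→ₗ[ℝ] Module.End 𝕜 (P × Q)) :
    HasEndParity p S ↔ ∀ n v, (Even (p + n) → IsEvenMap (S n v)) ∧ (Odd (p + n) → IsOddMap (S n v)) := by
  refine forall_congr' fun n => forall_congr' fun v => ?_
  rcases Nat.even_or_odd (p + n) with h | h
  · simp [h.neg_one_pow, h, isEvenMap_iff, Nat.not_odd_iff_even.2 h]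
  · have e : (-1 : ℝ) • S n v = -S n v := LinearMap.ext fun w => by
      rw [LinearMap.smul_apply, neg_smul, one_smul]; rfl
    rw [h.neg_one_pow, e]
    simp [h, isOddMap_iff, Nat.not_even_iff_odd.2 h]

theorem HasParity.congr {p q : ℕ} (h : Even (p + q)) {θ : ∀ n : ℕ, T [⋀^Fin n]→ₗ[ℝ] (P × Q)}
    (hθ : HasParity 𝕜 p θ) : HasParity 𝕜 q θ := fun n v => by
  rw [hθ n v, neg_one_pow_congr (m := p + n) (n := q + n)]
  obtain ⟨k, hk⟩ := h
  exact ⟨k + n, by omega⟩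

end Parity

/-! ### Local frames, cut off to global sections -/

theorem finiteDimensional_fibre (𝕜 : Type*) [NontriviallyNormedField 𝕜] {B : Type*}
    [TopologicalSpace B] (G : Type*) [NormedAddCommGroup G] [NormedSpace 𝕜 G] [FiniteDimensional 𝕜 G]
    (W : B → Type*) [TopologicalSpace (TotalSpace G W)] [∀ x, AddCommGroup (W x)]
    [∀ x, Module 𝕜 (W x)] [∀ x, TopologicalSpace (W x)] [FiberBundle G W] [VectorBundle 𝕜 G W]
    (y : B) : FiniteDimensional 𝕜 (W y) :=
  ((trivializationAt G W y).linearEquivAt 𝕜 y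
    (FiberBundle.mem_baseSet_trivializationAt' y)).symm.finiteDimensional

section Frames

open Topology Filter

variable {𝕜 : Type*} [RCLike 𝕜]
  {V : Type*} [NormedAddCommGroup V] [NormedSpace ℝ V] [FiniteDimensional ℝ V]
  {M : Type*} [TopologicalSpace M] [ChartedSpace V M] [IsManifold 𝓘(ℝ, V) ∞ M] [T2Space M]
  {G : Type*} [NormedAddCommGroup G] [NormedSpace ℝ G] [NormedSpace 𝕜 G] [IsScalarTower ℝ 𝕜 G]
  [FiniteDimensional 𝕜 G]
  {W : M → Type*} [TopologicalSpace (TotalSpace G W)]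
  [∀ x, AddCommGroup (W x)] [∀ x, Module ℝ (W x)] [∀ x, Module 𝕜 (W x)]
  [∀ x, IsScalarTower ℝ 𝕜 (W x)] [∀ x, TopologicalSpace (W x)] [FiberBundle G W]
  [VectorBundle ℝ G W] [VectorBundle 𝕜 G W] [ContMDiffVectorBundle ∞ G W 𝓘(ℝ, V)]

variable (𝕜 V G W) in
/-- A frame of the vector bundle `W` near `x₀` together with the dual coframe, both cut off to
global objects: near `x₀` the sections `sec i` form a frame with dual coframe `coord i`, and
everywhere `∑ᵢ coord i (v) • sec i = cutoff • v` with a function `cutoff` that is `1` near `x₀`. -/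
structure LocalFrame (x₀ : M) where
  /-- the index set -/
  ι : Type
  [fintype : Fintype ι]
  [decidableEq : DecidableEq ι]
  /-- the sections of the frame -/
  sec : ι → Cₛ^∞⟮𝓘(ℝ, V); G, W⟯
  /-- the dual coframe -/
  coord : ι → ∀ y : M, W y →ₗ[𝕜] 𝕜
  /-- the cutoff function -/
  cutoff : M → 𝕜
  smooth_coord : ∀ (i : ι) (θ : ℝ → Form V W), IsSmoothFamily G θ →
    ∀ (n : ℕ) (X : Fin n → VectorField V M), ContMDiff (𝓘(ℝ, ℝ).prod 𝓘(ℝ, V)) 𝓘(ℝ, 𝕜) ∞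
      fun p : ℝ × M => coord i p.2 (θ p.1 p.2 n fun i => X i p.2)
  smooth_cutoff : ContMDiff 𝓘(ℝ, V) 𝓘(ℝ, 𝕜) ∞ cutoff
  cutoff_eventually : ∀ᶠ y in 𝓝 x₀, cutoff y = 1
  sum_coord : ∀ y v, ∑ i, coord i y v • sec i y = cutoff y • v
  coord_sec : ∀ i j, coord i x₀ (sec j x₀) = if i = j then 1 else 0

attribute [instance] LocalFrame.fintype LocalFrame.decidableEq

/-- The frame of a trivialization agrees near `x₀` with global sections. The coframe is multiplied by
a bump function that is supported where they agree. -/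
theorem exists_localFrame (x₀ : M) : Nonempty (LocalFrame 𝕜 V G W x₀) := by
  set e := trivializationAt G W x₀ with he
  let b := Module.finBasis 𝕜 G
  have := Module.Finite.trans (R := ℝ) 𝕜 G
  have hx₀ : x₀ ∈ e.baseSet := FiberBundle.mem_baseSet_trivializationAt' x₀
  choose S hS using fun i => exists_section_extending (V := V) G (W := W) (x₀ := x₀)
    (e.symm x₀ (b i))
  have hU : {y | y ∈ e.baseSet ∧ ∀ i, S i y = FiberBundle.extend G (e.symm x₀ (b i)) y} ∈ 𝓝 x₀ :=
    inter_mem (e.open_baseSet.mem_nhds hx₀) (Filter.eventually_all.2 hS)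
  obtain ⟨f, -, hf⟩ := (SmoothBumpFunction.nhds_basis_tsupport (I := 𝓘(ℝ, V)) x₀).mem_iff.1 hU
  have hS' : ∀ y ∈ tsupport f, ∀ i, S i y = e.symm y (b i) := by
    intro y hy i
    rw [(hf hy).2 i, FiberBundle.extend, ← he]
    exact congrArg (fun w : M × G => e.symm y w.2) (e.apply_mk_symm hx₀ (b i))
  have hcutoff : ContMDiff 𝓘(ℝ, V) 𝓘(ℝ, 𝕜) ∞ fun y => ((f y : ℝ) : 𝕜) :=
    (RCLike.ofRealCLM (K := 𝕜)).contMDiff.comp f.contMDiff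
  refine ⟨{
    ι := Fin (Module.finrank 𝕜 G)
    sec := S
    cutoff := fun y => ((f y : ℝ) : 𝕜)
    coord := fun i y => ((f y : ℝ) : 𝕜) • (b.coord i ∘ₗ e.linearMapAt 𝕜 y)
    smooth_coord := ?_
    smooth_cutoff := hcutoff
    cutoff_eventually := ?_
    sum_coord := ?_
    coord_sec := ?_ }⟩
  · rintro i θ hθ n X ⟨t, y⟩
    by_cases hy : y ∈ e.baseSet
    · have h1 := ((e.contMDiffAt_iff (IB := 𝓘(ℝ, V)) (x₀ := (t, y)) (e.mem_source.2 hy)).1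
        (hθ n X (t, y))).2
      have hc : ContMDiff 𝓘(ℝ, G) 𝓘(ℝ, 𝕜) ∞ (((b.coord i).restrictScalars ℝ) : G → 𝕜) :=
        (LinearMap.toContinuousLinearMap ((b.coord i).restrictScalars ℝ)).contMDiff
      have h2 := (hc _).comp (t, y) h1
      have h3 : ContMDiff (𝓘(ℝ, ℝ).prod 𝓘(ℝ, V)) 𝓘(ℝ, 𝕜) ∞ (fun p : ℝ × M => ((f p.2 : ℝ) : 𝕜)) :=
        hcutoff.comp contMDiff_snd
      refine (contDiff_mul.contMDiff.contMDiffAt.comp (t, y)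
        ((h3 (t, y)).prodMk_space h2)).congr_of_eventuallyEq ?_
      filter_upwards [(continuousAt_snd (p := (t, y))).eventually (e.open_baseSet.mem_nhds hy)]
        with p hp
      change ((f p.2 : ℝ) : 𝕜) • b.coord i (e.linearMapAt 𝕜 p.2 _) = _
      rw [e.coe_linearMapAt_of_mem hp]
      rfl
    -- Outside the domain of the trivialization the coordinates vanish locally.
    · have hy' : ∀ᶠ z in 𝓝 y, z ∉ tsupport f :=
        (isClosed_tsupport f).isOpen_compl.mem_nhds fun h => hy (hf h).1
      refine contMDiffAt_const (c := (0 : 𝕜)) |>.congr_of_eventuallyEq ?_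
      filter_upwards [(continuousAt_snd (p := (t, y))).eventually hy'] with p hp
      have : f p.2 = 0 := image_eq_zero_of_notMem_tsupport hp
      simp [this]
  · filter_upwards [f.eventuallyEq_one] with y hy
    simp [hy]
  · intro y v
    by_cases hy : y ∈ tsupport f
    · have hyb := (hf hy).1
      have h1 : v = e.symm y (e ⟨y, v⟩).2 := (e.symm_apply_apply_mk hyb v).symm
      have h2 : (e ⟨y, v⟩).2 = ∑ i, b.coord i (e ⟨y, v⟩).2 • b i := (b.sum_repr _).symm
      have h3 : v = ∑ i, b.coord i (e ⟨y, v⟩).2 • S i y := by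
        conv_lhs => rw [h1, h2]
        have h4 : ∀ g, e.symm y g = e.symmₗ 𝕜 y g := fun g => by
          rw [e.coe_symmₗ]; exact hyb
        rw [h4, map_sum]
        refine Finset.sum_congr rfl fun i _ => ?_
        rw [map_smul, ← h4, hS' y hy]
      conv_rhs => rw [h3, Finset.smul_sum]
      refine Finset.sum_congr rfl fun i _ => ?_
      rw [smul_smul]
      congr 1
      change ((f y : ℝ) : 𝕜) • b.coord i (e.linearMapAt 𝕜 y _) = _
      rw [e.coe_linearMapAt_of_mem hyb]
      rfl
    · have : f y = 0 := image_eq_zero_of_notMem_tsupport hy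
      simp [this]
  · intro i j
    have hx₀s : x₀ ∈ tsupport f := subset_tsupport _ (by
      rw [Function.mem_support, f.eq_one]; exact one_ne_zero)
    have hf1 : f x₀ = 1 := f.eq_one
    change ((f x₀ : ℝ) : 𝕜) • b.coord i (e.linearMapAt 𝕜 x₀ _) = _
    rw [e.coe_linearMapAt_of_mem hx₀, hf1, hS' _ hx₀s]
    change ((1 : ℝ) : 𝕜) • b.coord i (e ⟨x₀, e.symm x₀ (b j)⟩).2 = _
    rw [e.apply_mk_symm hx₀]
    simp [Finsupp.single_apply, eq_comm]

namespace LocalFrame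

variable {x₀ : M} (F : LocalFrame 𝕜 V G W x₀)

theorem smooth_coord_const (i : F.ι) (θ : BundleForm (V := V) 𝕜 G W) (n : ℕ)
    (X : Fin n → VectorField V M) :
    ContMDiff 𝓘(ℝ, V) 𝓘(ℝ, 𝕜) ∞ fun y : M => F.coord i y (θ.1 y n fun i => X i y) := by
  have h := F.smooth_coord i (fun _ => θ.1) (fun n X => (θ.2 n X).comp contMDiff_snd) n X
  exact h.comp (f := fun y : M => ((0 : ℝ), y)) (contMDiff_const.prodMk contMDiff_id)

/-- The coordinates of a form with values in `W`. -/
def coordForm (i : F.ι) (θ : BundleForm (V := V) 𝕜 G W) : ScalarForm (V := V) (M := M) 𝕜 :=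
  ⟨fun y n => ((F.coord i y).restrictScalars ℝ).compAlternatingMap (θ.1 y n),
    fun n X => F.smooth_coord_const i θ n X⟩

theorem coordForm_apply (i : F.ι) (θ : BundleForm (V := V) 𝕜 G W) (y : M) (n : ℕ)
    (v : Fin n → TangentSpace 𝓘(ℝ, V) y) :
    (F.coordForm i θ).1 y n v = F.coord i y (θ.1 y n v) := rfl

/-- The trace of an endomorphism in terms of a frame. -/
theorem trace_eq_sum {y : M} (hy : F.cutoff y = 1) (L : Module.End 𝕜 (W y)) :
    LinearMap.trace 𝕜 (W y) L = ∑ i, F.coord i y (L (F.sec i y)) := by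
  have := finiteDimensional_fibre 𝕜 G W y
  have h : L = ∑ i, (F.coord i y).smulRight (L (F.sec i y)) := by
    ext v
    conv_lhs => rw [← one_smul 𝕜 v, ← hy, ← F.sum_coord, map_sum]
    simp
  conv_lhs => rw [h, map_sum]
  exact Finset.sum_congr rfl fun i _ => LinearMap.trace_smulRight _ _

end LocalFrame

/-- A smooth function as a form of degree `0`. -/
def funForm {h : M → 𝕜} (hh : ContMDiff 𝓘(ℝ, V) 𝓘(ℝ, 𝕜) ∞ h) : ScalarForm (V := V) (M := M) 𝕜 :=
  ⟨fun y => form0 (TangentSpace 𝓘(ℝ, V) y) (h y), fun n X => by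
    cases n with
    | zero => exact hh
    | succ n => exact contMDiff_const⟩

variable (𝕜) in
/-- A section of `W` as a form of degree `0`. -/
def secForm (s : Cₛ^∞⟮𝓘(ℝ, V); G, W⟯) : BundleForm (V := V) 𝕜 G W :=
  ⟨fun y => form0 (TangentSpace 𝓘(ℝ, V) y) (s y), fun n X => by
    cases n with
    | zero => exact s.contMDiff
    | succ n => exact Bundle.contMDiff_zeroSection ℝ W⟩

/-- The expansion of a form in a frame, multiplied by the cutoff function to hold globally. -/
theorem LocalFrame.sum_wedgeLeft {x₀ : M} (F : LocalFrame 𝕜 V G W x₀)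
    (θ : BundleForm (V := V) 𝕜 G W) :
    ∑ i, wedgeLeft (F.coordForm i θ) (secForm 𝕜 (F.sec i)) = wedgeLeft (funForm F.smooth_cutoff) θ := by
  refine Subtype.ext (funext fun y => funext fun n => AlternatingMap.ext fun v => ?_)
  rw [AddSubmonoidClass.coe_finsetSum, Finset.sum_apply, Finset.sum_apply, alternating_sum_apply]
  refine Eq.trans ?_ (wedgeAt_form0 _ _ _ _).symm
  rw [← F.sum_coord]
  exact Finset.sum_congr rfl fun i _ => wedgeAt_form0_right _ _ _ _

end Frames

/-! ### Frames of a superbundle -/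

section SuperFrames

open Topology Filter

variable {𝕜 : Type*} [RCLike 𝕜]
  {V : Type*} [NormedAddCommGroup V] [NormedSpace ℝ V] [FiniteDimensional ℝ V]
  {M : Type*} [TopologicalSpace M] [ChartedSpace V M] [IsManifold 𝓘(ℝ, V) ∞ M] [T2Space M]
  {Fp : Type*} [NormedAddCommGroup Fp] [NormedSpace ℝ Fp] [NormedSpace 𝕜 Fp]
  [IsScalarTower ℝ 𝕜 Fp] [FiniteDimensional 𝕜 Fp]
  {Ep : M → Type*} [TopologicalSpace (TotalSpace Fp Ep)]
  [∀ x, AddCommGroup (Ep x)] [∀ x, Module ℝ (Ep x)] [∀ x, Module 𝕜 (Ep x)]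
  [∀ x, IsScalarTower ℝ 𝕜 (Ep x)] [∀ x, TopologicalSpace (Ep x)] [FiberBundle Fp Ep]
  [VectorBundle ℝ Fp Ep] [VectorBundle 𝕜 Fp Ep] [ContMDiffVectorBundle ∞ Fp Ep 𝓘(ℝ, V)]
  {Fm : Type*} [NormedAddCommGroup Fm] [NormedSpace ℝ Fm] [NormedSpace 𝕜 Fm]
  [IsScalarTower ℝ 𝕜 Fm] [FiniteDimensional 𝕜 Fm]
  {Em : M → Type*} [TopologicalSpace (TotalSpace Fm Em)]
  [∀ x, AddCommGroup (Em x)] [∀ x, Module ℝ (Em x)] [∀ x, Module 𝕜 (Em x)]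
  [∀ x, IsScalarTower ℝ 𝕜 (Em x)] [∀ x, TopologicalSpace (Em x)] [FiberBundle Fm Em]
  [VectorBundle ℝ Fm Em] [VectorBundle 𝕜 Fm Em] [ContMDiffVectorBundle ∞ Fm Em 𝓘(ℝ, V)]

theorem IsSmoothFamily.fst {θ : ℝ → Form V (Ep ×ᵇ Em)} (hθ : IsSmoothFamily (Fp × Fm) θ) :
    IsSmoothFamily Fp fun s y n => (LinearMap.fst ℝ (Ep y) (Em y)).compAlternatingMap (θ s y n) := by
  intro n X p
  have h := (Bundle.contMDiffAt_totalSpace.1 (hθ n X p)).2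
  refine Bundle.contMDiffAt_totalSpace.2 ⟨contMDiffAt_snd, ?_⟩
  exact ((ContinuousLinearMap.fst ℝ Fp Fm).contMDiff (n := ∞) _).comp p h

theorem IsSmoothFamily.snd {θ : ℝ → Form V (Ep ×ᵇ Em)} (hθ : IsSmoothFamily (Fp × Fm) θ) :
    IsSmoothFamily Fm fun s y n => (LinearMap.snd ℝ (Ep y) (Em y)).compAlternatingMap (θ s y n) := by
  intro n X p
  have h := (Bundle.contMDiffAt_totalSpace.1 (hθ n X p)).2
  refine Bundle.contMDiffAt_totalSpace.2 ⟨contMDiffAt_snd, ?_⟩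
  exact ((ContinuousLinearMap.snd ℝ Fp Fm).contMDiff (n := ∞) _).comp p h

variable (𝕜 V Fp Ep Fm Em) in
/-- A local frame of a superbundle whose sections are homogeneous. -/
structure SuperFrame (x₀ : M) extends LocalFrame 𝕜 V (Fp × Fm) (Ep ×ᵇ Em) x₀ where
  /-- the parity of the sections -/
  deg : ι → ℕ
  grading_sec : ∀ i y, grading (P := Ep y) (N := Em y) 𝕜 (sec i y) = (-1 : ℝ) ^ deg i • sec i y

/-- The frames of `E⁺` and `E⁻` together form a frame of `E⁺ ⊕ E⁻`; each coframe is multiplied by the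
cutoff function of the other, so that there is a common cutoff function. -/
theorem exists_superFrame (x₀ : M) : Nonempty (SuperFrame 𝕜 V Fp Ep Fm Em x₀) := by
  obtain ⟨F⟩ := exists_localFrame (𝕜 := 𝕜) (V := V) (G := Fp) (W := Ep) x₀
  obtain ⟨F'⟩ := exists_localFrame (𝕜 := 𝕜) (V := V) (G := Fm) (W := Em) x₀
  have hm : ∀ {f g : ℝ × M → 𝕜}, ContMDiff (𝓘(ℝ, ℝ).prod 𝓘(ℝ, V)) 𝓘(ℝ, 𝕜) ∞ f →
      ContMDiff (𝓘(ℝ, ℝ).prod 𝓘(ℝ, V)) 𝓘(ℝ, 𝕜) ∞ g →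
      ContMDiff (𝓘(ℝ, ℝ).prod 𝓘(ℝ, V)) 𝓘(ℝ, 𝕜) ∞ fun p => f p * g p := fun hf hg =>
    contDiff_mul.contMDiff.comp (hf.prodMk_space hg)
  refine ⟨{
    ι := F.ι ⊕ F'.ι
    sec := Sum.elim (fun i => ⟨_, contMDiff_inl (F.sec i).contMDiff⟩)
      fun j => ⟨_, contMDiff_inr (F'.sec j).contMDiff⟩
    coord := Sum.elim (fun i y => F'.cutoff y • (F.coord i y ∘ₗ LinearMap.fst 𝕜 (Ep y) (Em y)))
      fun j y => F.cutoff y • (F'.coord j y ∘ₗ LinearMap.snd 𝕜 (Ep y) (Em y))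
    cutoff := fun y => F.cutoff y * F'.cutoff y
    smooth_coord := ?_
    smooth_cutoff := contDiff_mul.contMDiff.comp (F.smooth_cutoff.prodMk_space F'.smooth_cutoff)
    cutoff_eventually := ?_
    sum_coord := ?_
    coord_sec := ?_
    deg := Sum.elim (fun _ => 0) fun _ => 1
    grading_sec := ?_ }⟩
  · rintro (i | j) θ hθ n X
    · exact hm (F'.smooth_cutoff.comp contMDiff_snd) (F.smooth_coord i _ hθ.fst n X)
    · exact hm (F.smooth_cutoff.comp contMDiff_snd) (F'.smooth_coord j _ hθ.snd n X)
  · filter_upwards [F.cutoff_eventually, F'.cutoff_eventually] with y hy hy'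
    rw [hy, hy', one_mul]
  · intro y v
    have e1 : ∑ i, (F'.cutoff y * F.coord i y v.1) • ((F.sec i y, 0) : Ep y × Em y) =
        ((F.cutoff y * F'.cutoff y) • v.1, 0) := by
      refine (Finset.sum_congr rfl fun i _ => ?_ : _ = ∑ i, LinearMap.inl 𝕜 (Ep y) (Em y)
        (F'.cutoff y • F.coord i y v.1 • F.sec i y)).trans ?_
      · rw [mul_smul, map_smul, map_smul, LinearMap.inl_apply]
      · rw [← map_sum, ← Finset.smul_sum, F.sum_coord, smul_smul, mul_comm]
        rfl
    have e2 : ∑ i, (F.cutoff y * F'.coord i y v.2) • ((0, F'.sec i y) : Ep y × Em y) =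
        (0, (F.cutoff y * F'.cutoff y) • v.2) := by
      refine (Finset.sum_congr rfl fun i _ => ?_ : _ = ∑ i, LinearMap.inr 𝕜 (Ep y) (Em y)
        (F.cutoff y • F'.coord i y v.2 • F'.sec i y)).trans ?_
      · rw [mul_smul, map_smul, map_smul, LinearMap.inr_apply]
      · rw [← map_sum, ← Finset.smul_sum, F'.sum_coord, smul_smul]
        rfl
    rw [Fintype.sum_sum_type]
    refine (congrArg₂ (· + ·) e1 e2).trans ?_
    change ((F.cutoff y * F'.cutoff y) • v.1 + 0, 0 + (F.cutoff y * F'.cutoff y) • v.2) = _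
    rw [add_zero, zero_add]
    rfl
  · have h1 := F.cutoff_eventually.self_of_nhds
    have h2 := F'.cutoff_eventually.self_of_nhds
    rintro (i | i) (j | j)
    · change F'.cutoff x₀ * F.coord i x₀ (F.sec j x₀) = _
      simp [h2, F.coord_sec]
    · change F'.cutoff x₀ * F.coord i x₀ 0 = _
      simp
    · change F.cutoff x₀ * F'.coord i x₀ 0 = _
      simp
    · change F.cutoff x₀ * F'.coord i x₀ (F'.sec j x₀) = _
      simp [h1, F'.coord_sec]
  · rintro (i | j) y
    · change ((F.sec i y, -0) : Ep y × Em y) = (-1 : ℝ) ^ 0 • (F.sec i y, 0)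
      rw [pow_zero, one_smul, neg_zero]
    · change ((0, -F'.sec j y) : Ep y × Em y) = (-1 : ℝ) ^ 1 • (0, F'.sec j y)
      rw [pow_one, neg_smul, one_smul, Prod.neg_mk, neg_zero]

/-- Endomorphisms that agree on a frame agree. -/
theorem LocalFrame.ext_sec {x₀ y : M} (F : LocalFrame 𝕜 V (Fp × Fm) (Ep ×ᵇ Em) x₀)
    (hy : F.cutoff y = 1) {L L' : Module.End 𝕜 ((Ep ×ᵇ Em) y)}
    (h : ∀ i, L (F.sec i y) = L' (F.sec i y)) : L = L' := by
  refine LinearMap.ext fun v => ?_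
  rw [← one_smul 𝕜 v, ← hy, ← F.sum_coord, map_sum, map_sum]
  exact Finset.sum_congr rfl fun i _ => by rw [map_smul, map_smul, h]

/-- The supertrace of an endomorphism in terms of a homogeneous frame. -/
theorem SuperFrame.supertrace_eq_sum {x₀ y : M} (F : SuperFrame 𝕜 V Fp Ep Fm Em x₀)
    (hy : F.cutoff y = 1) (L : Module.End 𝕜 (Ep y × Em y)) :
    supertrace 𝕜 L = ∑ i, (-1 : ℝ) ^ F.deg i • F.coord i y (L (F.sec i y)) := by
  have := finiteDimensional_fibre 𝕜 Fp Ep y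
  have := finiteDimensional_fibre 𝕜 Fm Em y
  rw [supertrace_eq_trace, LinearMap.trace_mul_comm]
  refine (F.trace_eq_sum hy (L * grading 𝕜)).trans (Finset.sum_congr rfl fun i _ => ?_)
  have h : (L * grading 𝕜 : Module.End 𝕜 (Ep y × Em y)) (F.sec i y) = (-1 : ℝ) ^ F.deg i • L (F.sec i y) :=
    (congrArg L (F.grading_sec i y)).trans (L.map_smul_of_tower _ _)
  exact (congrArg (F.coord i y) h).trans ((F.coord i y).map_smul_of_tower _ _)

end SuperFrames

section Superconnections

open Topology

variable {𝕜 : Type*} [RCLike 𝕜]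
  {V : Type*} [NormedAddCommGroup V] [NormedSpace ℝ V] [FiniteDimensional ℝ V]
  {M : Type*} [TopologicalSpace M] [ChartedSpace V M] [IsManifold 𝓘(ℝ, V) ∞ M] [T2Space M]
  {Fp : Type*} [NormedAddCommGroup Fp] [NormedSpace ℝ Fp] [NormedSpace 𝕜 Fp]
  [IsScalarTower ℝ 𝕜 Fp] [FiniteDimensional 𝕜 Fp]
  {Ep : M → Type*} [TopologicalSpace (TotalSpace Fp Ep)]
  [∀ x, AddCommGroup (Ep x)] [∀ x, Module ℝ (Ep x)] [∀ x, Module 𝕜 (Ep x)]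
  [∀ x, IsScalarTower ℝ 𝕜 (Ep x)] [∀ x, TopologicalSpace (Ep x)] [FiberBundle Fp Ep]
  [VectorBundle ℝ Fp Ep] [VectorBundle 𝕜 Fp Ep] [ContMDiffVectorBundle ∞ Fp Ep 𝓘(ℝ, V)]
  {Fm : Type*} [NormedAddCommGroup Fm] [NormedSpace ℝ Fm] [NormedSpace 𝕜 Fm]
  [IsScalarTower ℝ 𝕜 Fm] [FiniteDimensional 𝕜 Fm]
  {Em : M → Type*} [TopologicalSpace (TotalSpace Fm Em)]
  [∀ x, AddCommGroup (Em x)] [∀ x, Module ℝ (Em x)] [∀ x, Module 𝕜 (Em x)]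
  [∀ x, IsScalarTower ℝ 𝕜 (Em x)] [∀ x, TopologicalSpace (Em x)] [FiberBundle Fm Em]
  [VectorBundle ℝ Fm Em] [VectorBundle 𝕜 Fm Em] [ContMDiffVectorBundle ∞ Fm Em 𝓘(ℝ, V)]


/-! ### Operators with a Leibniz rule -/

/-- The exterior derivative as an operator on `Ω(M)`. -/
def dForm (α : ScalarForm (V := V) (M := M) 𝕜) : ScalarForm (V := V) (M := M) 𝕜 := ⟨d α.1, d_mem α.2⟩

/-- Multiplication by `(-1)^{pn}` in degree `n`, as an operator on `Ω(M)`. -/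
def sgnForm (p : ℕ) (α : ScalarForm (V := V) (M := M) 𝕜) : ScalarForm (V := V) (M := M) 𝕜 :=
  ⟨fun y => sgn p (α.1 y), fun n X =>
    ((-1 : ℝ) ^ (p * n) • ContinuousLinearMap.id ℝ 𝕜).contMDiff.comp (α.2 n X)⟩

theorem neg_one_zpow_smul {N : Type*} [AddCommGroup N] [Module ℝ N] (p : ℕ) (v : N) :
    (-1 : ℤ) ^ p • v = (-1 : ℝ) ^ p • v := by
  rcases neg_one_pow_eq_or ℤ p with h | h <;> rcases Nat.even_or_odd p with h' | h' <;>
    simp_all [Odd.neg_one_pow]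

theorem dForm_dForm (α : ScalarForm (V := V) (M := M) 𝕜) : dForm (dForm α) = 0 :=
  Subtype.ext (d_d α.2)

theorem dForm_sgnForm (p : ℕ) (α : ScalarForm (V := V) (M := M) 𝕜) :
    dForm (sgnForm p α) = (-1 : ℤ) ^ p • sgnForm p (dForm α) := by
  refine Subtype.ext (funext fun y => (d_sgn p α.1 y).trans ?_)
  rw [← neg_one_zpow_smul]
  rfl

theorem sgnForm_sgnForm (p q : ℕ) (α : ScalarForm (V := V) (M := M) 𝕜) :
    sgnForm p (sgnForm q α) = sgnForm (p + q) α := by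
  refine Subtype.ext (funext fun y => funext fun n => ?_)
  change (-1 : ℝ) ^ (p * n) • (-1 : ℝ) ^ (q * n) • α.1 y n = (-1 : ℝ) ^ ((p + q) * n) • α.1 y n
  rw [smul_smul, ← pow_add, add_mul]

theorem sgnForm_congr {p q : ℕ} (h : Even (p + q)) (α : ScalarForm (V := V) (M := M) 𝕜) :
    sgnForm p α = sgnForm q α := by
  refine Subtype.ext (funext fun y => funext fun n => ?_)
  change (-1 : ℝ) ^ (p * n) • α.1 y n = (-1 : ℝ) ^ (q * n) • α.1 y n
  rw [neg_one_pow_congr (m := p * n) (n := q * n)]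
  rw [← add_mul]
  exact h.mul_right n

theorem sgnForm_zero (α : ScalarForm (V := V) (M := M) 𝕜) : sgnForm 0 α = α := by
  refine Subtype.ext (funext fun y => funext fun n => ?_)
  change (-1 : ℝ) ^ (0 * n) • α.1 y n = α.1 y n
  rw [zero_mul, pow_zero, one_smul]

theorem wedgeLeft_add_left (α β : ScalarForm (V := V) (M := M) 𝕜)
    (θ : SuperForm (V := V) 𝕜 Fp Ep Fm Em) :
    wedgeLeft (α + β) θ = wedgeLeft α θ + wedgeLeft β θ :=
  Subtype.ext (funext fun y => xprod_add_left (fun _ _ => smulBilin (Ep y × Em y)) (α.1 y) (β.1 y) (θ.1 y))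

theorem wedgeLeft_zero_left (θ : SuperForm (V := V) 𝕜 Fp Ep Fm Em) :
    wedgeLeft (0 : ScalarForm (V := V) (M := M) 𝕜) θ = 0 := by
  simpa using wedgeLeft_add_left 0 0 θ

theorem wedgeLeft_zsmul_left (k : ℤ) (α : ScalarForm (V := V) (M := M) 𝕜)
    (θ : SuperForm (V := V) 𝕜 Fp Ep Fm Em) :
    wedgeLeft (k • α) θ = k • wedgeLeft α θ :=
  map_zsmul (AddMonoidHom.mk' (fun α => wedgeLeft α θ) fun α β => wedgeLeft_add_left α β θ) k α

/-- The form `θ ∈ Ω(M, E)` has total parity `p`. -/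
def IsHomog (p : ℕ) (θ : SuperForm (V := V) 𝕜 Fp Ep Fm Em) : Prop := ∀ y, HasParity 𝕜 p (θ.1 y)

theorem IsHomog.congr {p q : ℕ} (h : Even (p + q)) {θ : SuperForm (V := V) 𝕜 Fp Ep Fm Em}
    (hθ : IsHomog p θ) : IsHomog q θ := fun y => (hθ y).congr h

theorem IsHomog.add {p : ℕ} {θ θ' : SuperForm (V := V) 𝕜 Fp Ep Fm Em} (h : IsHomog p θ)
    (h' : IsHomog p θ') : IsHomog p (θ + θ') := fun y n v => by
  refine (map_add (grading 𝕜 : Module.End 𝕜 (Ep y × Em y)) (θ.1 y n v) (θ'.1 y n v)).trans ?_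
  rw [h y n v, h' y n v, ← smul_add]
  rfl

theorem IsHomog.zsmul {p : ℕ} {θ : SuperForm (V := V) 𝕜 Fp Ep Fm Em} (k : ℤ) (h : IsHomog p θ) :
    IsHomog p (k • θ) := fun y n v => by
  refine (map_zsmul (grading 𝕜 : Module.End 𝕜 (Ep y × Em y)) k (θ.1 y n v)).trans ?_
  rw [h y n v, smul_comm]
  rfl

theorem isHomog_zero_iff (θ : SuperForm (V := V) 𝕜 Fp Ep Fm Em) : IsHomog 0 θ ↔ IsEvenForm θ.1 := by
  refine forall_congr' fun y => (hasParity_iff 0 _).trans ?_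
  simp only [zero_add]

theorem isHomog_one_iff (θ : SuperForm (V := V) 𝕜 Fp Ep Fm Em) : IsHomog 1 θ ↔ IsOddForm θ.1 := by
  refine forall_congr' fun y => (hasParity_iff 1 _).trans ?_
  refine forall_congr' fun n => forall_congr' fun v => ?_
  rw [add_comm, Nat.even_add_one, Nat.odd_add_one, Nat.not_even_iff_odd, Nat.not_odd_iff_even]

/-- The operator `Φ` on `Ω(M, E)` has parity `p` and satisfies the Leibniz rule
`Φ (α ∧ θ) = κ dα ∧ θ + (-1)^{p |α|} α ∧ Φ θ`. For `κ = 1` and `p = 1` this is a superconnection,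
for `κ = 0` it is the action of an `End E`-valued form of parity `p`. -/
structure IsLeibniz (κ : ℤ) (p : ℕ) (Φ : Module.End 𝕜 (SuperForm (V := V) 𝕜 Fp Ep Fm Em)) :
    Prop where
  map_wedge : ∀ (α : ScalarForm (V := V) (M := M) 𝕜) (θ : SuperForm (V := V) 𝕜 Fp Ep Fm Em),
    Φ (wedgeLeft α θ) = κ • wedgeLeft (dForm α) θ + wedgeLeft (sgnForm p α) (Φ θ)
  parity : ∀ (q : ℕ) (θ : SuperForm (V := V) 𝕜 Fp Ep Fm Em), IsHomog q θ → IsHomog (q + p) (Φ θ)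

theorem Superconnection.isLeibniz (A : Superconnection 𝕜 V Fp Ep Fm Em) : IsLeibniz 1 1 A.op where
  map_wedge α θ := by
    refine Subtype.ext ((A.leibniz α θ).trans ?_)
    have h : (fun x n => (-1 : ℝ) ^ n • α.1 x n : Form V (fun _ : M => 𝕜)) = (sgnForm 1 α).1 := by
      funext x n
      change _ = (-1 : ℝ) ^ (1 * n) • α.1 x n
      rw [one_mul]
    rw [h, one_smul]
    rfl
  parity q θ hθ := by
    rcases Nat.even_or_odd q with h | h
    · have h0 : IsHomog 0 θ := hθ.congr (by simpa using h)
      have h1 := (isHomog_one_iff _).2 (A.odd_of_even θ ((isHomog_zero_iff _).1 h0))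
      exact h1.congr (by obtain ⟨k, hk⟩ := h; exact ⟨k + 1, by omega⟩)
    · have h0 : IsHomog 1 θ := hθ.congr h.add_one
      have h1 := (isHomog_zero_iff _).2 (A.even_of_odd θ ((isHomog_one_iff _).1 h0))
      exact h1.congr (by simpa using h.add_one)

theorem isLeibniz_actOp {p : ℕ} {T : SuperEnd (V := V) 𝕜 Fp Ep Fm Em}
    (hT : ∀ y, HasEndParity (P := Ep y) (Q := Em y) p (T.1 y)) : IsLeibniz 0 p (actOp T) where
  map_wedge α θ := by
    rw [zero_smul, zero_add]
    exact Subtype.ext (funext fun y => actAt_wedgeAt (hT y) (α.1 y) (θ.1 y))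
  parity q θ hθ := fun y => by
    have := HasParity.actAt (hT y) (hθ y)
    rw [add_comm] at this
    exact this

namespace IsLeibniz

variable {κ κ' : ℤ} {p q : ℕ} {Φ Ψ : Module.End 𝕜 (SuperForm (V := V) 𝕜 Fp Ep Fm Em)}

theorem add (hΦ : IsLeibniz 0 p Φ) (hΨ : IsLeibniz 0 p Ψ) : IsLeibniz 0 p (Φ + Ψ) where
  map_wedge α θ := by
    rw [LinearMap.add_apply, hΦ.map_wedge, hΨ.map_wedge, LinearMap.add_apply, map_add]
    simp only [zero_smul, zero_add]
  parity r θ hθ := (hΦ.parity r θ hθ).add (hΨ.parity r θ hθ)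

/-- The composition of two operators with a Leibniz rule. The terms with `dα` cancel for the square
of a superconnection, and in the supercommutator of a superconnection with a tensorial operator. -/
theorem map_map_wedge (hΦ : IsLeibniz κ p Φ) (hΨ : IsLeibniz κ' q Ψ)
    (α : ScalarForm (V := V) (M := M) 𝕜) (θ : SuperForm (V := V) 𝕜 Fp Ep Fm Em) :
    Φ (Ψ (wedgeLeft α θ)) = κ' • wedgeLeft (sgnForm p (dForm α)) (Φ θ) +
      (κ * (-1) ^ q) • wedgeLeft (sgnForm q (dForm α)) (Ψ θ) +
        wedgeLeft (sgnForm (p + q) α) (Φ (Ψ θ)) := by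
  rw [hΨ.map_wedge, map_add, map_zsmul, hΦ.map_wedge, hΦ.map_wedge, dForm_dForm,
    wedgeLeft_zero_left, dForm_sgnForm, wedgeLeft_zsmul_left, sgnForm_sgnForm, smul_zero, zero_add,
    smul_smul, add_assoc]

/-- The square of a superconnection is tensorial. -/
theorem sq (hΦ : IsLeibniz 1 1 Φ) : IsLeibniz 0 2 (Φ * Φ) where
  map_wedge α θ := by
    rw [Module.End.mul_apply, hΦ.map_map_wedge hΦ]
    simp [Module.End.mul_apply]
  parity r θ hθ := hΦ.parity _ _ (hΦ.parity _ _ hθ)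

/-- The supercommutator of a superconnection with a tensorial operator is tensorial. -/
theorem supercommutator (hΦ : IsLeibniz 1 1 Φ) (hΨ : IsLeibniz 0 q Ψ) :
    IsLeibniz 0 (q + 1) (Φ * Ψ - (-1 : ℤ) ^ q • (Ψ * Φ)) where
  map_wedge α θ := by
    simp only [LinearMap.sub_apply, LinearMap.smul_apply, Module.End.mul_apply]
    rw [hΦ.map_map_wedge hΨ, hΨ.map_map_wedge hΦ, map_sub, map_zsmul, add_comm 1 q]
    simp only [zero_smul, zero_mul, zero_add, one_smul, one_mul, add_zero, smul_add]
    abel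
  parity r θ hθ := by
    have h1 : IsHomog (r + (q + 1)) (Φ (Ψ θ)) := by
      have := hΦ.parity _ _ (hΨ.parity _ _ hθ)
      rwa [add_assoc] at this
    have h2 : IsHomog (r + (q + 1)) (Ψ (Φ θ)) := by
      have := hΨ.parity _ _ (hΦ.parity _ _ hθ)
      rwa [add_assoc, add_comm 1] at this
    have h3 := h1.add ((h2.zsmul ((-1) ^ q)).zsmul (-1))
    rw [neg_one_smul, ← sub_eq_add_neg] at h3
    exact h3

end IsLeibniz

/-! ### Locality of operators with a Leibniz rule -/

namespace IsLeibniz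

variable {κ κ' : ℤ} {p q : ℕ} {Φ Ψ : Module.End 𝕜 (SuperForm (V := V) 𝕜 Fp Ep Fm Em)}

/-- The values of an operator with Leibniz rule are determined by its values on a frame. -/
theorem apply_eq (hΦ : IsLeibniz κ p Φ) {x : M} (F : LocalFrame 𝕜 V (Fp × Fm) (Ep ×ᵇ Em) x)
    (θ : SuperForm (V := V) 𝕜 Fp Ep Fm Em) :
    (Φ θ).1 x = ∑ i, (κ • wedgeAt (d (F.coordForm i θ).1 x)
        (form0 (TangentSpace 𝓘(ℝ, V) x) (F.sec i x)) +
      wedgeAt (sgn p ((F.coordForm i θ).1 x)) ((Φ (secForm 𝕜 (F.sec i))).1 x)) := by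
  -- Apply `Φ` to the expansion of `cutoff • θ`; at `x` the cutoff function is `1` and its derivative
  -- is `0`.
  have h := congrArg Φ (F.sum_wedgeLeft θ)
  rw [map_sum, hΦ.map_wedge] at h
  have h' := congrArg (fun θ => θ.1 x) h
  have h1 : d (funForm (V := V) F.smooth_cutoff).1 x = 0 :=
    d_form0_of_eventually_const F.cutoff_eventually
  have h2 : sgn p ((funForm (V := V) F.smooth_cutoff).1 x) = form0 (TangentSpace 𝓘(ℝ, V) x) 1 := by
    refine (sgn_form0 p _).trans ?_
    rw [F.cutoff_eventually.self_of_nhds]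
  have h3 : (κ • wedgeLeft (dForm (funForm F.smooth_cutoff)) θ +
      wedgeLeft (sgnForm p (funForm F.smooth_cutoff)) (Φ θ)).1 x = (Φ θ).1 x := by
    have h5 : (κ • wedgeLeft (dForm (funForm F.smooth_cutoff)) θ +
        wedgeLeft (sgnForm p (funForm F.smooth_cutoff)) (Φ θ)).1 x =
      κ • wedgeAt (d (funForm (V := V) F.smooth_cutoff).1 x) (θ.1 x) +
      wedgeAt (sgn p ((funForm (V := V) F.smooth_cutoff).1 x)) ((Φ θ).1 x) := rfl
    rw [h5, h1, h2]
    have h4 : wedgeAt (0 : ∀ n : ℕ, TangentSpace 𝓘(ℝ, V) x [⋀^Fin n]→ₗ[ℝ] 𝕜) (θ.1 x) = 0 :=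
      xprod_zero_left _ _
    rw [h4, smul_zero, zero_add]
    funext n
    ext1 v
    rw [wedgeAt_form0, one_smul]
  refine h3.symm.trans (h'.symm.trans ?_)
  have h6 : ∀ g : F.ι → SuperForm (V := V) 𝕜 Fp Ep Fm Em, (∑ i, g i).1 x = ∑ i, (g i).1 x :=
    fun g => by rw [AddSubmonoidClass.coe_finsetSum, Finset.sum_apply]
  refine (h6 _).trans (Finset.sum_congr rfl fun i _ => ?_)
  rw [hΦ.map_wedge]
  rfl

/-- Operators with the same Leibniz rule that agree on sections agree. -/
theorem ext (hΦ : IsLeibniz κ p Φ) (hΨ : IsLeibniz κ p Ψ)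
    (h : ∀ s, Φ (secForm 𝕜 s) = Ψ (secForm 𝕜 s)) : Φ = Ψ := by
  refine LinearMap.ext fun θ => Subtype.ext (funext fun x => ?_)
  obtain ⟨F⟩ := exists_localFrame (𝕜 := 𝕜) (V := V) (G := Fp × Fm) (W := Ep ×ᵇ Em) x
  rw [hΦ.apply_eq F, hΨ.apply_eq F]
  simp only [h]

/-- A tensorial operator acts pointwise. -/
theorem apply_congr (hΦ : IsLeibniz 0 p Φ) {x : M} {θ θ' : SuperForm (V := V) 𝕜 Fp Ep Fm Em}
    (h : θ.1 x = θ'.1 x) : (Φ θ).1 x = (Φ θ').1 x := by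
  obtain ⟨F⟩ := exists_localFrame (𝕜 := 𝕜) (V := V) (G := Fp × Fm) (W := Ep ×ᵇ Em) x
  rw [hΦ.apply_eq F, hΦ.apply_eq F]
  have h1 : ∀ i, (F.coordForm i θ).1 x = (F.coordForm i θ').1 x := fun i => by
    funext n
    ext1 v
    rw [F.coordForm_apply, F.coordForm_apply, h]
  simp only [h1, zero_smul]

theorem apply_secForm_congr (hΦ : IsLeibniz 0 p Φ) {x : M} {θ : SuperForm (V := V) 𝕜 Fp Ep Fm Em}
    {s : Cₛ^∞⟮𝓘(ℝ, V); Fp × Fm, Ep ×ᵇ Em⟯}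
    (h : θ.1 x = form0 (TangentSpace 𝓘(ℝ, V) x) (s x)) : (Φ θ).1 x = (Φ (secForm 𝕜 s)).1 x :=
  hΦ.apply_congr h

end IsLeibniz

/-! ### Tensorial operators are endomorphism-valued forms -/

theorem actOp_secForm (T : SuperEnd (V := V) 𝕜 Fp Ep Fm Em) (s : Cₛ^∞⟮𝓘(ℝ, V); Fp × Fm, Ep ×ᵇ Em⟯)
    (x : M) (n : ℕ) (v : Fin n → TangentSpace 𝓘(ℝ, V) x) :
    (actOp T (secForm 𝕜 s)).1 x n v = T.1 x n v (s x) := actAt_form0 _ _ _ _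

/-- A form is determined by its action, because every vector is the value of a section. -/
theorem actOp_injective : Function.Injective (actOp (V := V) (𝕜 := 𝕜) (Fp := Fp) (Ep := Ep)
    (Fm := Fm) (Em := Em)) := by
  intro T T' h
  refine Subtype.ext (funext fun x => funext fun n => AlternatingMap.ext fun v =>
    LinearMap.ext fun e => ?_)
  obtain ⟨s, rfl⟩ := exists_section_apply_eq (V := V) (Fp × Fm) (W := Ep ×ᵇ Em) e
  rw [← actOp_secForm, ← actOp_secForm, h]

/-- The section `(s, 0)` of `E⁺ ⊕ E⁻`. -/
def inlSection (s : Cₛ^∞⟮𝓘(ℝ, V); Fp, Ep⟯) : Cₛ^∞⟮𝓘(ℝ, V); Fp × Fm, Ep ×ᵇ Em⟯ :=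
  ⟨fun x => (s x, 0), contMDiff_inl s.contMDiff⟩

/-- The section `(0, s)` of `E⁺ ⊕ E⁻`. -/
def inrSection (s : Cₛ^∞⟮𝓘(ℝ, V); Fm, Em⟯) : Cₛ^∞⟮𝓘(ℝ, V); Fp × Fm, Ep ×ᵇ Em⟯ :=
  ⟨fun x => (0, s x), contMDiff_inr s.contMDiff⟩

theorem isHomog_secForm {q : ℕ} {s : Cₛ^∞⟮𝓘(ℝ, V); Fp × Fm, Ep ×ᵇ Em⟯}
    (hs : ∀ y, grading (P := Ep y) (N := Em y) 𝕜 (s y) = (-1 : ℝ) ^ q • s y) :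
    IsHomog q (secForm 𝕜 s) := by
  intro y n v
  cases n with
  | zero => exact hs y
  | succ n =>
    change grading (P := Ep y) (N := Em y) 𝕜 0 = (-1 : ℝ) ^ (q + (n + 1)) • (0 : Ep y × Em y)
    rw [map_zero, smul_zero]

theorem isHomog_inlSection (s : Cₛ^∞⟮𝓘(ℝ, V); Fp, Ep⟯) :
    IsHomog 0 (secForm 𝕜 (inlSection (Fm := Fm) (Em := Em) s)) := by
  refine isHomog_secForm fun y => ?_
  rw [pow_zero, one_smul]
  exact (grading_eq_self_iff _).2 rfl

theorem isHomog_inrSection (s : Cₛ^∞⟮𝓘(ℝ, V); Fm, Em⟯) :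
    IsHomog 1 (secForm 𝕜 (inrSection (Fp := Fp) (Ep := Ep) s)) := by
  refine isHomog_secForm fun y => ?_
  rw [pow_one, neg_smul, one_smul]
  exact (grading_eq_neg_iff _).2 rfl

/-- An `End E`-valued form that acts on sections like an operator of parity `p` has parity `p`. -/
theorem IsLeibniz.hasEndParity_of_sections {κ : ℤ} {p : ℕ}
    {Φ : Module.End 𝕜 (SuperForm (V := V) 𝕜 Fp Ep Fm Em)} (h : IsLeibniz κ p Φ)
    {T : Form V fun x => Module.End 𝕜 ((Ep ×ᵇ Em) x)}
    (hT : ∀ (s : Cₛ^∞⟮𝓘(ℝ, V); Fp × Fm, Ep ×ᵇ Em⟯) x n v,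
      T x n v (s x) = (Φ (secForm 𝕜 s)).1 x n v) (y : M) :
    HasEndParity (P := Ep y) (Q := Em y) p (T y) := by
  have h0 : ∀ (a : Ep y) n v, grading 𝕜 (T y n v (a, 0)) = (-1 : ℝ) ^ (p + n) • T y n v (a, 0) := by
    intro a n v
    obtain ⟨s, rfl⟩ := exists_section_apply_eq (V := V) Fp (W := Ep) a
    have := h.parity _ _ (isHomog_inlSection (𝕜 := 𝕜) (Fm := Fm) (Em := Em) s) y n v
    rw [← hT, zero_add] at this
    exact this
  have h1 : ∀ (b : Em y) n v,
      grading 𝕜 (T y n v (0, b)) = (-1 : ℝ) ^ (1 + p + n) • T y n v (0, b) := by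
    intro b n v
    obtain ⟨s, rfl⟩ := exists_section_apply_eq (V := V) Fm (W := Em) b
    have := h.parity _ _ (isHomog_inrSection (𝕜 := 𝕜) (Fp := Fp) (Ep := Ep) s) y n v
    rw [← hT] at this
    exact this
  intro n v
  refine LinearMap.ext fun e => ?_
  have he : e = (e.1, 0) + (0, e.2) := by
    rw [Prod.mk_add_mk, add_zero, zero_add]
  have hg : grading 𝕜 e = (e.1, 0) - (0, e.2) := by
    rw [Prod.mk_sub_mk, sub_zero, zero_sub]
    rfl
  change grading 𝕜 (T y n v (grading 𝕜 e)) = (-1 : ℝ) ^ (p + n) • T y n v e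
  rw [hg, map_sub, map_sub, h0, h1, add_assoc, pow_add _ 1, pow_one, neg_one_mul, neg_smul,
    sub_neg_eq_add, ← smul_add, ← map_add, ← he]

theorem IsLeibniz.hasEndParity {p : ℕ} {T : SuperEnd (V := V) 𝕜 Fp Ep Fm Em}
    (h : IsLeibniz 0 p (actOp T)) (y : M) : HasEndParity (P := Ep y) (Q := Em y) p (T.1 y) :=
  h.hasEndParity_of_sections (fun s x n v => (actOp_secForm T s x n v).symm) y

/-- A tensorial operator is the action of an `End E`-valued form. -/
theorem IsLeibniz.exists_actOp_eq {p : ℕ} {Φ : Module.End 𝕜 (SuperForm (V := V) 𝕜 Fp Ep Fm Em)}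
    (hΦ : IsLeibniz 0 p Φ) : ∃ T : SuperEnd (V := V) 𝕜 Fp Ep Fm Em, actOp T = Φ := by
  -- The value of the form at `x` maps `e` to the value at `x` of `Φ s`, for any section `s` with
  -- `s x = e`. By locality it does not depend on the choice of `s`.
  choose S hS using fun (x : M) (e : (Ep ×ᵇ Em) x) =>
    exists_section_apply_eq (V := V) (Fp × Fm) (W := Ep ×ᵇ Em) e
  have hsec : ∀ (x : M) (θ : SuperForm (V := V) 𝕜 Fp Ep Fm Em) (e : (Ep ×ᵇ Em) x),
      θ.1 x = form0 (TangentSpace 𝓘(ℝ, V) x) e → (Φ θ).1 x = (Φ (secForm 𝕜 (S x e))).1 x := by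
    intro x θ e h
    refine hΦ.apply_secForm_congr ?_
    rw [hS, h]
  have hadd : ∀ x e e', (Φ (secForm 𝕜 (S x (e + e')))).1 x =
      (Φ (secForm 𝕜 (S x e))).1 x + (Φ (secForm 𝕜 (S x e'))).1 x := by
    intro x e e'
    rw [← hsec x (secForm 𝕜 (S x e) + secForm 𝕜 (S x e')) (e + e'), map_add]
    · rfl
    · funext n
      cases n with
      | zero =>
        ext1 v
        exact congrArg₂ (· + ·) (hS x e) (hS x e')
      | succ n => exact add_zero _
  have hsmul : ∀ x (c : 𝕜) e, (Φ (secForm 𝕜 (S x (c • e)))).1 x =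
      c • (Φ (secForm 𝕜 (S x e))).1 x := by
    intro x c e
    rw [← hsec x (c • secForm 𝕜 (S x e)) (c • e), map_smul]
    · rfl
    · funext n
      cases n with
      | zero =>
        ext1 v
        exact congrArg (c • ·) (hS x e)
      | succ n =>
        exact (smul_zero c :
          c • (0 : TangentSpace 𝓘(ℝ, V) x [⋀^Fin (n + 1)]→ₗ[ℝ] (Ep ×ᵇ Em) x) = 0)
  let T : Form V fun x => Module.End 𝕜 ((Ep ×ᵇ Em) x) := fun x n =>
    { toFun := fun v =>
        { toFun := fun e => (Φ (secForm 𝕜 (S x e))).1 x n v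
          map_add' := fun e e' => by rw [hadd]; rfl
          map_smul' := fun c e => by rw [hsmul]; rfl }
      map_update_add' := fun v i a b => LinearMap.ext fun e => AlternatingMap.map_update_add _ v i a b
      map_update_smul' := fun v i c a => LinearMap.ext fun e => AlternatingMap.map_update_smul _ v i c a
      map_eq_zero_of_eq' := fun v i j hv hij => LinearMap.ext fun e =>
        AlternatingMap.map_eq_zero_of_eq _ v hv hij }
  have hT : ∀ (s : Cₛ^∞⟮𝓘(ℝ, V); Fp × Fm, Ep ×ᵇ Em⟯) x n v,
      T x n v (s x) = (Φ (secForm 𝕜 s)).1 x n v := fun s x n v => by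
    rw [hsec x (secForm 𝕜 s) (s x) rfl]
    rfl
  have hTmem : T ∈ SuperEnd (V := V) 𝕜 Fp Ep Fm Em := fun n X s => by
    simp only [hT]
    exact (Φ (secForm 𝕜 s)).2 n X
  refine ⟨⟨T, hTmem⟩, (isLeibniz_actOp (hΦ.hasEndParity_of_sections hT)).ext hΦ fun s =>
    Subtype.ext (funext fun x => funext fun n => AlternatingMap.ext fun v => ?_)⟩
  rw [actOp_secForm]
  exact hT s x n v

/-! ### The supertrace of a supercommutator -/

theorem xprod_sum_right {T N₁ N₂ N ι : Type*} [AddCommGroup T] [Module ℝ T] [AddCommGroup N₁]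
    [Module ℝ N₁] [AddCommGroup N₂] [Module ℝ N₂] [AddCommGroup N] [Module ℝ N]
    (b : ℕ → ℕ → N₁ →ₗ[ℝ] N₂ →ₗ[ℝ] N) (α : ∀ n : ℕ, T [⋀^Fin n]→ₗ[ℝ] N₁)
    (s : Finset ι) (β : ι → ∀ n : ℕ, T [⋀^Fin n]→ₗ[ℝ] N₂) :
    xprod b α (∑ i ∈ s, β i) = ∑ i ∈ s, xprod b α (β i) :=
  map_sum (AddMonoidHom.mk' (fun β => xprod b α β) fun β β' => xprod_add_right b α β β') β s

theorem d_zsmul (k : ℤ) (α : ScalarForm (V := V) (M := M) 𝕜) : d (k • α).1 = k • d α.1 :=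
  congrArg Subtype.val (map_zsmul (AddMonoidHom.mk' dForm fun α β : ScalarForm (V := V) (M := M) 𝕜 =>
    Subtype.ext (d_add α.2 β.2)) k α)

/-- The expansion of a form at the centre of a frame. -/
theorem LocalFrame.apply_eq_sum {x : M} (F : LocalFrame 𝕜 V (Fp × Fm) (Ep ×ᵇ Em) x)
    (θ : SuperForm (V := V) 𝕜 Fp Ep Fm Em) :
    θ.1 x = ∑ i, wedgeAt ((F.coordForm i θ).1 x) (form0 (TangentSpace 𝓘(ℝ, V) x) (F.sec i x)) := by
  funext n
  ext1 v
  rw [Finset.sum_apply, alternating_sum_apply, ← one_smul 𝕜 (θ.1 x n v),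
    ← F.cutoff_eventually.self_of_nhds, ← F.sum_coord]
  exact Finset.sum_congr rfl fun i _ =>
    (wedgeAt_form0_right ((F.coordForm i θ).1 x) (F.sec i x) n v).symm

/-- At the centre `x` of a frame, a superconnection `A` is the sum of the exterior derivative of the
coordinates and of a connection form, an odd `End E`-valued form at `x`. -/
theorem exists_connectionForm {x : M} (F : SuperFrame 𝕜 V Fp Ep Fm Em x)
    {A : Module.End 𝕜 (SuperForm (V := V) 𝕜 Fp Ep Fm Em)} (hA : IsLeibniz 1 1 A) :
    ∃ a : ∀ n : ℕ, TangentSpace 𝓘(ℝ, V) x [⋀^Fin n]→ₗ[ℝ] Module.End 𝕜 (Ep x × Em x),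
      HasEndParity 1 a ∧ (∀ i, (A (secForm 𝕜 (F.sec i))).1 x =
        actAt a (form0 (TangentSpace 𝓘(ℝ, V) x) (F.sec i x))) ∧
      ∀ θ : SuperForm (V := V) 𝕜 Fp Ep Fm Em, (A θ).1 x =
        ∑ i, wedgeAt (d (F.coordForm i θ).1 x) (form0 (TangentSpace 𝓘(ℝ, V) x) (F.sec i x)) +
          actAt a (θ.1 x) := by
  have h1 := F.cutoff_eventually.self_of_nhds
  -- The connection form maps the frame to its image under `A`.
  let a : ∀ n : ℕ, TangentSpace 𝓘(ℝ, V) x [⋀^Fin n]→ₗ[ℝ] Module.End 𝕜 (Ep x × Em x) := fun n =>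
    ∑ j, ((LinearMap.smulRightₗ (F.coord j x)).restrictScalars ℝ).compAlternatingMap
      ((A (secForm 𝕜 (F.sec j))).1 x n)
  have ha : ∀ j n v, a n v (F.sec j x) = (A (secForm 𝕜 (F.sec j))).1 x n v := by
    intro j n v
    have : a n v (F.sec j x) = ∑ i, F.coord i x (F.sec j x) • (A (secForm 𝕜 (F.sec i))).1 x n v := by
      have h2 : a n v = ∑ i, (F.coord i x).smulRight ((A (secForm 𝕜 (F.sec i))).1 x n v) :=
        alternating_sum_apply _ _ _
      rw [h2]
      exact LinearMap.sum_apply _ _ _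
    rw [this]
    simp [F.coord_sec]
  have hpar : HasEndParity 1 a := by
    intro n v
    refine F.ext_sec h1 fun j => ?_
    have h2 := hA.parity _ _ (isHomog_secForm (𝕜 := 𝕜) (F.grading_sec j)) x n v
    have h3 : a n v (grading 𝕜 (F.sec j x)) = (-1 : ℝ) ^ F.deg j • a n v (F.sec j x) := by
      refine (congrArg (a n v) (F.grading_sec j x)).trans ?_
      exact LinearMap.map_smul_of_tower _ _ _
    change grading 𝕜 (a n v (grading 𝕜 (F.sec j x))) = (-1 : ℝ) ^ (1 + n) • a n v (F.sec j x)
    rw [h3, LinearMap.map_smul_of_tower, ha, h2, smul_smul, ← pow_add,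
      neg_one_pow_congr (m := F.deg j + (F.deg j + 1 + n)) (n := 1 + n)]
    exact ⟨F.deg j + 1 + n, by omega⟩
  have ha' : ∀ i, (A (secForm 𝕜 (F.sec i))).1 x =
      actAt a (form0 (TangentSpace 𝓘(ℝ, V) x) (F.sec i x)) := by
    intro i
    funext n
    ext1 v
    exact (ha i n v).symm.trans (actAt_form0 _ _ _ _).symm
  refine ⟨a, hpar, ha', fun θ => ?_⟩
  have h4 : actAt a (θ.1 x) = ∑ i, wedgeAt (sgn 1 ((F.coordForm i θ).1 x))
      ((A (secForm 𝕜 (F.sec i))).1 x) := by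
    rw [F.apply_eq_sum θ]
    refine (xprod_sum_right _ _ _ _).trans (Finset.sum_congr rfl fun i _ => ?_)
    exact (actAt_wedgeAt hpar _ _).trans (congrArg _ (ha' i).symm)
  rw [h4, hA.apply_eq F.toLocalFrame, ← Finset.sum_add_distrib]
  exact Finset.sum_congr rfl fun i _ => by rw [one_smul]

theorem Str_apply (T : SuperEnd (V := V) 𝕜 Fp Ep Fm Em) (y : M) (n : ℕ)
    (v : Fin n → TangentSpace 𝓘(ℝ, V) y) :
    (Str T).1 y n v = supertrace (P := Ep y) (N := Em y) 𝕜 (T.1 y n v) := rfl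

/-- Near the centre of a frame, the supertrace is the alternating sum of the diagonal entries. -/
theorem SuperFrame.Str_eventuallyEq {x : M} (F : SuperFrame 𝕜 V Fp Ep Fm Em x)
    (T : SuperEnd (V := V) 𝕜 Fp Ep Fm Em) : ∀ᶠ y in 𝓝 x, (Str T).1 y =
      (∑ i, ((-1 : ℤ) ^ F.deg i • F.coordForm i (actOp T (secForm 𝕜 (F.sec i)))).1) y := by
  filter_upwards [F.cutoff_eventually] with y hy
  funext n
  ext1 v
  rw [Str_apply, F.supertrace_eq_sum hy, Finset.sum_apply, Finset.sum_apply, alternating_sum_apply]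
  refine Finset.sum_congr rfl fun i _ => ?_
  rw [← neg_one_zpow_smul]
  exact congrArg (fun w => (-1 : ℤ) ^ F.deg i • F.coord i y w) (actOp_secForm T _ y n v).symm

/-- The supertrace intertwines the supercommutator with a superconnection and the exterior
derivative: the connection form does not contribute, because the supertrace vanishes on
supercommutators. -/
theorem Str_supercommutator {A : Module.End 𝕜 (SuperForm (V := V) 𝕜 Fp Ep Fm Em)}
    (hA : IsLeibniz 1 1 A) {p : ℕ} {D R : SuperEnd (V := V) 𝕜 Fp Ep Fm Em}
    (hD : IsLeibniz 0 p (actOp D))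
    (hR : actOp R = A * actOp D - (-1 : ℤ) ^ p • (actOp D * A)) : (Str R).1 = d (Str D).1 := by
  funext x
  obtain ⟨F⟩ := exists_superFrame (𝕜 := 𝕜) (V := V) (Fp := Fp) (Ep := Ep) (Fm := Fm) (Em := Em) x
  obtain ⟨a, ha, has, hAa⟩ := exists_connectionForm F hA
  have h1 := F.cutoff_eventually.self_of_nhds
  have hDp : HasEndParity (P := Ep x) (Q := Em x) p (D.1 x) := hD.hasEndParity x
  rw [d_congr (F.Str_eventuallyEq D), d_sum]
  funext n
  ext1 v
  -- The supertrace does not see the commutator with the connection form.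
  have hcomm : supertrace 𝕜 (mulAt a (D.1 x) n v) =
      (-1 : ℝ) ^ p • supertrace 𝕜 (mulAt (D.1 x) a n v) := by
    have := finiteDimensional_fibre 𝕜 Fp Ep x
    have := finiteDimensional_fibre 𝕜 Fm Em x
    have h := congrArg (fun f => f n v) (strAt_mulAt_comm ha hDp)
    rw [one_mul] at h
    exact h
  -- On the frame, the supercommutator is the derivative of the matrix of `D`, plus the
  -- supercommutator of `D` with the connection form.
  have key : ∀ i, R.1 x n v (F.sec i x) =
      ∑ j, d (F.coordForm j (actOp D (secForm 𝕜 (F.sec i)))).1 x n v • F.sec j x +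
        (mulAt a (D.1 x) n v - (-1 : ℝ) ^ p • mulAt (D.1 x) a n v) (F.sec i x) := by
    intro i
    have h2 : (actOp R (secForm 𝕜 (F.sec i))).1 x n v =
        (A (actOp D (secForm 𝕜 (F.sec i)))).1 x n v -
          (-1 : ℤ) ^ p • (actOp D (A (secForm 𝕜 (F.sec i)))).1 x n v :=
      congrArg (fun Φ : Module.End 𝕜 (SuperForm (V := V) 𝕜 Fp Ep Fm Em) =>
        (Φ (secForm 𝕜 (F.sec i))).1 x n v) hR
    have h3 : (actOp D (secForm 𝕜 (F.sec i))).1 x =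
      actAt (D.1 x) (form0 (TangentSpace 𝓘(ℝ, V) x) (F.sec i x)) := rfl
    have h4 : (actOp D (A (secForm 𝕜 (F.sec i)))).1 x =
      actAt (D.1 x) ((A (secForm 𝕜 (F.sec i))).1 x) := rfl
    rw [actOp_secForm, hAa, h3, h4, has, actAt_actAt, actAt_actAt, neg_one_zpow_smul] at h2
    refine h2.trans ?_
    rw [Pi.add_apply, Finset.sum_apply, AlternatingMap.add_apply, alternating_sum_apply,
      actAt_form0, actAt_form0, add_sub_assoc]
    refine congrArg₂ (· + ·) (Finset.sum_congr rfl fun j _ => ?_) rfl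
    exact wedgeAt_form0_right _ _ _ _
  rw [Str_apply, F.supertrace_eq_sum h1, Finset.sum_apply, Finset.sum_apply, alternating_sum_apply]
  have h5 : ∑ i, (-1 : ℝ) ^ F.deg i • F.coord i x
      ((mulAt a (D.1 x) n v - (-1 : ℝ) ^ p • mulAt (D.1 x) a n v) (F.sec i x)) = 0 := by
    rw [← F.supertrace_eq_sum h1, map_sub, map_smul, hcomm, sub_self]
  have h6 : ∀ i, F.coord i x (R.1 x n v (F.sec i x)) =
      d (F.coordForm i (actOp D (secForm 𝕜 (F.sec i)))).1 x n v + F.coord i x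
        ((mulAt a (D.1 x) n v - (-1 : ℝ) ^ p • mulAt (D.1 x) a n v) (F.sec i x)) := by
    intro i
    rw [key, map_add, map_sum]
    simp only [map_smul, F.coord_sec]
    simp
  simp only [h6, smul_add, Finset.sum_add_distrib]
  rw [h5, add_zero]
  refine Finset.sum_congr rfl fun i _ => ?_
  rw [d_zsmul, ← neg_one_zpow_smul]
  rfl

/-! ### Time derivatives of families of operators -/

/-- The derivative of a family of forms, defined through a trivialization, does not depend on it. -/
theorem hasLinDeriv_timeDeriv {G : Type*} [NormedAddCommGroup G] [NormedSpace ℝ G]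
    [FiniteDimensional ℝ G] {W : M → Type*} [TopologicalSpace (TotalSpace G W)]
    [∀ x, AddCommGroup (W x)] [∀ x, Module ℝ (W x)] [∀ x, TopologicalSpace (W x)] [FiberBundle G W]
    [VectorBundle ℝ G W] [ContMDiffVectorBundle ∞ G W 𝓘(ℝ, V)]
    {θ : ℝ → Form V W} (hθ : IsSmoothFamily G θ) (x : M)
    (n : ℕ) (v : Fin n → TangentSpace 𝓘(ℝ, V) x) (t : ℝ) :
    HasLinDeriv (fun s => θ s x n v) (timeDeriv θ hθ t x n v) t := by
  intro ℓ
  have h1 := (differentiable_fibre hθ x n v t).hasDerivAt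
  have h2 := hasLinDeriv_of_hasDerivAt h1 (ℓ ∘ₗ (fibreIso (W := W) G x).symm.toLinearMap)
  have h3 : ∀ w, (ℓ ∘ₗ (fibreIso (W := W) G x).symm.toLinearMap) (fibreIso G x w) = ℓ w := fun w =>
    congrArg ℓ ((fibreIso (W := W) G x).symm_apply_apply w)
  simp only [h3] at h2
  exact h2

theorem hasLinDeriv_wedgeAt_left {T N : Type*} [AddCommGroup T] [Module ℝ T] [AddCommGroup N]
    [Module ℝ N] [Module 𝕜 N] [IsScalarTower ℝ 𝕜 N] {α : ℝ → ∀ n : ℕ, T [⋀^Fin n]→ₗ[ℝ] 𝕜}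
    {α' : ∀ n : ℕ, T [⋀^Fin n]→ₗ[ℝ] 𝕜} {t : ℝ}
    (hα : ∀ n v, HasLinDeriv (fun s => α s n v) (α' n v) t)
    (β : ∀ n : ℕ, T [⋀^Fin n]→ₗ[ℝ] N) (n : ℕ) (v : Fin n → T) :
    HasLinDeriv (fun s => wedgeAt (α s) β n v) (wedgeAt α' β n v) t := by
  have h := hasLinDeriv_wedgeWith (fun _ => smulBilin N) hα (β := fun _ => β) (β' := 0)
    (fun n v => hasLinDeriv_const _ _) n v
  have h0 : wedgeWith (fun _ => smulBilin N) (α t) (0 : ∀ n : ℕ, T [⋀^Fin n]→ₗ[ℝ] N) n v = 0 :=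
    congrArg (fun f => f n v) (xprod_zero_right (fun _ _ => smulBilin N) (α t))
  rw [h0, add_zero] at h
  exact h

theorem hasLinDeriv_wedgeAt_right {T N : Type*} [AddCommGroup T] [Module ℝ T] [AddCommGroup N]
    [Module ℝ N] [Module 𝕜 N] [IsScalarTower ℝ 𝕜 N] (α : ∀ n : ℕ, T [⋀^Fin n]→ₗ[ℝ] 𝕜)
    {β : ℝ → ∀ n : ℕ, T [⋀^Fin n]→ₗ[ℝ] N} {β' : ∀ n : ℕ, T [⋀^Fin n]→ₗ[ℝ] N} {t : ℝ}
    (hβ : ∀ n v, HasLinDeriv (fun s => β s n v) (β' n v) t) (n : ℕ) (v : Fin n → T) :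
    HasLinDeriv (fun s => wedgeAt α (β s) n v) (wedgeAt α β' n v) t := by
  have h := hasLinDeriv_wedgeWith (fun _ => smulBilin N) (α := fun _ => α) (α' := 0)
    (fun n v => hasLinDeriv_const _ _) hβ n v
  have h0 : wedgeWith (fun _ => smulBilin N) (0 : ∀ n : ℕ, T [⋀^Fin n]→ₗ[ℝ] 𝕜) (β t) n v = 0 :=
    congrArg (fun f => f n v) (xprod_zero_left (fun _ _ => smulBilin N) (β t))
  rw [h0, zero_add] at h
  exact h

theorem HasLinDeriv.sgn {T N : Type*} [AddCommGroup T] [Module ℝ T] [AddCommGroup N] [Module ℝ N]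
    (p : ℕ) {α : ℝ → ∀ n : ℕ, T [⋀^Fin n]→ₗ[ℝ] N} {α' : ∀ n : ℕ, T [⋀^Fin n]→ₗ[ℝ] N} {t : ℝ}
    (hα : ∀ n v, HasLinDeriv (fun s => α s n v) (α' n v) t) (n : ℕ) (v : Fin n → T) :
    HasLinDeriv (fun s => PrimitiveChernWeil.sgn p (α s) n v) (PrimitiveChernWeil.sgn p α' n v) t :=
  (hα n v).map ((-1 : ℝ) ^ (p * n) • LinearMap.id)

theorem HasLinDeriv.zsmul {N : Type*} [AddCommGroup N] [Module ℝ N] {g : ℝ → N} {g' : N} {t : ℝ}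
    (k : ℤ) (h : HasLinDeriv g g' t) : HasLinDeriv (fun s => k • g s) (k • g') t :=
  h.map (k • LinearMap.id)

theorem HasLinDeriv.congr {N : Type*} [AddCommGroup N] [Module ℝ N] {g f : ℝ → N} {g' : N} {t : ℝ}
    (h : HasLinDeriv g g' t) (hf : ∀ s, f s = g s) : HasLinDeriv f g' t := by
  rwa [funext hf]

theorem hasLinDeriv_opDeriv {D : ℝ → Module.End 𝕜 (SuperForm (V := V) 𝕜 Fp Ep Fm Em)}
    (hD : IsSmoothOpFamily D) (t : ℝ) (θ : SuperForm (V := V) 𝕜 Fp Ep Fm Em) (x : M) (n : ℕ)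
    (v : Fin n → TangentSpace 𝓘(ℝ, V) x) :
    HasLinDeriv (fun s => (D s θ).1 x n v) ((opDeriv D hD t θ).1 x n v) t := by
  have := Module.Finite.trans (R := ℝ) 𝕜 Fp
  have := Module.Finite.trans (R := ℝ) 𝕜 Fm
  exact hasLinDeriv_timeDeriv (hD θ) x n v t

/-- The inhomogeneous term of the Leibniz rule does not depend on time, so that the derivative of a
family of superconnections is tensorial. -/
theorem isLeibniz_opDeriv {κ : ℤ} {p : ℕ}
    {D : ℝ → Module.End 𝕜 (SuperForm (V := V) 𝕜 Fp Ep Fm Em)} (hD : IsSmoothOpFamily D)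
    (h : ∀ s, IsLeibniz κ p (D s)) (t : ℝ) : IsLeibniz 0 p (opDeriv D hD t) where
  map_wedge α θ := by
    rw [zero_smul, zero_add]
    refine Subtype.ext (funext fun x => funext fun n => AlternatingMap.ext fun v => ?_)
    refine (hasLinDeriv_opDeriv hD t (wedgeLeft α θ) x n v).unique ?_
    have h1 := (hasLinDeriv_const ((κ • wedgeLeft (dForm α) θ).1 x n v) t).add
      (hasLinDeriv_wedgeAt_right (sgn p (α.1 x)) (fun n v => hasLinDeriv_opDeriv hD t θ x n v) n v)
    rw [zero_add] at h1
    refine h1.congr fun s => ?_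
    exact congrArg (fun θ : SuperForm (V := V) 𝕜 Fp Ep Fm Em => θ.1 x n v) ((h s).map_wedge α θ)
  parity q θ hθ := fun x n v => by
    have h1 := hasLinDeriv_opDeriv hD t θ x n v
    have h2 := h1.map ((grading 𝕜 : Module.End 𝕜 (Ep x × Em x)).restrictScalars ℝ)
    have h3 := h1.map ((-1 : ℝ) ^ (q + p + n) • LinearMap.id)
    exact h2.unique (h3.congr fun s => (h s).parity q θ hθ x n v)

/-- The product rule for the application of a family of operators to a family of forms. In a frame,
the operators are given by the exterior derivative of the coordinates, which commutes with the time
derivative, and by the images of the frame. -/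
theorem hasLinDeriv_apply {κ : ℤ} {p : ℕ}
    {D : ℝ → Module.End 𝕜 (SuperForm (V := V) 𝕜 Fp Ep Fm Em)} (hD : IsSmoothOpFamily D)
    (h : ∀ s, IsLeibniz κ p (D s)) {θ : ℝ → SuperForm (V := V) 𝕜 Fp Ep Fm Em}
    (hθ : IsSmoothFamily (Fp × Fm) fun s => (θ s).1) {t : ℝ}
    {θ' : SuperForm (V := V) 𝕜 Fp Ep Fm Em}
    (hθ' : ∀ x n v, HasLinDeriv (fun s => (θ s).1 x n v) (θ'.1 x n v) t) (x : M) (n : ℕ)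
    (v : Fin n → TangentSpace 𝓘(ℝ, V) x) :
    HasLinDeriv (fun s => (D s (θ s)).1 x n v)
      ((opDeriv D hD t (θ t)).1 x n v + (D t θ').1 x n v) t := by
  obtain ⟨F⟩ := exists_localFrame (𝕜 := 𝕜) (V := V) (G := Fp × Fm) (W := Ep ×ᵇ Em) x
  have hc : ∀ i y n (v : Fin n → TangentSpace 𝓘(ℝ, V) y),
      HasLinDeriv (fun s => (F.coordForm i (θ s)).1 y n v) ((F.coordForm i θ').1 y n v) t :=
    fun i y n v => (hθ' y n v).map ((F.coord i y).restrictScalars ℝ)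
  have hdc : ∀ i n (v : Fin n → TangentSpace 𝓘(ℝ, V) x),
      HasLinDeriv (fun s => d (F.coordForm i (θ s)).1 x n v) (d (F.coordForm i θ').1 x n v) t :=
    fun i n v => hasLinDeriv_of_hasDerivAt (hasDerivAt_d (α := fun s => (F.coordForm i (θ s)).1)
      (fun n X => F.smooth_coord i _ hθ n X) (fun y n v => (hc i y n v).hasDerivAt)
      (F.coordForm i θ').2 x n v)
  have h1 : HasLinDeriv (fun s => ∑ i, (κ • wedgeAt (d (F.coordForm i (θ s)).1 x)
        (form0 (TangentSpace 𝓘(ℝ, V) x) (F.sec i x)) n v +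
      wedgeAt (sgn p ((F.coordForm i (θ s)).1 x)) ((D s (secForm 𝕜 (F.sec i))).1 x) n v))
      (∑ i, (κ • wedgeAt (d (F.coordForm i θ').1 x)
        (form0 (TangentSpace 𝓘(ℝ, V) x) (F.sec i x)) n v +
      (wedgeAt (sgn p ((F.coordForm i θ').1 x)) ((D t (secForm 𝕜 (F.sec i))).1 x) n v +
      wedgeAt (sgn p ((F.coordForm i (θ t)).1 x)) ((opDeriv D hD t (secForm 𝕜 (F.sec i))).1 x) n v))) t := by
    refine HasLinDeriv.sum fun i _ => ((hasLinDeriv_wedgeAt_left (hdc i) _ n v).zsmul κ).add ?_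
    exact hasLinDeriv_wedgeWith (fun _ => smulBilin (Ep x × Em x)) (HasLinDeriv.sgn p (hc i x))
      (fun n v => hasLinDeriv_opDeriv hD t (secForm 𝕜 (F.sec i)) x n v) n v
  have h2 : (opDeriv D hD t (θ t)).1 x n v + (D t θ').1 x n v =
      ∑ i, (κ • wedgeAt (d (F.coordForm i θ').1 x)
        (form0 (TangentSpace 𝓘(ℝ, V) x) (F.sec i x)) n v +
      (wedgeAt (sgn p ((F.coordForm i θ').1 x)) ((D t (secForm 𝕜 (F.sec i))).1 x) n v +
      wedgeAt (sgn p ((F.coordForm i (θ t)).1 x))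
        ((opDeriv D hD t (secForm 𝕜 (F.sec i))).1 x) n v)) := by
    rw [(isLeibniz_opDeriv hD h t).apply_eq F, (h t).apply_eq F, Finset.sum_apply, Finset.sum_apply,
      alternating_sum_apply, alternating_sum_apply, ← Finset.sum_add_distrib]
    refine Finset.sum_congr rfl fun i _ => ?_
    rw [zero_smul, zero_add, add_comm]
    exact add_assoc _ _ _
  rw [h2]
  refine h1.congr fun s => ?_
  rw [(h s).apply_eq F, Finset.sum_apply, alternating_sum_apply]
  rfl

/-- A family of endomorphisms is differentiable if it is so pointwise. -/
theorem hasLinDeriv_end {N : Type*} [AddCommGroup N] [Module ℝ N] [Module 𝕜 N] [IsScalarTower ℝ 𝕜 N]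
    [FiniteDimensional 𝕜 N] {L : ℝ → Module.End 𝕜 N} {L' : Module.End 𝕜 N} {t : ℝ}
    (h : ∀ e, HasLinDeriv (fun s => L s e) (L' e) t) : HasLinDeriv L L' t := by
  let b := Module.finBasis 𝕜 N
  have h1 : ∀ K : Module.End 𝕜 N, K = ∑ i, (b.coord i).smulRight (K (b i)) := fun K =>
    b.ext fun j => by simp [Finsupp.single_apply]
  rw [h1 L', funext fun s => h1 (L s)]
  exact HasLinDeriv.sum fun i _ =>
    (h (b i)).map ((LinearMap.smulRightₗ (b.coord i)).restrictScalars ℝ)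

/-! ### The algebra of endomorphism-valued forms -/

theorem isHomog_iff_parity_eq {q : ℕ} (θ : SuperForm (V := V) 𝕜 Fp Ep Fm Em) :
    IsHomog q θ ↔ parity θ = (-1 : ℤ) ^ q • θ := by
  have h : ∀ y n v, (grading (P := Ep y) (N := Em y) 𝕜 (θ.1 y n v) =
      (-1 : ℝ) ^ (q + n) • θ.1 y n v ↔ (parity θ).1 y n v = (-1 : ℝ) ^ q • θ.1 y n v) := by
    intro y n v
    have e : (parity θ).1 y n v = (-1 : ℝ) ^ n • grading (P := Ep y) (N := Em y) 𝕜 (θ.1 y n v) := rfl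
    have hn : (-1 : ℝ) ^ n * (-1) ^ n = 1 := by rw [← mul_pow]; simp
    rw [e]
    constructor
    · intro h
      rw [h, pow_add, mul_comm, smul_smul, ← mul_assoc, hn, one_mul]
    · intro h
      rw [pow_add, mul_comm, ← smul_smul, ← h, smul_smul, hn, one_smul]
  constructor
  · intro hθ
    refine Subtype.ext (funext fun y => funext fun n => AlternatingMap.ext fun v => ?_)
    refine ((h y n v).1 (hθ y n v)).trans ?_
    rw [← neg_one_zpow_smul]
    rfl
  · intro hθ y n v
    refine (h y n v).2 ?_
    rw [← neg_one_zpow_smul, hθ]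
    rfl

theorem parity_parity (θ : SuperForm (V := V) 𝕜 Fp Ep Fm Em) : parity (parity θ) = θ := by
  refine Subtype.ext (funext fun y => funext fun n => AlternatingMap.ext fun v => ?_)
  change (-1 : ℝ) ^ n • grading (P := Ep y) (N := Em y) 𝕜 ((-1 : ℝ) ^ n • grading 𝕜 (θ.1 y n v)) = _
  rw [LinearMap.map_smul_of_tower, smul_smul, ← mul_pow, grading_grading]
  simp

/-- An operator of parity `p` commutes with the grading operator up to the sign `(-1)^p`. -/
theorem IsLeibniz.parity_apply {κ : ℤ} {p : ℕ} {Φ : Module.End 𝕜 (SuperForm (V := V) 𝕜 Fp Ep Fm Em)}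
    (hΦ : IsLeibniz κ p Φ) (θ : SuperForm (V := V) 𝕜 Fp Ep Fm Em) :
    PrimitiveChernWeil.parity (Φ (PrimitiveChernWeil.parity θ)) = (-1 : ℤ) ^ p • Φ θ := by
  -- `θ + Π θ` is even and `θ - Π θ` is odd.
  have h0 : IsHomog 0 (θ + PrimitiveChernWeil.parity θ) := by
    rw [isHomog_iff_parity_eq, map_add, parity_parity, pow_zero, one_smul, add_comm]
  have h1 : IsHomog 1 (θ - PrimitiveChernWeil.parity θ) := by
    rw [isHomog_iff_parity_eq, map_sub, parity_parity, pow_one, neg_smul, one_smul, neg_sub]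
  have e0 := (isHomog_iff_parity_eq _).1 (hΦ.parity _ _ h0)
  have e1 := (isHomog_iff_parity_eq _).1 (hΦ.parity _ _ h1)
  rw [zero_add] at e0
  rw [pow_add, pow_one, neg_one_mul, neg_smul] at e1
  have e2 := congrArg₂ (· - ·) e0 e1
  simp only [map_add, map_sub, smul_add, smul_sub] at e2
  have e3 : (2 : 𝕜) • PrimitiveChernWeil.parity (Φ (PrimitiveChernWeil.parity θ)) =
      (2 : 𝕜) • (-1 : ℤ) ^ p • Φ θ := by
    rw [two_smul, two_smul]
    calc _ = _ := by abel
      _ = _ := e2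
      _ = _ := by abel
  exact smul_right_injective _ (two_ne_zero (α := 𝕜)) e3

/-- The product of `End E`-valued forms. -/
def mulEnd (S T : SuperEnd (V := V) 𝕜 Fp Ep Fm Em) : SuperEnd (V := V) 𝕜 Fp Ep Fm Em :=
  ⟨fun x => mulAt (P := Ep x) (Q := Em x) (S.1 x) (T.1 x), fun n X s => by
    refine ((actOp S (actOp T (secForm 𝕜 s))).2 n X).congr fun x => ?_
    refine congrArg (TotalSpace.mk' (Fp × Fm) x) ?_
    have h : (actOp S (actOp T (secForm 𝕜 s))).1 x =
      actAt (S.1 x) (actAt (T.1 x) (form0 (TangentSpace 𝓘(ℝ, V) x) (s x))) := rfl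
    rw [h, actAt_actAt, actAt_form0]⟩

theorem actOp_mulEnd (S T : SuperEnd (V := V) 𝕜 Fp Ep Fm Em) :
    actOp (mulEnd S T) = actOp S * actOp T := by
  refine LinearMap.ext fun θ => Subtype.ext (funext fun x => ?_)
  exact (actAt_actAt (S.1 x) (T.1 x) (θ.1 x)).symm

section

variable {T : Type*} [AddCommGroup T] [Module ℝ T] {P Q : Type*} [AddCommGroup P] [Module ℝ P]
  [Module 𝕜 P] [IsScalarTower ℝ 𝕜 P] [AddCommGroup Q] [Module ℝ Q] [Module 𝕜 Q]
  [IsScalarTower ℝ 𝕜 Q]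

theorem actAt_add_left (S S' : ∀ n : ℕ, T [⋀^Fin n]→ₗ[ℝ] Module.End 𝕜 (P × Q))
    (θ : ∀ n : ℕ, T [⋀^Fin n]→ₗ[ℝ] (P × Q)) :
    actAt (fun n => S n + S' n) θ = fun n => actAt S θ n + actAt S' θ n :=
  xprod_add_left _ _ _ _

theorem actAt_smul_left (c : 𝕜) (S : ∀ n : ℕ, T [⋀^Fin n]→ₗ[ℝ] Module.End 𝕜 (P × Q))
    (θ : ∀ n : ℕ, T [⋀^Fin n]→ₗ[ℝ] (P × Q)) (n : ℕ) (v : Fin n → T) :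
    actAt (fun n => c • S n) θ n v = c • actAt S θ n v := by
  change wedgeWith (fun j => signedApply 𝕜 j) (fun n => c • S n) θ n v =
    c • wedgeWith (fun j => signedApply 𝕜 j) S θ n v
  simp only [wedgeWith_apply, Finset.smul_sum]
  refine Finset.sum_congr rfl fun i _ => Finset.sum_congr rfl fun q _ => ?_
  rw [smul_comm c]
  congr 1
  simp only [signedApply_apply, AlternatingMap.smul_apply, mul_smul_comm,
    smul_mul_assoc, LinearMap.smul_apply]

theorem smul_zsmul_comm {N : Type*} [AddCommGroup N] [Module 𝕜 N] (c : 𝕜) (k : ℤ) (v : N) :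
    c • k • v = k • c • v := smul_comm c k v

end

theorem actOp_add (S T : SuperEnd (V := V) 𝕜 Fp Ep Fm Em) : actOp (S + T) = actOp S + actOp T :=
  LinearMap.ext fun θ => Subtype.ext (funext fun x => actAt_add_left (S.1 x) (T.1 x) (θ.1 x))

theorem actOp_smul (c : 𝕜) (T : SuperEnd (V := V) 𝕜 Fp Ep Fm Em) : actOp (c • T) = c • actOp T :=
  LinearMap.ext fun θ => Subtype.ext (funext fun x => funext fun n => AlternatingMap.ext fun v =>
    actAt_smul_left c (T.1 x) (θ.1 x) n v)

theorem actOp_zero : actOp (0 : SuperEnd (V := V) 𝕜 Fp Ep Fm Em) = 0 :=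
  LinearMap.ext fun θ => Subtype.ext (funext fun x =>
    xprod_zero_left (fun _ j => signedApply (P := Ep x) (N := Em x) 𝕜 j) (θ.1 x))

theorem Str_add (S T : SuperEnd (V := V) 𝕜 Fp Ep Fm Em) : Str (S + T) = Str S + Str T :=
  Subtype.ext (funext fun y => funext fun n => AlternatingMap.ext fun v =>
    map_add (supertrace (P := Ep y) (N := Em y) 𝕜) (S.1 y n v) (T.1 y n v))

/-- The supertrace of a product is supersymmetric. -/
theorem Str_mulEnd_comm {p q : ℕ} {S T : SuperEnd (V := V) 𝕜 Fp Ep Fm Em}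
    (hS : IsLeibniz 0 p (actOp S)) (hT : IsLeibniz 0 q (actOp T)) :
    Str (mulEnd S T) = (-1 : ℤ) ^ (p * q) • Str (mulEnd T S) := by
  refine Subtype.ext (funext fun y => ?_)
  have := finiteDimensional_fibre 𝕜 Fp Ep y
  have := finiteDimensional_fibre 𝕜 Fm Em y
  refine (strAt_mulAt_comm (hS.hasEndParity y) (hT.hasEndParity y)).trans (funext fun n => ?_)
  exact (neg_one_zpow_smul (p * q) (strAt (mulAt (T.1 y) (S.1 y)) n)).symm

theorem isLeibniz_one : IsLeibniz 0 0 (1 : Module.End 𝕜 (SuperForm (V := V) 𝕜 Fp Ep Fm Em)) where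
  map_wedge α θ := by
    rw [zero_smul, zero_add, sgnForm_zero]
    rfl
  parity q θ hθ := hθ

namespace IsLeibniz

variable {κ : ℤ} {p q : ℕ} {Φ Ψ : Module.End 𝕜 (SuperForm (V := V) 𝕜 Fp Ep Fm Em)}

theorem congr (h : Even (p + q)) (hΦ : IsLeibniz κ p Φ) : IsLeibniz κ q Φ where
  map_wedge α θ := by rw [hΦ.map_wedge, sgnForm_congr h]
  parity r θ hθ := (hΦ.parity r θ hθ).congr (by
    obtain ⟨k, hk⟩ := h
    exact ⟨r + k, by omega⟩)

theorem mul (hΦ : IsLeibniz 0 p Φ) (hΨ : IsLeibniz 0 q Ψ) : IsLeibniz 0 (p + q) (Φ * Ψ) where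
  map_wedge α θ := by
    rw [Module.End.mul_apply, hΦ.map_map_wedge hΨ]
    simp [Module.End.mul_apply]
  parity r θ hθ := by
    have := hΦ.parity _ _ (hΨ.parity _ _ hθ)
    rwa [add_assoc, add_comm q p] at this

theorem smul (c : 𝕜) (hΦ : IsLeibniz 0 p Φ) : IsLeibniz 0 p (c • Φ) where
  map_wedge α θ := by
    rw [LinearMap.smul_apply, hΦ.map_wedge, LinearMap.smul_apply, map_smul]
    simp only [zero_smul, zero_add]
  parity r θ hθ := by
    rw [isHomog_iff_parity_eq, LinearMap.smul_apply, map_smul,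
      (isHomog_iff_parity_eq _).1 (hΦ.parity r θ hθ)]
    exact smul_zsmul_comm _ _ _

end IsLeibniz

/-! ### Operators identified with pairs of forms -/

/-- The pair `(D, D')` of `End E`-valued forms has parity `p`, that is, `D` has parity `p` and `D'`
has parity `p + 1`. -/
def IsPair (p : ℕ) (P : SuperEnd (V := V) 𝕜 Fp Ep Fm Em × SuperEnd (V := V) 𝕜 Fp Ep Fm Em) : Prop :=
  IsLeibniz 0 p (actOp P.1) ∧ IsLeibniz 0 (p + 1) (actOp P.2)

theorem pairOp_apply {p : ℕ} {P : SuperEnd (V := V) 𝕜 Fp Ep Fm Em × SuperEnd (V := V) 𝕜 Fp Ep Fm Em}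
    (hP : IsPair p P) (α β : SuperForm (V := V) 𝕜 Fp Ep Fm Em) :
    pairOp P (α, β) = (actOp P.1 α, actOp P.2 α + (-1 : ℤ) ^ p • actOp P.1 β) := by
  rw [← hP.1.parity_apply]
  rfl

theorem pairOp_apply_zero (P : SuperEnd (V := V) 𝕜 Fp Ep Fm Em × SuperEnd (V := V) 𝕜 Fp Ep Fm Em)
    (α : SuperForm (V := V) 𝕜 Fp Ep Fm Em) : pairOp P (α, 0) = (actOp P.1 α, actOp P.2 α) := by
  refine Prod.ext rfl ?_
  change actOp P.2 α + parity (actOp P.1 (parity 0)) = actOp P.2 α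
  rw [map_zero, map_zero, map_zero, add_zero]

theorem pairOp_injective : Function.Injective (pairOp (V := V) (𝕜 := 𝕜) (Fp := Fp) (Ep := Ep)
    (Fm := Fm) (Em := Em)) := by
  intro P P' h
  have h1 : ∀ α, (actOp P.1 α, actOp P.2 α) = (actOp P'.1 α, actOp P'.2 α) := fun α => by
    rw [← pairOp_apply_zero, ← pairOp_apply_zero, h]
  exact Prod.ext (actOp_injective (LinearMap.ext fun α => congrArg Prod.fst (h1 α)))
    (actOp_injective (LinearMap.ext fun α => congrArg Prod.snd (h1 α)))

/-- Since an operator is identified with at most one pair, the choice in the definition of the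
supertrace does not matter. -/
theorem pairStr_pairOp (P : SuperEnd (V := V) 𝕜 Fp Ep Fm Em × SuperEnd (V := V) 𝕜 Fp Ep Fm Em) :
    pairStr (pairOp P) = (Str P.1, Str P.2) := by
  have h : ∃ P', pairOp P' = pairOp P := ⟨P, rfl⟩
  rw [pairStr, dif_pos h, pairOp_injective h.choose_spec]

/-- The product of pairs that corresponds to the composition of operators, where `p` is the parity of
the first factor. -/
def mulPair (p : ℕ) (P Q : SuperEnd (V := V) 𝕜 Fp Ep Fm Em × SuperEnd (V := V) 𝕜 Fp Ep Fm Em) :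
    SuperEnd (V := V) 𝕜 Fp Ep Fm Em × SuperEnd (V := V) 𝕜 Fp Ep Fm Em :=
  (mulEnd P.1 Q.1, mulEnd P.2 Q.1 + ((-1 : 𝕜) ^ p) • mulEnd P.1 Q.2)

theorem neg_one_pow_smul_eq_zsmul {N : Type*} [AddCommGroup N] [Module 𝕜 N] (p : ℕ) (v : N) :
    (-1 : 𝕜) ^ p • v = (-1 : ℤ) ^ p • v := by
  rcases Nat.even_or_odd p with h' | h' <;> simp [h'.neg_one_pow]

theorem IsPair.mulPair {p q : ℕ} {P Q : SuperEnd (V := V) 𝕜 Fp Ep Fm Em × SuperEnd (V := V) 𝕜 Fp Ep Fm Em}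
    (hP : IsPair p P) (hQ : IsPair q Q) : IsPair (p + q) (mulPair p P Q) := by
  refine ⟨?_, ?_⟩
  · rw [PrimitiveChernWeil.mulPair, actOp_mulEnd]
    exact hP.1.mul hQ.1
  · rw [PrimitiveChernWeil.mulPair, actOp_add, actOp_smul, actOp_mulEnd, actOp_mulEnd]
    exact ((hP.2.mul hQ.1).congr ⟨p + q + 1, by omega⟩).add ((hP.1.mul hQ.2).smul _)

theorem pairOp_mulPair {p q : ℕ} {P Q : SuperEnd (V := V) 𝕜 Fp Ep Fm Em × SuperEnd (V := V) 𝕜 Fp Ep Fm Em}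
    (hP : IsPair p P) (hQ : IsPair q Q) : pairOp (mulPair p P Q) = pairOp P * pairOp Q := by
  refine LinearMap.ext fun w => ?_
  obtain ⟨α, β⟩ := w
  rw [pairOp_apply (hP.mulPair hQ), Module.End.mul_apply, pairOp_apply hQ, pairOp_apply hP,
    mulPair, actOp_add, actOp_smul, actOp_mulEnd, actOp_mulEnd, actOp_mulEnd]
  refine Prod.ext rfl ?_
  simp only [LinearMap.add_apply, LinearMap.smul_apply, Module.End.mul_apply, map_add, smul_add,
    map_zsmul, neg_one_pow_smul_eq_zsmul, smul_smul, pow_add]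
  abel

/-- The operator `X` on `Ω(M, E) ⊕ Ω(M, E)` is identified with a pair of parity `p`. -/
def IsPairOp (p : ℕ)
    (X : Module.End 𝕜 (SuperForm (V := V) 𝕜 Fp Ep Fm Em × SuperForm (V := V) 𝕜 Fp Ep Fm Em)) : Prop :=
  ∃ P, IsPair p P ∧ pairOp P = X

theorem pairOp_add (P Q : SuperEnd (V := V) 𝕜 Fp Ep Fm Em × SuperEnd (V := V) 𝕜 Fp Ep Fm Em) :
    pairOp (P + Q) = pairOp P + pairOp Q := by
  refine LinearMap.ext fun w => ?_
  change (actOp (P.1 + Q.1) w.1, actOp (P.2 + Q.2) w.1 + parity (actOp (P.1 + Q.1) (parity w.2))) =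
    (actOp P.1 w.1 + actOp Q.1 w.1, (actOp P.2 w.1 + parity (actOp P.1 (parity w.2))) +
      (actOp Q.2 w.1 + parity (actOp Q.1 (parity w.2))))
  rw [actOp_add, actOp_add, LinearMap.add_apply, LinearMap.add_apply, LinearMap.add_apply, map_add,
    add_add_add_comm]

theorem pairOp_smul (c : 𝕜) (P : SuperEnd (V := V) 𝕜 Fp Ep Fm Em × SuperEnd (V := V) 𝕜 Fp Ep Fm Em) :
    pairOp (c • P) = c • pairOp P := by
  refine LinearMap.ext fun w => ?_
  change (actOp (c • P.1) w.1, actOp (c • P.2) w.1 + parity (actOp (c • P.1) (parity w.2))) =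
    (c • actOp P.1 w.1, c • (actOp P.2 w.1 + parity (actOp P.1 (parity w.2))))
  rw [actOp_smul, actOp_smul, LinearMap.smul_apply, LinearMap.smul_apply, LinearMap.smul_apply,
    map_smul, smul_add]

section PairOps

variable {X Y : Module.End 𝕜 (SuperForm (V := V) 𝕜 Fp Ep Fm Em × SuperForm (V := V) 𝕜 Fp Ep Fm Em)}
  {p q : ℕ}

theorem IsPair.add {P Q : SuperEnd (V := V) 𝕜 Fp Ep Fm Em × SuperEnd (V := V) 𝕜 Fp Ep Fm Em}
    (hP : IsPair p P) (hQ : IsPair p Q) : IsPair p (P + Q) := by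
  refine ⟨?_, ?_⟩
  · rw [Prod.fst_add, actOp_add]
    exact hP.1.add hQ.1
  · rw [Prod.snd_add, actOp_add]
    exact hP.2.add hQ.2

theorem IsPair.smul (c : 𝕜) {P : SuperEnd (V := V) 𝕜 Fp Ep Fm Em × SuperEnd (V := V) 𝕜 Fp Ep Fm Em}
    (hP : IsPair p P) : IsPair p (c • P) := by
  refine ⟨?_, ?_⟩
  · rw [Prod.smul_fst, actOp_smul]
    exact hP.1.smul c
  · rw [Prod.smul_snd, actOp_smul]
    exact hP.2.smul c

theorem IsPairOp.add (hX : IsPairOp p X) (hY : IsPairOp p Y) : IsPairOp p (X + Y) := by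
  obtain ⟨P, hP, rfl⟩ := hX
  obtain ⟨Q, hQ, rfl⟩ := hY
  exact ⟨P + Q, hP.add hQ, pairOp_add P Q⟩

theorem IsPairOp.smul (c : 𝕜) (hX : IsPairOp p X) : IsPairOp p (c • X) := by
  obtain ⟨P, hP, rfl⟩ := hX
  exact ⟨c • P, hP.smul c, pairOp_smul c P⟩

theorem IsPairOp.mul (hX : IsPairOp p X) (hY : IsPairOp q Y) : IsPairOp (p + q) (X * Y) := by
  obtain ⟨P, hP, rfl⟩ := hX
  obtain ⟨Q, hQ, rfl⟩ := hY
  exact ⟨_, hP.mulPair hQ, pairOp_mulPair hP hQ⟩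

theorem isPairOp_one : IsPairOp 0
    (1 : Module.End 𝕜 (SuperForm (V := V) 𝕜 Fp Ep Fm Em × SuperForm (V := V) 𝕜 Fp Ep Fm Em)) := by
  obtain ⟨T, hT⟩ := (isLeibniz_one (𝕜 := 𝕜) (V := V) (Fp := Fp) (Ep := Ep) (Fm := Fm)
    (Em := Em)).exists_actOp_eq
  have hP : IsPair 0 (T, 0) := by
    refine ⟨?_, ?_⟩
    · rw [hT]
      exact isLeibniz_one
    · rw [actOp_zero]
      exact ⟨fun α θ => by simp, fun q θ hθ y n v => by
        change grading (P := Ep y) (N := Em y) 𝕜 0 = (-1 : ℝ) ^ (q + (0 + 1) + n) • (0 : Ep y × Em y)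
        rw [map_zero, smul_zero]⟩
  refine ⟨_, hP, LinearMap.ext fun w => ?_⟩
  obtain ⟨α, β⟩ := w
  rw [pairOp_apply hP, hT, actOp_zero]
  simp

theorem IsPairOp.pow (hX : IsPairOp 0 X) (k : ℕ) : IsPairOp 0 (X ^ k) := by
  induction k with
  | zero =>
    rw [pow_zero]
    exact isPairOp_one
  | succ k ih =>
    rw [pow_succ]
    exact ih.mul hX

theorem pairStr_add (hX : IsPairOp p X) (hY : IsPairOp p Y) :
    pairStr (X + Y) = pairStr X + pairStr Y := by
  obtain ⟨P, -, rfl⟩ := hX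
  obtain ⟨Q, -, rfl⟩ := hY
  rw [← pairOp_add, pairStr_pairOp, pairStr_pairOp, pairStr_pairOp]
  exact Prod.ext (Str_add _ _) (Str_add _ _)

/-- The supertrace is cyclic on operators that are identified with even pairs. -/
theorem pairStr_mul_comm (hX : IsPairOp 0 X) (hY : IsPairOp 0 Y) : pairStr (X * Y) = pairStr (Y * X) := by
  obtain ⟨P, hP, rfl⟩ := hX
  obtain ⟨Q, hQ, rfl⟩ := hY
  rw [← pairOp_mulPair hP hQ, ← pairOp_mulPair hQ hP, pairStr_pairOp, pairStr_pairOp]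
  refine Prod.ext ?_ ?_
  · refine (Str_mulEnd_comm hP.1 hQ.1).trans ?_
    rw [zero_mul, pow_zero, one_smul]
    rfl
  · change Str (mulEnd P.2 Q.1 + (-1 : 𝕜) ^ 0 • mulEnd P.1 Q.2) =
      Str (mulEnd Q.2 P.1 + (-1 : 𝕜) ^ 0 • mulEnd Q.1 P.2)
    rw [pow_zero, one_smul, one_smul, Str_add, Str_add, Str_mulEnd_comm hP.2 hQ.1,
      Str_mulEnd_comm hP.1 hQ.2, mul_zero, zero_mul, pow_zero, one_smul, one_smul, add_comm]

end PairOps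

/-! ### Primitive superconnections -/

theorem actOp_sub (S T : SuperEnd (V := V) 𝕜 Fp Ep Fm Em) : actOp (S - T) = actOp S - actOp T :=
  map_sub (AddMonoidHom.mk' (actOp (V := V) (𝕜 := 𝕜) (Fp := Fp) (Ep := Ep) (Fm := Fm) (Em := Em))
    actOp_add) S T

theorem actOp_neg (T : SuperEnd (V := V) 𝕜 Fp Ep Fm Em) : actOp (-T) = -actOp T :=
  map_neg (AddMonoidHom.mk' (actOp (V := V) (𝕜 := 𝕜) (Fp := Fp) (Ep := Ep) (Fm := Fm) (Em := Em))
    actOp_add) T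

theorem Str_sub (S T : SuperEnd (V := V) 𝕜 Fp Ep Fm Em) : Str (S - T) = Str S - Str T :=
  map_sub (AddMonoidHom.mk' (Str (V := V) (𝕜 := 𝕜) (Fp := Fp) (Ep := Ep) (Fm := Fm) (Em := Em))
    Str_add) S T

theorem Str_neg (T : SuperEnd (V := V) 𝕜 Fp Ep Fm Em) : Str (-T) = -Str T :=
  map_neg (AddMonoidHom.mk' (Str (V := V) (𝕜 := 𝕜) (Fp := Fp) (Ep := Ep) (Fm := Fm) (Em := Em))
    Str_add) T

theorem Str_sub_sub_of_eq {S T : SuperEnd (V := V) 𝕜 Fp Ep Fm Em} (h : Str S = Str T)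
    (R : SuperEnd (V := V) 𝕜 Fp Ep Fm Em) : Str (S - T - R) = -Str R :=
  (Str_sub (S - T) R).trans ((congrArg (· - Str R) ((Str_sub S T).trans (sub_eq_zero.2 h))).trans
    (zero_sub _))

section Blocks

variable {N : Type*} [AddCommGroup N] [Module 𝕜 N]

/-- The operator `(α, β) ↦ (D α, D' α + ε D β)`. -/
def blockOp (ε : ℤ) (D D' : Module.End 𝕜 N) : Module.End 𝕜 (N × N) :=
  (D ∘ₗ LinearMap.fst 𝕜 N N).prod (D' ∘ₗ LinearMap.fst 𝕜 N N + (ε • D) ∘ₗ LinearMap.snd 𝕜 N N)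

/-- The operator `(α, β) ↦ (A α + w β, B α - A β)`. -/
def connOp (A w B : Module.End 𝕜 N) : Module.End 𝕜 (N × N) :=
  (A ∘ₗ LinearMap.fst 𝕜 N N + w ∘ₗ LinearMap.snd 𝕜 N N).prod
    (B ∘ₗ LinearMap.fst 𝕜 N N - A ∘ₗ LinearMap.snd 𝕜 N N)

theorem blockOp_apply (ε : ℤ) (D D' : Module.End 𝕜 N) (α β : N) :
    blockOp ε D D' (α, β) = (D α, D' α + ε • D β) := rfl

theorem connOp_apply (A w B : Module.End 𝕜 N) (α β : N) :
    connOp A w B (α, β) = (A α + w β, B α - A β) := rfl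

variable {A w B : Module.End 𝕜 N}

/-- The square of a primitive superconnection, written as an even block operator. -/
theorem connOp_sq (hA : A * w = w * A) (hB : B * w = w * B) :
    connOp A w B ^ 2 = blockOp ((-1) ^ 0) (A * A + w * B) (-(A * B - (-1 : ℤ) ^ 0 • (B * A))) := by
  have hA' : ∀ x, A (w x) = w (A x) := LinearMap.congr_fun hA
  have hB' : ∀ x, B (w x) = w (B x) := LinearMap.congr_fun hB
  refine LinearMap.ext fun z => ?_
  obtain ⟨α, β⟩ := z
  rw [pow_two, Module.End.mul_apply]
  simp only [connOp_apply, blockOp_apply, map_add, map_sub, LinearMap.add_apply, LinearMap.neg_apply,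
    LinearMap.sub_apply, Module.End.mul_apply, pow_zero, one_smul, hA', hB']
  refine Prod.ext ?_ ?_
  · change _ + _ = _ + _
    abel
  · change _ - _ = _ + _
    abel

/-- The supercommutator of a primitive superconnection with an odd block operator, in terms of
supercommutators with `A` (which are tensorial) and of commutators with `B`. -/
theorem connOp_anticommutator {C C' : Module.End 𝕜 N} (hC : C * w = w * C) (hC' : C' * w = w * C') :
    connOp A w B * blockOp ((-1) ^ 1) C C' + blockOp ((-1) ^ 1) C C' * connOp A w B =
      blockOp ((-1) ^ 0) (A * C - (-1 : ℤ) ^ 1 • (C * A) + w * C')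
        (B * C - C * B - (A * C' - (-1 : ℤ) ^ 2 • (C' * A))) := by
  have hC1 : ∀ x, C (w x) = w (C x) := LinearMap.congr_fun hC
  have hC1' : ∀ x, C' (w x) = w (C' x) := LinearMap.congr_fun hC'
  refine LinearMap.ext fun z => ?_
  obtain ⟨α, β⟩ := z
  rw [LinearMap.add_apply, Module.End.mul_apply, Module.End.mul_apply]
  simp only [connOp_apply, blockOp_apply, map_add, map_sub, LinearMap.add_apply, LinearMap.neg_apply,
    LinearMap.sub_apply, Module.End.mul_apply, pow_zero, pow_one, one_smul, neg_smul, map_neg,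
    even_two.neg_one_pow, hC1, hC1']
  refine Prod.ext ?_ ?_
  · change _ + _ + (_ + _) = _ + _
    abel
  · change _ - _ + (_ + _) = _ + _
    abel

/-- If an even block operator commutes with a primitive superconnection, the supercommutators of its
entries with `A` are given by the endomorphism-valued forms `w` and `B`. -/
theorem of_connOp_commute {D G : Module.End 𝕜 N}
    (h : connOp A w B * blockOp ((-1) ^ 0) D G = blockOp ((-1) ^ 0) D G * connOp A w B) :
    -(w * G) = A * D - (-1 : ℤ) ^ 0 • (D * A) ∧ B * D - D * B = A * G - (-1 : ℤ) ^ 1 • (G * A) := by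
  have e : ∀ α, (A (D α) + w (G α), B (D α) - A (G α)) = (D (A α), G (A α) + D (B α)) := fun α => by
    have := LinearMap.congr_fun h (α, 0)
    rw [Module.End.mul_apply, Module.End.mul_apply] at this
    simpa only [connOp_apply, blockOp_apply, map_zero, smul_zero, add_zero, sub_zero, pow_zero,
      one_smul] using this
  refine ⟨LinearMap.ext fun α => ?_, LinearMap.ext fun α => ?_⟩
  · have := congrArg Prod.fst (e α)
    simp only [LinearMap.neg_apply, LinearMap.sub_apply, Module.End.mul_apply, pow_zero,
      one_smul] at this ⊢
    rw [← this]
    abel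
  · have := congrArg Prod.snd (e α)
    simp only [LinearMap.sub_apply, Module.End.mul_apply, pow_one, neg_smul, one_smul,
      sub_neg_eq_add] at this ⊢
    rw [sub_eq_iff_eq_add] at this ⊢
    rw [this, LinearMap.add_apply, Module.End.mul_apply, Module.End.mul_apply]
    abel

end Blocks

theorem IsPair.pairOp_eq {p : ℕ}
    {P : SuperEnd (V := V) 𝕜 Fp Ep Fm Em × SuperEnd (V := V) 𝕜 Fp Ep Fm Em} (hP : IsPair p P)
    {D D' : Module.End 𝕜 (SuperForm (V := V) 𝕜 Fp Ep Fm Em)} (h : actOp P.1 = D)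
    (h' : actOp P.2 = D') : pairOp P = blockOp ((-1) ^ p) D D' := by
  subst h h'
  exact LinearMap.ext fun z => pairOp_apply hP z.1 z.2

theorem IsLeibniz.neg {p : ℕ} {Φ : Module.End 𝕜 (SuperForm (V := V) 𝕜 Fp Ep Fm Em)}
    (hΦ : IsLeibniz 0 p Φ) : IsLeibniz 0 p (-Φ) := by
  have e : -Φ = (-1 : 𝕜) • Φ := LinearMap.ext fun θ => (neg_one_smul 𝕜 (Φ θ)).symm
  rw [e]
  exact hΦ.smul (-1)

theorem IsLeibniz.sub {p : ℕ} {Φ Ψ : Module.End 𝕜 (SuperForm (V := V) 𝕜 Fp Ep Fm Em)}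
    (hΦ : IsLeibniz 0 p Φ) (hΨ : IsLeibniz 0 p Ψ) : IsLeibniz 0 p (Φ - Ψ) := by
  have e : Φ - Ψ = Φ + -Ψ := LinearMap.ext fun θ => sub_eq_add_neg _ _
  rw [e]
  exact hΦ.add hΨ.neg

/-- Exterior multiplication by the symplectic form is the action of an even endomorphism-valued
form. -/
theorem exists_actOp_eq_wedgeLeft (σ : SymplecticForm V M) :
    ∃ T : SuperEnd (V := V) 𝕜 Fp Ep Fm Em, actOp T = wedgeLeft (σ.toScalarForm 𝕜) ∧
      IsLeibniz 0 0 (actOp T) ∧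
      ∀ S, (Str (mulEnd T S)).1 = wedge (σ.toScalarForm 𝕜).1 (Str S).1 := by
  let T : SuperEnd (V := V) 𝕜 Fp Ep Fm Em :=
    ⟨fun x => scalarEndAt (P := Ep x) (Q := Em x) ((σ.toScalarForm 𝕜).1 x), fun n X s =>
      contMDiff_smul_section 𝕜 ((σ.toScalarForm 𝕜).2 n X) s.contMDiff⟩
  refine ⟨T, ?_, isLeibniz_actOp fun y n v => ?_, fun S => funext fun y => ?_⟩
  · exact LinearMap.ext fun θ => Subtype.ext (funext fun y => actAt_scalarEndAt _ _)
  · have h : (-1 : ℝ) ^ (0 + n) • (σ.toScalarForm 𝕜).1 y n v = (σ.toScalarForm 𝕜).1 y n v := by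
      have := congrArg (fun f => f n v) (sgn_toScalarForm (𝕜 := 𝕜) σ 1 y)
      have e : (-1 : ℝ) ^ (0 + n) = (-1) ^ (1 * n) := by rw [zero_add, one_mul]
      rw [e]
      exact this
    have h1 : (grading 𝕜 * grading 𝕜 : Module.End 𝕜 (Ep y × Em y)) = 1 := grading_mul_self
    change grading 𝕜 * ((σ.toScalarForm 𝕜).1 y n v • (1 : Module.End 𝕜 (Ep y × Em y))) * grading 𝕜 =
      (-1 : ℝ) ^ (0 + n) • ((σ.toScalarForm 𝕜).1 y n v • (1 : Module.End 𝕜 (Ep y × Em y)))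
    rw [← smul_assoc, h, mul_smul_comm, smul_mul_assoc, mul_one, h1]
  · have := finiteDimensional_fibre 𝕜 Fp Ep y
    have := finiteDimensional_fibre 𝕜 Fm Em y
    exact (congrArg strAt (mulAt_scalarEndAt _ (S.1 y))).trans (strAt_wedgeAt _ (S.1 y))

namespace PrimitiveSuperconnection

variable (𝔸 : PrimitiveSuperconnection 𝕜 V Fp Ep Fm Em) (σ : SymplecticForm V M)

theorem isLeibniz_endo : IsLeibniz 0 0 (actOp 𝔸.endo) :=
  isLeibniz_actOp fun y => (hasEndParity_iff 0 _).2 fun n v => by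
    rw [zero_add]
    exact 𝔸.even_endo y n v

/-- A superconnection commutes with the symplectic form, which is closed and even. -/
theorem conn_mul_wedgeLeft :
    𝔸.conn.op * wedgeLeft (σ.toScalarForm 𝕜) = wedgeLeft (σ.toScalarForm 𝕜) * 𝔸.conn.op := by
  have h1 : dForm (σ.toScalarForm 𝕜) = 0 := Subtype.ext (d_toScalarForm σ)
  have h2 : sgnForm 1 (σ.toScalarForm 𝕜) = σ.toScalarForm 𝕜 :=
    Subtype.ext (funext fun y => sgn_toScalarForm σ 1 y)
  refine LinearMap.ext fun θ => (𝔸.conn.isLeibniz.map_wedge _ θ).trans ?_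
  rw [h1, h2, wedgeLeft_zero_left, smul_zero, zero_add]
  rfl

theorem _root_.PrimitiveChernWeil.IsLeibniz.mul_wedgeLeft {p : ℕ}
    {Φ : Module.End 𝕜 (SuperForm (V := V) 𝕜 Fp Ep Fm Em)} (h : IsLeibniz 0 p Φ) :
    Φ * wedgeLeft (σ.toScalarForm 𝕜) = wedgeLeft (σ.toScalarForm 𝕜) * Φ := by
  have h2 : sgnForm p (σ.toScalarForm 𝕜) = σ.toScalarForm 𝕜 :=
    Subtype.ext (funext fun y => sgn_toScalarForm σ p y)
  refine LinearMap.ext fun θ => (h.map_wedge _ θ).trans ?_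
  rw [h2, zero_smul, zero_add]
  rfl

theorem op_eq : 𝔸.op σ =
    connOp 𝔸.conn.op (wedgeLeft (σ.toScalarForm 𝕜)) (actOp 𝔸.endo) := rfl

/-- The square of a primitive superconnection is identified with an even pair. -/
theorem isPairOp_op_sq : IsPairOp 0 (𝔸.op σ ^ 2) := by
  obtain ⟨Ω, hΩ, hΩ', -⟩ := exists_actOp_eq_wedgeLeft (𝕜 := 𝕜) (Fp := Fp) (Ep := Ep) (Fm := Fm)
    (Em := Em) σ
  have hB := 𝔸.isLeibniz_endo
  have hS := 𝔸.conn.isLeibniz.sq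
  have hR := 𝔸.conn.isLeibniz.supercommutator hB
  obtain ⟨S, eS⟩ := hS.exists_actOp_eq
  obtain ⟨R, eR⟩ := hR.exists_actOp_eq
  have e1 : actOp (S + mulEnd Ω 𝔸.endo) =
      𝔸.conn.op * 𝔸.conn.op + wedgeLeft (σ.toScalarForm 𝕜) * actOp 𝔸.endo := by
    rw [actOp_add, actOp_mulEnd, eS, hΩ]
  have e2 : actOp (-R) = -(𝔸.conn.op * actOp 𝔸.endo - (-1 : ℤ) ^ 0 • (actOp 𝔸.endo * 𝔸.conn.op)) := by
    rw [actOp_neg, eR]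
  have hP : IsPair 0 (S + mulEnd Ω 𝔸.endo, -R) := by
    refine ⟨?_, ?_⟩
    · rw [actOp_add, actOp_mulEnd, eS]
      exact (hS.congr (by decide)).add (hΩ'.mul hB)
    · rw [actOp_neg, eR]
      exact hR.neg
  refine ⟨_, hP, (hP.pairOp_eq e1 e2).trans ?_⟩
  rw [op_eq]
  exact (connOp_sq (𝔸.conn_mul_wedgeLeft σ) (hB.mul_wedgeLeft σ)).symm

set_option maxHeartbeats 800000 in
/-- The supercommutator of a primitive superconnection with an odd pair is identified with an even
pair, whose supertrace is a boundary. -/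
theorem isPairOp_anticommutator {X : Module.End 𝕜 (SuperForm (V := V) 𝕜 Fp Ep Fm Em ×
    SuperForm (V := V) 𝕜 Fp Ep Fm Em)} (hX : IsPairOp 1 X) :
    IsPairOp 0 (𝔸.op σ * X + X * 𝔸.op σ) ∧
      ((pairStr (𝔸.op σ * X + X * 𝔸.op σ)).1.1, (pairStr (𝔸.op σ * X + X * 𝔸.op σ)).2.1) =
        boundary σ (pairStr X) := by
  obtain ⟨⟨C, C'⟩, hC, rfl⟩ := hX
  obtain ⟨Ω, hΩ, hΩ', hΩS⟩ := exists_actOp_eq_wedgeLeft (𝕜 := 𝕜) (Fp := Fp) (Ep := Ep) (Fm := Fm)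
    (Em := Em) σ
  have hA := 𝔸.conn.isLeibniz
  have hB := 𝔸.isLeibniz_endo
  have h1 : IsLeibniz 0 1 (actOp C) := hC.1
  have h2 : IsLeibniz 0 2 (actOp C') := hC.2
  have hR := hA.supercommutator h1
  have hR' := hA.supercommutator h2
  obtain ⟨R, eR⟩ := hR.exists_actOp_eq
  obtain ⟨R', eR'⟩ := hR'.exists_actOp_eq
  have e1 : actOp (R + mulEnd Ω C') = 𝔸.conn.op * actOp C - (-1 : ℤ) ^ 1 • (actOp C * 𝔸.conn.op) +
      wedgeLeft (σ.toScalarForm 𝕜) * actOp C' := by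
    rw [actOp_add, actOp_mulEnd, eR, hΩ]
  have e2 : actOp (mulEnd 𝔸.endo C - mulEnd C 𝔸.endo - R') =
      actOp 𝔸.endo * actOp C - actOp C * actOp 𝔸.endo -
        (𝔸.conn.op * actOp C' - (-1 : ℤ) ^ 2 • (actOp C' * 𝔸.conn.op)) := by
    rw [actOp_sub, actOp_sub, actOp_mulEnd, actOp_mulEnd, eR']
  have hP : IsPair 0 (R + mulEnd Ω C', mulEnd 𝔸.endo C - mulEnd C 𝔸.endo - R') := by
    refine ⟨?_, ?_⟩
    · rw [actOp_add, actOp_mulEnd, eR]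
      exact (hR.congr (by decide)).add ((hΩ'.mul h2).congr (by decide))
    · rw [e2]
      exact ((hB.mul h1).sub (h1.mul hB)).sub (hR'.congr (by decide))
  have e : pairOp (R + mulEnd Ω C', mulEnd 𝔸.endo C - mulEnd C 𝔸.endo - R') =
      𝔸.op σ * pairOp (C, C') + pairOp (C, C') * 𝔸.op σ := by
    rw [hP.pairOp_eq e1 e2, hC.pairOp_eq rfl rfl, op_eq]
    exact (connOp_anticommutator (h1.mul_wedgeLeft σ) (h2.mul_wedgeLeft σ)).symm
  refine ⟨⟨_, hP, e⟩, ?_⟩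
  rw [← e, pairStr_pairOp, pairStr_pairOp]
  refine Prod.ext ?_ ?_
  · change (Str (R + mulEnd Ω C')).1 = d (Str C).1 + wedge (σ.toScalarForm 𝕜).1 (Str C').1
    rw [Str_add, ← hΩS, ← Str_supercommutator hA h1 eR]
    rfl
  · have e3 : Str (mulEnd 𝔸.endo C) = Str (mulEnd C 𝔸.endo) :=
      (Str_mulEnd_comm hB h1).trans (by rw [zero_mul, pow_zero, one_smul])
    exact (congrArg Subtype.val (Str_sub_sub_of_eq e3 R')).trans
      (congrArg Neg.neg (Str_supercommutator hA h2 eR'))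

/-- The supertrace of an even pair that commutes with a primitive superconnection is closed. -/
theorem boundary_pairStr_eq_zero {X : Module.End 𝕜 (SuperForm (V := V) 𝕜 Fp Ep Fm Em ×
    SuperForm (V := V) 𝕜 Fp Ep Fm Em)} (hX : IsPairOp 0 X) (h : 𝔸.op σ * X = X * 𝔸.op σ) :
    boundary σ (pairStr X) = 0 := by
  obtain ⟨⟨D, G⟩, hD, rfl⟩ := hX
  obtain ⟨Ω, hΩ, hΩ', hΩS⟩ := exists_actOp_eq_wedgeLeft (𝕜 := 𝕜) (Fp := Fp) (Ep := Ep) (Fm := Fm)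
    (Em := Em) σ
  have hA := 𝔸.conn.isLeibniz
  have hB := 𝔸.isLeibniz_endo
  have h1 : IsLeibniz 0 0 (actOp D) := hD.1
  have h2 : IsLeibniz 0 1 (actOp G) := hD.2
  have e0 := hD.pairOp_eq rfl rfl
  rw [e0, op_eq] at h
  obtain ⟨e1, e2⟩ := of_connOp_commute h
  have e1' : actOp (-mulEnd Ω G) = 𝔸.conn.op * actOp D - (-1 : ℤ) ^ 0 • (actOp D * 𝔸.conn.op) := by
    rw [actOp_neg, actOp_mulEnd, hΩ]
    exact e1
  have e2' : actOp (mulEnd 𝔸.endo D - mulEnd D 𝔸.endo) =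
      𝔸.conn.op * actOp G - (-1 : ℤ) ^ 1 • (actOp G * 𝔸.conn.op) := by
    rw [actOp_sub, actOp_mulEnd, actOp_mulEnd]
    exact e2
  rw [pairStr_pairOp]
  refine Prod.ext ?_ ?_
  · change d (Str D).1 + wedge (σ.toScalarForm 𝕜).1 (Str G).1 = 0
    rw [← hΩS, ← Str_supercommutator hA h1 e1', Str_neg]
    exact neg_add_cancel _
  · change - d (Str G).1 = 0
    rw [← Str_supercommutator hA h2 e2', Str_sub, Str_mulEnd_comm hB h1, zero_mul, pow_zero, one_smul,
      sub_self]
    exact neg_zero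

end PrimitiveSuperconnection

/-! ### Traces of polynomials in an abstract setting -/

section Abstract

open Polynomial

variable {R N : Type*} [Semiring R] [Algebra 𝕜 R]

theorem aeval_mem_subalgebra {E : Subalgebra 𝕜 R} {X : R} (hX : X ∈ E) (f : 𝕜[X]) :
    aeval X f ∈ E := by
  have h : aeval X f = E.val (aeval (⟨X, hX⟩ : E) f) := aeval_algHom_apply E.val (⟨X, hX⟩ : E) f
  rw [h]
  exact (aeval (⟨X, hX⟩ : E) f).2

theorem commute_aeval {X Y : R} (h : Commute Y X) (f : 𝕜[X]) : Commute Y (aeval X f) := by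
  induction f using Polynomial.induction_on' with
  | add f g hf hg =>
    rw [map_add]
    exact hf.add_right hg
  | monomial n a =>
    rw [aeval_monomial]
    exact (Algebra.commute_algebraMap_right a Y).mul_right (h.pow_right n)

/-- Let `X` be a family in an algebra with derivative `Y` at `t`, for a notion `H` of
differentiability at `t` that satisfies the product rule. Then `f(X)` has a derivative, and under a
trace `τ` on a subalgebra `E` it may be replaced by `Y f'(X)`. For the induction on `f` this is
proved in the presence of a factor `Z` that commutes with `X`. -/
theorem exists_deriv_aeval [Add N] {E : Subalgebra 𝕜 R} {τ : R → N}
    (hadd : ∀ X ∈ E, ∀ Y ∈ E, τ (X + Y) = τ X + τ Y)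
    (hmul : ∀ X ∈ E, ∀ Y ∈ E, τ (X * Y) = τ (Y * X)) {t : ℝ} {H : (ℝ → R) → R → Prop}
    (hmem : ∀ X X', H X X' → X' ∈ E) (hconst : ∀ c : 𝕜, H (fun _ => algebraMap 𝕜 R c) 0)
    (hsum : ∀ X X' Y Y', H X X' → H Y Y' → H (fun s => X s + Y s) (X' + Y'))
    (hprod : ∀ X X' Y Y', H X X' → H Y Y' → H (fun s => X s * Y s) (X' * Y t + X t * Y'))
    {X : ℝ → R} (hX : X t ∈ E) {Y : R} (h : H X Y) (f : 𝕜[X]) :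
    ∃ D, H (fun s => aeval (X s) f) D ∧ ∀ Z ∈ E, Z * X t = X t * Z →
      τ (Z * D) = τ (Z * (Y * aeval (X t) (derivative f))) := by
  have hY := hmem _ _ h
  induction f using Polynomial.induction_on with
  | C a =>
    refine ⟨0, ?_, fun Z _ _ => ?_⟩
    · simpa only [aeval_C] using hconst a
    · rw [derivative_C, map_zero, mul_zero, mul_zero, mul_zero]
  | add f g hf hg =>
    obtain ⟨D, hD, hD'⟩ := hf
    obtain ⟨D₁, hD₁, hD₁'⟩ := hg
    refine ⟨D + D₁, ?_, fun Z hZ hc => ?_⟩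
    · simpa only [map_add] using hsum _ _ _ _ hD hD₁
    · rw [mul_add, hadd _ (E.mul_mem hZ (hmem _ _ hD)) _ (E.mul_mem hZ (hmem _ _ hD₁)), hD' Z hZ hc,
        hD₁' Z hZ hc, derivative_add, map_add, mul_add, mul_add, hadd]
      · exact E.mul_mem hZ (E.mul_mem hY (aeval_mem_subalgebra hX _))
      · exact E.mul_mem hZ (E.mul_mem hY (aeval_mem_subalgebra hX _))
  | monomial n a ih =>
    obtain ⟨D, hD, hD'⟩ := ih
    have hg := aeval_mem_subalgebra hX (C a * Polynomial.X ^ n)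
    have hg' := aeval_mem_subalgebra hX (derivative (C a * Polynomial.X ^ n))
    have hE : ∀ {P Q}, P ∈ E → Q ∈ E → P * Q ∈ E := fun hP hQ => E.mul_mem hP hQ
    refine ⟨D * X t + aeval (X t) (C a * Polynomial.X ^ n) * Y, ?_, fun Z hZ hc => ?_⟩
    · have := hprod _ _ _ _ hD h
      simpa only [← map_mul, pow_succ, ← mul_assoc, map_mul, aeval_X] using this
    · have hcg : Z * aeval (X t) (C a * Polynomial.X ^ n) =
          aeval (X t) (C a * Polynomial.X ^ n) * Z := commute_aeval hc _
      have hXZ : X t * Z * X t = X t * (X t * Z) := by rw [mul_assoc, hc]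
      -- By cyclicity the last factor `X t` moves to `Z`, where the induction hypothesis applies.
      have e1 : τ (Z * (D * X t)) =
          τ (Z * (Y * (aeval (X t) (derivative (C a * Polynomial.X ^ n)) * X t))) := by
        rw [← mul_assoc, hmul _ (hE hZ (hmem _ _ hD)) _ hX, ← mul_assoc, hD' _ (hE hX hZ) hXZ,
          mul_assoc, hmul _ hX _ (hE hZ (hE hY hg')), mul_assoc, mul_assoc]
      have e2 : τ (Z * (aeval (X t) (C a * Polynomial.X ^ n) * Y)) =
          τ (Z * (Y * aeval (X t) (C a * Polynomial.X ^ n))) := by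
        rw [← mul_assoc, hcg, mul_assoc, hmul _ hg _ (hE hZ hY), mul_assoc]
      have e3 : aeval (X t) (derivative (C a * Polynomial.X ^ (n + 1))) =
          aeval (X t) (derivative (C a * Polynomial.X ^ n)) * X t +
            aeval (X t) (C a * Polynomial.X ^ n) := by
        rw [pow_succ, ← mul_assoc, derivative_mul, derivative_X, mul_one, map_add, map_mul, aeval_X]
      rw [mul_add, hadd _ (hE hZ (hE (hmem _ _ hD) hX)) _ (hE hZ (hE hg hY)), e1, e2, e3, mul_add,
        mul_add, hadd _ (hE hZ (hE hY (hE hg' hX))) _ (hE hZ (hE hY hg))]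

/-- For a family `A` whose square has the derivative `A B + B A`, the derivative of `f(A²)` may under
a trace be replaced by the anticommutator of `A` with `B f'(A²)`, because `A` commutes with
`f'(A²)`. -/
theorem exists_deriv_aeval_sq [Add N] {E : Subalgebra 𝕜 R} {τ : R → N}
    (hadd : ∀ X ∈ E, ∀ Y ∈ E, τ (X + Y) = τ X + τ Y)
    (hmul : ∀ X ∈ E, ∀ Y ∈ E, τ (X * Y) = τ (Y * X)) {t : ℝ} {H : (ℝ → R) → R → Prop}
    (hmem : ∀ X X', H X X' → X' ∈ E) (hconst : ∀ c : 𝕜, H (fun _ => algebraMap 𝕜 R c) 0)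
    (hsum : ∀ X X' Y Y', H X X' → H Y Y' → H (fun s => X s + Y s) (X' + Y'))
    (hprod : ∀ X X' Y Y', H X X' → H Y Y' → H (fun s => X s * Y s) (X' * Y t + X t * Y'))
    {A : ℝ → R} {B : R} (hA : A t ^ 2 ∈ E) (h : H (fun s => A s ^ 2) (A t * B + B * A t)) (f : 𝕜[X]) :
    ∃ D, H (fun s => aeval (A s ^ 2) f) D ∧
      τ D = τ (A t * (B * aeval (A t ^ 2) (derivative f)) +
        B * aeval (A t ^ 2) (derivative f) * A t) := by
  obtain ⟨D, hD, hD'⟩ := exists_deriv_aeval hadd hmul hmem hconst hsum hprod hA h f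
  refine ⟨D, hD, ?_⟩
  have := hD' 1 (one_mem _) ((one_mul _).trans (mul_one _).symm)
  rw [one_mul, one_mul] at this
  have hc : Commute (A t) (aeval (A t ^ 2) (derivative f)) :=
    commute_aeval ((Commute.refl _).pow_right 2) _
  rw [this, add_mul, mul_assoc, mul_assoc, mul_assoc, hc.eq]

end Abstract

/-! ### Differentiable families of pairs -/

theorem HasLinDeriv.congr_deriv {N : Type*} [AddCommGroup N] [Module ℝ N] {g : ℝ → N} {g' g'' : N}
    {t : ℝ} (h : HasLinDeriv g g' t) (e : g' = g'') : HasLinDeriv g g'' t := e ▸ h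

theorem HasLinDeriv.sub {N : Type*} [AddCommGroup N] [Module ℝ N] {g f : ℝ → N} {g' f' : N} {t : ℝ}
    (hg : HasLinDeriv g g' t) (hf : HasLinDeriv f f' t) :
    HasLinDeriv (fun s => g s - f s) (g' - f') t := fun ℓ => by
  simpa only [map_sub] using (hg ℓ).fun_sub (hf ℓ)

theorem add_smul_add_add_smul {N : Type*} [AddCommGroup N] [Module 𝕜 N] (k : 𝕜) (a b c e : N) :
    a + k • b + (c + k • e) = a + c + k • (b + e) := by
  rw [smul_add, add_add_add_comm]

theorem add_sub_add_rotate {N : Type*} [AddCommGroup N] (a b c e : N) :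
    a + b - (c + e) = b - e + (a - c) := by abel

/-- The family `S` of `End E`-valued forms is differentiable at `t`, with derivative `S'`. -/
def HasEndDeriv (S : ℝ → SuperEnd (V := V) 𝕜 Fp Ep Fm Em) (S' : SuperEnd (V := V) 𝕜 Fp Ep Fm Em)
    (t : ℝ) : Prop :=
  ∀ (x : M) (n : ℕ) (v : Fin n → TangentSpace 𝓘(ℝ, V) x),
    HasLinDeriv (fun s => (S s).1 x n v) (S'.1 x n v) t

section HasEndDeriv

variable {S T : ℝ → SuperEnd (V := V) 𝕜 Fp Ep Fm Em} {S' T' : SuperEnd (V := V) 𝕜 Fp Ep Fm Em} {t : ℝ}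

theorem hasEndDeriv_const (S : SuperEnd (V := V) 𝕜 Fp Ep Fm Em) (t : ℝ) :
    HasEndDeriv (fun _ => S) 0 t := fun x n v => hasLinDeriv_const (S.1 x n v) t

theorem HasEndDeriv.add (hS : HasEndDeriv S S' t) (hT : HasEndDeriv T T' t) :
    HasEndDeriv (fun s => S s + T s) (S' + T') t := fun x n v => (hS x n v).add (hT x n v)

theorem HasEndDeriv.smul (c : 𝕜) (hS : HasEndDeriv S S' t) :
    HasEndDeriv (fun s => c • S s) (c • S') t := fun x n v =>
  (hS x n v).map ((LinearMap.lsmul 𝕜 (Module.End 𝕜 (Ep x × Em x)) c).restrictScalars ℝ)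

theorem HasEndDeriv.mulEnd (hS : HasEndDeriv S S' t) (hT : HasEndDeriv T T' t) :
    HasEndDeriv (fun s => PrimitiveChernWeil.mulEnd (S s) (T s))
      (PrimitiveChernWeil.mulEnd S' (T t) + PrimitiveChernWeil.mulEnd (S t) T') t := fun x n v => by
  have := finiteDimensional_fibre 𝕜 Fp Ep x
  have := finiteDimensional_fibre 𝕜 Fm Em x
  have := Module.Finite.trans (R := ℝ) 𝕜 (Module.End 𝕜 (Ep x × Em x))
  exact hasLinDeriv_wedgeWith (fun j => signedMul (𝕜 := 𝕜) (P := Ep x) (Q := Em x) j)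
    (fun n v => hS x n v) (fun n v => hT x n v) n v

/-- A family of `End E`-valued forms is differentiable if its action on every form is. -/
theorem hasEndDeriv_of_apply (h : ∀ θ x n (v : Fin n → TangentSpace 𝓘(ℝ, V) x),
    HasLinDeriv (fun s => (actOp (S s) θ).1 x n v) ((actOp S' θ).1 x n v) t) :
    HasEndDeriv S S' t := fun x n v => by
  have := finiteDimensional_fibre 𝕜 Fp Ep x
  have := finiteDimensional_fibre 𝕜 Fm Em x
  refine hasLinDeriv_end fun e => ?_
  obtain ⟨s, rfl⟩ := exists_section_apply_eq (V := V) (Fp × Fm) (W := Ep ×ᵇ Em) e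
  have := h (secForm 𝕜 s) x n v
  simpa only [actOp_secForm] using this

end HasEndDeriv

/-- The operators `X s` are identified with even pairs whose components are differentiable at `t`,
and the derivative of these pairs is identified with `X'`. -/
def HasPairDeriv
    (X : ℝ → Module.End 𝕜 (SuperForm (V := V) 𝕜 Fp Ep Fm Em × SuperForm (V := V) 𝕜 Fp Ep Fm Em))
    (X' : Module.End 𝕜 (SuperForm (V := V) 𝕜 Fp Ep Fm Em × SuperForm (V := V) 𝕜 Fp Ep Fm Em))
    (t : ℝ) : Prop :=
  ∃ (P : ℝ → SuperEnd (V := V) 𝕜 Fp Ep Fm Em × SuperEnd (V := V) 𝕜 Fp Ep Fm Em)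
    (P' : SuperEnd (V := V) 𝕜 Fp Ep Fm Em × SuperEnd (V := V) 𝕜 Fp Ep Fm Em),
    (∀ s, IsPair 0 (P s) ∧ pairOp (P s) = X s) ∧ (IsPair 0 P' ∧ pairOp P' = X') ∧
    HasEndDeriv (fun s => (P s).1) P'.1 t ∧ HasEndDeriv (fun s => (P s).2) P'.2 t

section HasPairDeriv

variable
  {X Y : ℝ → Module.End 𝕜 (SuperForm (V := V) 𝕜 Fp Ep Fm Em × SuperForm (V := V) 𝕜 Fp Ep Fm Em)}
  {X' Y' : Module.End 𝕜 (SuperForm (V := V) 𝕜 Fp Ep Fm Em × SuperForm (V := V) 𝕜 Fp Ep Fm Em)}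
  {t : ℝ}

theorem HasPairDeriv.isPairOp (h : HasPairDeriv X X' t) : IsPairOp 0 X' := by
  obtain ⟨P, P', -, h', -⟩ := h
  exact ⟨P', h'⟩

theorem IsPairOp.hasPairDeriv_const (h : IsPairOp 0 X') : HasPairDeriv (fun _ => X') 0 t := by
  obtain ⟨P, hP, rfl⟩ := h
  have e : (0 : 𝕜) • P = 0 := zero_smul 𝕜 P
  have e' : (0 : 𝕜) • pairOp P = 0 := zero_smul 𝕜 (pairOp P)
  refine ⟨fun _ => P, 0, fun _ => ⟨hP, rfl⟩, ⟨?_, ?_⟩, hasEndDeriv_const _ _, hasEndDeriv_const _ _⟩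
  · rw [← e]
    exact hP.smul 0
  · rw [← e, ← e', pairOp_smul]

theorem HasPairDeriv.add (hX : HasPairDeriv X X' t) (hY : HasPairDeriv Y Y' t) :
    HasPairDeriv (fun s => X s + Y s) (X' + Y') t := by
  obtain ⟨P, P', hP, ⟨hP', eP⟩, h1, h2⟩ := hX
  obtain ⟨Q, Q', hQ, ⟨hQ', eQ⟩, h1', h2'⟩ := hY
  refine ⟨fun s => P s + Q s, P' + Q', fun s => ⟨(hP s).1.add (hQ s).1, ?_⟩, ⟨hP'.add hQ', ?_⟩,
    h1.add h1', h2.add h2'⟩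
  · rw [pairOp_add, (hP s).2, (hQ s).2]
  · rw [pairOp_add, eP, eQ]

theorem HasPairDeriv.mul (hX : HasPairDeriv X X' t) (hY : HasPairDeriv Y Y' t) :
    HasPairDeriv (fun s => X s * Y s) (X' * Y t + X t * Y') t := by
  obtain ⟨P, P', hP, ⟨hP', eP⟩, h1, h2⟩ := hX
  obtain ⟨Q, Q', hQ, ⟨hQ', eQ⟩, h1', h2'⟩ := hY
  refine ⟨fun s => mulPair 0 (P s) (Q s), mulPair 0 P' (Q t) + mulPair 0 (P t) Q',
    fun s => ⟨(hP s).1.mulPair (hQ s).1, ?_⟩,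
    ⟨(hP'.mulPair (hQ t).1).add ((hP t).1.mulPair hQ'), ?_⟩, h1.mulEnd h1', ?_⟩
  · rw [pairOp_mulPair (hP s).1 (hQ s).1, (hP s).2, (hQ s).2]
  · rw [pairOp_add, pairOp_mulPair hP' (hQ t).1, pairOp_mulPair (hP t).1 hQ', (hP t).2, (hQ t).2, eP,
      eQ]
  · have h3 := (h2.mulEnd h1').add ((h1.mulEnd h2').smul ((-1) ^ 0))
    have e : (mulPair 0 P' (Q t) + mulPair 0 (P t) Q').2 =
        mulEnd P'.2 (Q t).1 + mulEnd (P t).2 Q'.1 +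
          (-1 : 𝕜) ^ 0 • (mulEnd P'.1 (Q t).2 + mulEnd (P t).1 Q'.2) :=
      add_smul_add_add_smul _ _ _ _ _
    rw [e]
    exact h3

/-- The supertrace of a differentiable family is differentiable. -/
theorem HasPairDeriv.hasDerivAt_pairStr (h : HasPairDeriv X X' t) (x : M) (n : ℕ)
    (v : Fin n → TangentSpace 𝓘(ℝ, V) x) :
    HasDerivAt (fun s => (pairStr (X s)).1.1 x n v) ((pairStr X').1.1 x n v) t ∧
      HasDerivAt (fun s => (pairStr (X s)).2.1 x n v) ((pairStr X').2.1 x n v) t := by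
  obtain ⟨P, P', hP, ⟨-, rfl⟩, h1, h2⟩ := h
  have e : X = fun s => pairOp (P s) := funext fun s => (hP s).2.symm
  subst e
  simp only [pairStr_pairOp]
  exact ⟨((h1 x n v).map (supertrace (P := Ep x) (N := Em x) 𝕜)).hasDerivAt,
    ((h2 x n v).map (supertrace (P := Ep x) (N := Em x) 𝕜)).hasDerivAt⟩

end HasPairDeriv

variable (𝕜 V Fp Ep Fm Em) in
/-- The algebra of the operators that are identified with even pairs. -/
def evenPairOps : Subalgebra 𝕜
    (Module.End 𝕜 (SuperForm (V := V) 𝕜 Fp Ep Fm Em × SuperForm (V := V) 𝕜 Fp Ep Fm Em)) where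
  carrier := {X | IsPairOp 0 X}
  mul_mem' hX hY := IsPairOp.mul hX hY
  add_mem' hX hY := IsPairOp.add hX hY
  algebraMap_mem' c := by
    rw [Algebra.algebraMap_eq_smul_one]
    exact isPairOp_one.smul c

/-! ### Smooth families of primitive superconnections -/

theorem connOp_anticommutator_apply {N : Type*} [AddCommGroup N] [Module 𝕜 N]
    (A w B C C' : Module.End 𝕜 N) (α : N) :
    (connOp A w B * blockOp ((-1) ^ 1) C C' + blockOp ((-1) ^ 1) C C' * connOp A w B) (α, 0) =
      (A (C α) + w (C' α) + C (A α), B (C α) - A (C' α) + (C' (A α) - C (B α))) := by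
  rw [LinearMap.add_apply, Module.End.mul_apply, Module.End.mul_apply]
  simp only [connOp_apply, blockOp_apply, map_zero, smul_zero, add_zero, sub_zero, pow_one, neg_smul,
    one_smul, ← sub_eq_add_neg]
  rfl

namespace IsSmoothPrimitiveFamily

variable {𝔸 : ℝ → PrimitiveSuperconnection 𝕜 V Fp Ep Fm Em} (h𝔸 : IsSmoothPrimitiveFamily 𝔸)
  (σ : SymplecticForm V M) (t : ℝ)

theorem deriv_eq : h𝔸.deriv t = blockOp ((-1) ^ 1) (opDeriv _ h𝔸.conn t) (opDeriv _ h𝔸.endo t) := by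
  refine LinearMap.ext fun z => Prod.ext rfl ?_
  change opDeriv _ h𝔸.endo t z.1 - opDeriv _ h𝔸.conn t z.2 =
    opDeriv _ h𝔸.endo t z.1 + (-1 : ℤ) ^ 1 • opDeriv _ h𝔸.conn t z.2
  rw [pow_one, neg_smul, one_smul, sub_eq_add_neg]

/-- The derivative of a smooth family of primitive superconnections is identified with an odd
pair. -/
theorem isPairOp_deriv : IsPairOp 1 (h𝔸.deriv t) := by
  have h1 := isLeibniz_opDeriv h𝔸.conn (fun s => (𝔸 s).conn.isLeibniz) t
  have h2 := isLeibniz_opDeriv h𝔸.endo (fun s => (𝔸 s).isLeibniz_endo) t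
  obtain ⟨C, hC⟩ := h1.exists_actOp_eq
  obtain ⟨C', hC'⟩ := h2.exists_actOp_eq
  have hP : IsPair 1 (C, C') := by
    refine ⟨?_, ?_⟩
    · rw [hC]
      exact h1
    · rw [hC']
      exact h2.congr (by decide)
  exact ⟨_, hP, (hP.pairOp_eq hC hC').trans (h𝔸.deriv_eq t).symm⟩

theorem op_sq_apply (s : ℝ) (θ : SuperForm (V := V) 𝕜 Fp Ep Fm Em) :
    ((𝔸 s).op σ ^ 2) (θ, 0) =
      ((𝔸 s).conn.op ((𝔸 s).conn.op θ) + wedgeLeft (σ.toScalarForm 𝕜) (actOp (𝔸 s).endo θ),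
        actOp (𝔸 s).endo ((𝔸 s).conn.op θ) - (𝔸 s).conn.op (actOp (𝔸 s).endo θ)) := by
  rw [pow_two, Module.End.mul_apply, PrimitiveSuperconnection.op_eq, connOp_apply, connOp_apply,
    map_zero, map_zero, add_zero, sub_zero]

theorem anticommutator_apply (θ : SuperForm (V := V) 𝕜 Fp Ep Fm Em) :
    ((𝔸 t).op σ * h𝔸.deriv t + h𝔸.deriv t * (𝔸 t).op σ) (θ, 0) =
      ((𝔸 t).conn.op (opDeriv _ h𝔸.conn t θ) + wedgeLeft (σ.toScalarForm 𝕜) (opDeriv _ h𝔸.endo t θ) +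
        opDeriv _ h𝔸.conn t ((𝔸 t).conn.op θ),
      (actOp (𝔸 t).endo (opDeriv _ h𝔸.conn t θ) - (𝔸 t).conn.op (opDeriv _ h𝔸.endo t θ)) +
        (opDeriv _ h𝔸.endo t ((𝔸 t).conn.op θ) - opDeriv _ h𝔸.conn t (actOp (𝔸 t).endo θ))) := by
  rw [deriv_eq, PrimitiveSuperconnection.op_eq]
  exact connOp_anticommutator_apply _ _ _ _ _ _

/-- The square of a smooth family of primitive superconnections is differentiable, with the
derivative `𝔸 𝔸̇ + 𝔸̇ 𝔸`. -/
theorem hasPairDeriv_op_sq : HasPairDeriv (fun s => (𝔸 s).op σ ^ 2)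
    ((𝔸 t).op σ * h𝔸.deriv t + h𝔸.deriv t * (𝔸 t).op σ) t := by
  choose P hP using fun s => (𝔸 s).isPairOp_op_sq σ
  obtain ⟨P', hP'⟩ := ((𝔸 t).isPairOp_anticommutator σ (h𝔸.isPairOp_deriv t)).1
  have hA := fun s => (𝔸 s).conn.isLeibniz
  have hB := fun s => (𝔸 s).isLeibniz_endo
  have e : ∀ s θ, (actOp (P s).1 θ, actOp (P s).2 θ) = _ := fun s θ =>
    (pairOp_apply_zero (P s) θ).symm.trans ((LinearMap.congr_fun (hP s).2 (θ, 0)).trans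
      (op_sq_apply σ s θ))
  have e' : ∀ θ, (actOp P'.1 θ, actOp P'.2 θ) = _ := fun θ =>
    (pairOp_apply_zero P' θ).symm.trans ((LinearMap.congr_fun hP'.2 (θ, 0)).trans
      (h𝔸.anticommutator_apply σ t θ))
  refine ⟨P, P', hP, hP', hasEndDeriv_of_apply fun θ x n v => ?_,
    hasEndDeriv_of_apply fun θ x n v => ?_⟩
  · have d1 := hasLinDeriv_apply h𝔸.conn hA (h𝔸.conn θ) (hasLinDeriv_opDeriv h𝔸.conn t θ) x n v
    have d2 := hasLinDeriv_wedgeAt_right ((σ.toScalarForm 𝕜).1 x)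
      (fun n v => hasLinDeriv_opDeriv h𝔸.endo t θ x n v) n v
    rw [show actOp P'.1 θ = _ from congrArg Prod.fst (e' θ)]
    refine ((d1.add d2).congr fun s => ?_).congr_deriv (add_rotate _ _ _)
    exact congrArg (fun θ : SuperForm (V := V) 𝕜 Fp Ep Fm Em => θ.1 x n v) (congrArg Prod.fst (e s θ))
  · have d1 := hasLinDeriv_apply h𝔸.endo hB (h𝔸.conn θ) (hasLinDeriv_opDeriv h𝔸.conn t θ) x n v
    have d2 := hasLinDeriv_apply h𝔸.conn hA (h𝔸.endo θ) (hasLinDeriv_opDeriv h𝔸.endo t θ) x n v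
    rw [show actOp P'.2 θ = _ from congrArg Prod.snd (e' θ)]
    refine ((d1.sub d2).congr fun s => ?_).congr_deriv (add_sub_add_rotate _ _ _ _)
    exact congrArg (fun θ : SuperForm (V := V) 𝕜 Fp Ep Fm Em => θ.1 x n v) (congrArg Prod.snd (e s θ))

end IsSmoothPrimitiveFamily

theorem IsLeibniz.isEvenEnd {T : SuperEnd (V := V) 𝕜 Fp Ep Fm Em} (h : IsLeibniz 0 0 (actOp T)) :
    IsEvenEnd T.1 := fun y n v => by
  have := (hasEndParity_iff 0 _).1 (h.hasEndParity y) n v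
  rwa [zero_add] at this

theorem IsLeibniz.isOddEnd {T : SuperEnd (V := V) 𝕜 Fp Ep Fm Em} (h : IsLeibniz 0 1 (actOp T)) :
    IsOddEnd T.1 := fun y n v => by
  have := (hasEndParity_iff 1 _).1 (h.hasEndParity y) n v
  exact ⟨fun hn => this.1 (odd_one.add_odd hn), fun hn => this.2 (odd_one.add_even hn)⟩

namespace PrimitiveSuperconnection

variable (𝔸 : PrimitiveSuperconnection 𝕜 V Fp Ep Fm Em) (σ : SymplecticForm V M)

theorem commute_aeval_op_sq (f : Polynomial 𝕜) :
    Commute (𝔸.op σ) (Polynomial.aeval (𝔸.op σ ^ 2) f) :=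
  commute_aeval ((Commute.refl _).pow_right 2) f

theorem isPairOp_aeval_op_sq (f : Polynomial 𝕜) :
    IsPairOp 0 (Polynomial.aeval (𝔸.op σ ^ 2) f) :=
  aeval_mem_subalgebra (E := evenPairOps 𝕜 V Fp Ep Fm Em) (𝔸.isPairOp_op_sq σ) f

end PrimitiveSuperconnection

namespace IsSmoothPrimitiveFamily

variable {𝔸 : ℝ → PrimitiveSuperconnection 𝕜 V Fp Ep Fm Em} (h𝔸 : IsSmoothPrimitiveFamily 𝔸)
  (σ : SymplecticForm V M) (t : ℝ)

/-- The family `f(𝔸²)` is differentiable, and its derivative has the same supertrace as the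
supercommutator of `𝔸` with `𝔸̇ f'(𝔸²)`. -/
theorem exists_hasPairDeriv_aeval (f : Polynomial 𝕜) :
    ∃ D, HasPairDeriv (fun s => Polynomial.aeval ((𝔸 s).op σ ^ 2) f) D t ∧
      pairStr D = pairStr ((𝔸 t).op σ * (h𝔸.deriv t *
        Polynomial.aeval ((𝔸 t).op σ ^ 2) (Polynomial.derivative f)) + h𝔸.deriv t *
        Polynomial.aeval ((𝔸 t).op σ ^ 2) (Polynomial.derivative f) * (𝔸 t).op σ) := by
  exact exists_deriv_aeval_sq (E := evenPairOps 𝕜 V Fp Ep Fm Em) (τ := pairStr) (t := t)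
    (H := fun X X' => HasPairDeriv X X' t) (fun X hX Y hY => pairStr_add hX hY)
    (fun X hX Y hY => pairStr_mul_comm hX hY) (fun X X' h => h.isPairOp)
    (fun c => IsPairOp.hasPairDeriv_const ((evenPairOps 𝕜 V Fp Ep Fm Em).algebraMap_mem c))
    (fun X X' Y Y' h h' => h.add h') (fun X X' Y Y' h h' => h.mul h')
    ((𝔸 t).isPairOp_op_sq σ) (h𝔸.hasPairDeriv_op_sq σ t) f

/-- The derivative of the supertrace of `f(𝔸²)` is the boundary of the supertrace of `𝔸̇ f'(𝔸²)`. -/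
theorem hasDerivAt_pairStr_aeval (f : Polynomial 𝕜) (x : M) (n : ℕ)
    (v : Fin n → TangentSpace 𝓘(ℝ, V) x) :
    HasDerivAt (fun s => (pairStr (Polynomial.aeval ((𝔸 s).op σ ^ 2) f)).1.1 x n v)
      ((boundary σ (pairStr (h𝔸.deriv t *
        Polynomial.aeval ((𝔸 t).op σ ^ 2) (Polynomial.derivative f)))).1 x n v) t ∧
    HasDerivAt (fun s => (pairStr (Polynomial.aeval ((𝔸 s).op σ ^ 2) f)).2.1 x n v)
      ((boundary σ (pairStr (h𝔸.deriv t *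
        Polynomial.aeval ((𝔸 t).op σ ^ 2) (Polynomial.derivative f)))).2 x n v) t := by
  obtain ⟨D, hD, e⟩ := h𝔸.exists_hasPairDeriv_aeval σ t f
  have h := ((𝔸 t).isPairOp_anticommutator σ ((h𝔸.isPairOp_deriv t).mul
    ((𝔸 t).isPairOp_aeval_op_sq σ (Polynomial.derivative f)))).2
  rw [← e] at h
  rw [← h]
  exact hD.hasDerivAt_pairStr x n v

end IsSmoothPrimitiveFamily

end Superconnections

end

end PrimitiveChernWeil

theorem mainTheorem1
    {𝕜 : Type*} [RCLike 𝕜]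
    {V : Type*} [NormedAddCommGroup V] [NormedSpace ℝ V] [FiniteDimensional ℝ V]
    {M : Type*} [TopologicalSpace M] [ChartedSpace V M] [IsManifold 𝓘(ℝ, V) ∞ M] [T2Space M]
    {Fp : Type*} [NormedAddCommGroup Fp] [NormedSpace ℝ Fp] [NormedSpace 𝕜 Fp]
    [IsScalarTower ℝ 𝕜 Fp] [FiniteDimensional 𝕜 Fp]
    {Ep : M → Type*} [TopologicalSpace (TotalSpace Fp Ep)]
    [∀ x, AddCommGroup (Ep x)] [∀ x, Module ℝ (Ep x)] [∀ x, Module 𝕜 (Ep x)]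
    [∀ x, IsScalarTower ℝ 𝕜 (Ep x)] [∀ x, TopologicalSpace (Ep x)] [FiberBundle Fp Ep]
    [VectorBundle ℝ Fp Ep] [VectorBundle 𝕜 Fp Ep] [ContMDiffVectorBundle ∞ Fp Ep 𝓘(ℝ, V)]
    {Fm : Type*} [NormedAddCommGroup Fm] [NormedSpace ℝ Fm] [NormedSpace 𝕜 Fm]
    [IsScalarTower ℝ 𝕜 Fm] [FiniteDimensional 𝕜 Fm]
    {Em : M → Type*} [TopologicalSpace (TotalSpace Fm Em)]
    [∀ x, AddCommGroup (Em x)] [∀ x, Module ℝ (Em x)] [∀ x, Module 𝕜 (Em x)]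
    [∀ x, IsScalarTower ℝ 𝕜 (Em x)] [∀ x, TopologicalSpace (Em x)] [FiberBundle Fm Em]
    [VectorBundle ℝ Fm Em] [VectorBundle 𝕜 Fm Em] [ContMDiffVectorBundle ∞ Fm Em 𝓘(ℝ, V)]
    (σ : SymplecticForm V M)
    (𝔸 : ℝ → PrimitiveSuperconnection 𝕜 V Fp Ep Fm Em) (h𝔸 : IsSmoothPrimitiveFamily 𝔸) :
    (∀ (t : ℝ) (k : ℕ), ∃ P : SuperEnd (V := V) 𝕜 Fp Ep Fm Em × SuperEnd (V := V) 𝕜 Fp Ep Fm Em,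
      IsEvenEnd P.1.1 ∧ IsOddEnd P.2.1 ∧
        ∀ P', pairOp P' = (𝔸 t).op σ ^ (2 * k) ↔ P' = P) ∧
    (∀ (t : ℝ) (k : ℕ), 1 ≤ k →
      ∃ Q : SuperEnd (V := V) 𝕜 Fp Ep Fm Em × SuperEnd (V := V) 𝕜 Fp Ep Fm Em,
      IsOddEnd Q.1.1 ∧ IsEvenEnd Q.2.1 ∧
        ∀ Q', pairOp Q' = h𝔸.deriv t * (𝔸 t).op σ ^ (2 * k - 2) ↔ Q' = Q) ∧
    ∀ (f : Polynomial 𝕜) (t : ℝ),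
      boundary σ (pairStr (Polynomial.aeval ((𝔸 t).op σ ^ 2) f)) = 0 ∧
      ∀ (x : M) (n : ℕ) (v : Fin n → TangentSpace 𝓘(ℝ, V) x),
        HasDerivAt (fun s => (pairStr (Polynomial.aeval ((𝔸 s).op σ ^ 2) f)).1.1 x n v)
          ((boundary σ (pairStr (h𝔸.deriv t *
            Polynomial.aeval ((𝔸 t).op σ ^ 2) (Polynomial.derivative f)))).1 x n v) t ∧
        HasDerivAt (fun s => (pairStr (Polynomial.aeval ((𝔸 s).op σ ^ 2) f)).2.1 x n v)
          ((boundary σ (pairStr (h𝔸.deriv t *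
            Polynomial.aeval ((𝔸 t).op σ ^ 2) (Polynomial.derivative f)))).2 x n v) t := by
  refine ⟨fun t k => ?_, fun t k hk => ?_, fun f t => ⟨?_, fun x n v => ?_⟩⟩
  · have h := ((𝔸 t).isPairOp_op_sq σ).pow k
    rw [← pow_mul] at h
    obtain ⟨P, hP, e⟩ := h
    refine ⟨P, hP.1.isEvenEnd, hP.2.isOddEnd, fun P' => ?_⟩
    rw [← e]
    exact pairOp_injective.eq_iff
  · have h := (h𝔸.isPairOp_deriv t).mul (((𝔸 t).isPairOp_op_sq σ).pow (k - 1))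
    rw [← pow_mul, Nat.mul_sub, mul_one] at h
    obtain ⟨Q, hQ, e⟩ := h
    refine ⟨Q, hQ.1.isOddEnd, (hQ.2.congr (by decide)).isEvenEnd, fun Q' => ?_⟩
    rw [← e]
    exact pairOp_injective.eq_iff
  · exact (𝔸 t).boundary_pairStr_eq_zero σ ((𝔸 t).isPairOp_aeval_op_sq σ f)
      ((𝔸 t).commute_aeval_op_sq σ f)
  · exact h𝔸.hasDerivAt_pairStr_aeval σ t f x n v
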